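/- **Theorem.** *Setting.* Fix a local dimension $d$ and a number of outcomes $q$ (for qubits and two-outcome measurements $d=q=2$). Let $n\ge 3$ and let $|\psi\rangle\in(\mathbb C^d)^{\otimes n}$ be a unit vector. A *subcubic tree* for $n$ parties is a tree $T$ in which every vertex has one or three neighbours and whose leaves are identified with the $n$ parties; deleting an edge $e$ splits the parties into $(A_T^e,B_T^e)$, and $\chi_{A_T^e,B_T^e}(|\psi\rangle)$ is the Schmidt rank for this bipartition. The *Schmidt-rank width* is $$\chi:=\chi_{\mathrm{wd}}(|\psi\rangle)=\min_T\max_{e\in T}\log_2\chi_{A^e_T,B^e_T}(|\psi\rangle).$$ A *tree tensor network (TTN)* of $|\psi\rangle$ over $T$ consists of a dimension for every edge (equal to $d$ on the edges at the leaves) and a tensor at every non-leaf vertex, with one index for each of its three edges, such that summing the product of all tensors over the indices of all edges not incident with a leaf gives the coefficients of $|\psi\rangle$ in the product basis. It is called *optimal* if $T$ attains the minimum in the definition of $\chi$ and all summed indices have dimension at most $2^{\chi}$. A *measurement-based quantum computation (MQC)* on $|\psi\rangle$ is an adaptive protocol of local measurements: the outcomes obtained so far determine a party and a measurement $\{K_s\}_{s<q}$,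 $\sum_s K_s^\dagger K_s=1$, $K_s\in\mathbb C^{d\times d}$, on this party (for instance a projective measurement in a basis), or that the protocol stops. The classical computer is a random access machine with unit-cost exact complex arithmetic, whose memory initially holds the tree and the tensors of the network. It *simulates all MQC on $|\psi\rangle$ in time $\tau$* if 1. for every protocol, it produces online, from one fresh uniform random number in $[0,1)$ per measurement, outcomes distributed exactly by Born's rule, each measurement taking at most $\tau$ steps; 2. for every sequence of at most $n$ local operators $K_1,\dots,K_r$ on parties $j_1,\dots,j_r$ (such as those along a complete run of an MQC that measures every party once), it computes the probability $\|K_r\cdots K_1|\psi\rangle\|^2$ in at most $\tau$ steps altogether. *Claim.* There are a simulator (a fixed pair of programs, one for each of the two tasks) and constants $C,k$, depending only on $d$ and $q$, such that: * for all $n\ge3$, all unit vectors $|\psi\rangle$ and every optimal TTN of $|\psi\rangle$, given this network the simulator simulates all MQC on $|\psi\rangle$ in time $C\,n\,(2^{\chi})^{k}$; * for every $c$ there is $C'$ such that every $|\psi\rangle$ with $\chi_{\mathrm{wd}}(|\psi\rangle)\le c$ has an optimal TTN from which all MQC on $|\psi\rangle$ are simulated in time $C'n$; * for every $c$ there are $C',k'$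 such that every $|\psi\rangle$ with $\chi_{\mathrm{wd}}(|\psi\rangle)\le c\log_2 n$ has an optimal TTN from which all MQC on $|\psi\rangle$ are simulated in time $C'n^{k'}$. -/

import Mathlib

namespace MQC

/-! ### States, subcubic trees and the Schmidt-rank width -/

/-- Coefficients, in the product basis, of a vector of `n` parties with local dimension `d`. -/
abbrev State (n d : ℕ) : Type := (Fin n → Fin d) → ℂ

/-- Squared Hilbert space norm. -/
noncomputable def State.normSq {n d : ℕ} (ψ : State n d) : ℝ := ∑ x, ‖ψ x‖ ^ 2

/-- A tree all of whose vertices have one or three neighbours, whose leaves (vertices with one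
neighbour) are identified with the `n` parties. -/
structure SubcubicTree (n : ℕ) where
  m : ℕ
  graph : SimpleGraph (Fin m)
  isTree : graph.IsTree
  subcubic : ∀ v, (graph.neighborSet v).ncard = 1 ∨ (graph.neighborSet v).ncard = 3
  leaf : Fin n ≃ {v : Fin m // (graph.neighborSet v).ncard = 1}

/-- The vertices that are not leaves. -/
abbrev SubcubicTree.Inner {n : ℕ} (T : SubcubicTree n) : Type :=
  {v : Fin T.m // (T.graph.neighborSet v).ncard = 3}

/-- The parties in the connected component of `a` after deleting the edge `{a, b}`. -/
def SubcubicTree.side {n : ℕ} (T : SubcubicTree n) (a b : Fin T.m) : Set (Fin n) :=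
  {l | (T.graph.deleteEdges {s(a, b)}).Reachable a (T.leaf l)}

open Classical in
/-- The Schmidt rank of `ψ` for the bipartition `(A, Aᶜ)`: the rank of the matrix of coefficients
with rows indexed by the basis of `A` and columns by the basis of `Aᶜ`. -/
noncomputable def schmidtRank {n d : ℕ} (ψ : State n d) (A : Set (Fin n)) : ℕ :=
  (Matrix.of fun (a : A → Fin d) (b : (Aᶜ : Set (Fin n)) → Fin d) =>
    ψ fun l => if h : l ∈ A then a ⟨l, h⟩ else b ⟨l, h⟩).rank

/-- The maximum over all edges of `T` of the logarithm of the Schmidt rank. A dart is an edge with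
an orientation; both orientations give the same Schmidt rank. -/
noncomputable def SubcubicTree.width {n d : ℕ} (T : SubcubicTree n) (ψ : State n d) : ℝ :=
  ⨆ e : T.graph.Dart, Real.logb 2 (schmidtRank ψ (T.side e.fst e.snd))

/-- The Schmidt-rank width. -/
noncomputable def chiWidth {n d : ℕ} (ψ : State n d) : ℝ :=
  ⨅ T : SubcubicTree n, T.width ψ

/-! ### Tree tensor networks -/

/-- A tensor network with underlying tree `T`. Every edge carries an index with values in
`0, …, dim e - 1`; the index of an edge at a leaf is open and belongs to the party at this leaf.
Every inner vertex carries a tensor with one index for each of its three edges (its entries at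
indices out of range play no role). -/
structure TTN {n : ℕ} (T : SubcubicTree n) (d : ℕ) where
  dim : Sym2 (Fin T.m) → ℕ
  dim_open : ∀ (l : Fin n) (w : Fin T.m), T.graph.Adj (T.leaf l) w → dim s(↑(T.leaf l), w) = d
  tensor : (v : T.Inner) → (T.graph.neighborSet v → ℕ) → ℂ

variable {n d : ℕ}

open Classical in
/-- The contraction of the network: the open indices are fixed by `x`, all other indices are
summed over. -/
noncomputable def TTN.contract {T : SubcubicTree n} (N : TTN T d) : State n d := fun x =>
  ∑ σ ∈ Fintype.piFinset fun e : T.graph.edgeSet => Finset.range (N.dim e),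
    if ∀ (l : Fin n) (w : Fin T.m) (h : T.graph.Adj (T.leaf l) w),
        σ ⟨s(↑(T.leaf l), w), h⟩ = (x l : ℕ) then
      ∏ v : T.Inner, N.tensor v fun w => σ ⟨s(↑v, ↑w), w.2⟩
    else 0

/-- `N` is a tree tensor network of `ψ` over a tree that attains the minimum in the Schmidt-rank
width, and its contracted indices have dimension at most `2 ^ χ`. -/
structure TTN.IsOptimalFor {T : SubcubicTree n} (N : TTN T d) (ψ : State n d) : Prop where
  optimal : T.width ψ = chiWidth ψ
  represents : N.contract = ψ
  dim_le : ∀ v w : T.Inner, T.graph.Adj v w → (N.dim s(↑v, ↑w) : ℝ) ≤ (2 : ℝ) ^ chiWidth ψ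

/-! ### Measurement-based computation: adaptive local measurements -/

/-- A linear operator on the system of one party. -/
structure LocalOp (n d : ℕ) where
  party : Fin n
  op : Matrix (Fin d) (Fin d) ℂ

def LocalOp.apply (K : LocalOp n d) (ψ : State n d) : State n d := fun x =>
  ∑ y, K.op (x K.party) y * ψ (Function.update x K.party y)

/-- Applies a list of local operators, the head of the list last. -/
def applyOps : List (LocalOp n d) → State n d → State n d
  | [], ψ => ψ
  | K :: Ks, ψ => K.apply (applyOps Ks ψ)

/-- A (generalized) measurement on one party with outcomes in `Fin q`: outcome `s` maps `φ` to
`kraus s φ`. Projective measurements in a basis are the case `kraus s = |u_s⟩⟨u_s|`. -/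
structure LocalMeasurement (n d q : ℕ) where
  party : Fin n
  kraus : Fin q → Matrix (Fin d) (Fin d) ℂ
  complete : ∑ s, (kraus s).conjTranspose * kraus s = 1

/-- An adaptive protocol: the outcomes obtained so far (latest first) determine the next local
measurement, or that the protocol stops. -/
abbrev Protocol (n d q : ℕ) : Type := List (Fin q) → Option (LocalMeasurement n d q)

/-- The operators that have acted (latest first) when the outcomes are `h`; `none` if the protocol
stops before. -/
def Protocol.record {q : ℕ} (Λ : Protocol n d q) : List (Fin q) → Option (List (LocalOp n d))
  | [] => some []
  | s :: h => (Λ.record h).bind fun Ks => (Λ h).map fun M => ⟨M.party, M.kraus s⟩ :: Ks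

/-- Born's rule: the probability that the first `h.length` outcomes of the protocol on `ψ`
are `h`. -/
noncomputable def Protocol.born {q : ℕ} (Λ : Protocol n d q) (ψ : State n d) (h : List (Fin q)) :
    ℝ :=
  match Λ.record h with
  | some Ks => (applyOps Ks ψ).normSq
  | none => 0

/-! ### The classical computer: a random access machine with exact complex arithmetic -/

/-- Memory: arrays of natural numbers with two indices, and arrays of complex numbers with four
indices. The first argument is the name of the array. -/
structure Store where
  idx : ℕ → ℕ → ℕ → ℕ
  num : ℕ → ℕ → ℕ → ℕ → ℕ → ℂ

/-- Expressions with natural values. -/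
inductive IExp
  | lit (c : ℕ)
  | get (a : ℕ) (i j : IExp)
  | add (e f : IExp)
  | sub (e f : IExp)

def IExp.eval (s : Store) : IExp → ℕ
  | lit c => c
  | get a i j => s.idx a (i.eval s) (j.eval s)
  | add e f => e.eval s + f.eval s
  | sub e f => e.eval s - f.eval s

/-- Expressions with complex values. -/
inductive CExp
  | zero
  | one
  | get (a : ℕ) (i j k l : IExp)
  | add (e f : CExp)
  | mul (e f : CExp)
  | neg (e : CExp)
  | inv (e : CExp)
  | conj (e : CExp)

noncomputable def CExp.eval (s : Store) : CExp → ℂ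
  | zero => 0
  | one => 1
  | get a i j k l => s.num a (i.eval s) (j.eval s) (k.eval s) (l.eval s)
  | add e f => e.eval s + f.eval s
  | mul e f => e.eval s * f.eval s
  | neg e => -e.eval s
  | inv e => (e.eval s)⁻¹
  | conj e => (starRingEnd ℂ) (e.eval s)

/-- Tests: comparison of natural numbers, and of real parts of complex numbers. -/
inductive Test
  | eq (i j : IExp)
  | lt (i j : IExp)
  | ltRe (x y : CExp)

def Test.holds (s : Store) : Test → Prop
  | eq i j => i.eval s = j.eval s
  | lt i j => i.eval s < j.eval s
  | ltRe x y => (x.eval s).re < (y.eval s).re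

/-- Programs. -/
inductive Cmd
  | setI (a : ℕ) (i j e : IExp)
  | setC (a : ℕ) (i j k l : IExp) (e : CExp)
  | seq (c c' : Cmd)
  | ite (b : Test) (c c' : Cmd)
  | loop (b : Test) (c : Cmd)

open Classical in
/-- One step of the machine. The list holds the commands still to be executed. Assignments and
tests count as one step each; the expressions in a given program have a fixed size, so this is the
number of elementary operations up to a constant factor. -/
noncomputable def step : List Cmd × Store → List Cmd × Store
  | ([], s) => ([], s)
  | (.setI a i j e :: r, s) =>
    (r, { s with
      idx := fun a' i' j' =>
        if a' = a ∧ i' = i.eval s ∧ j' = j.eval s then e.eval s else s.idx a' i' j' })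
  | (.setC a i j k l e :: r, s) =>
    (r, { s with
      num := fun a' i' j' k' l' =>
        if a' = a ∧ i' = i.eval s ∧ j' = j.eval s ∧ k' = k.eval s ∧ l' = l.eval s then e.eval s
        else s.num a' i' j' k' l' })
  | (.seq c c' :: r, s) => (c :: c' :: r, s)
  | (.ite b c c' :: r, s) => if b.holds s then (c :: r, s) else (c' :: r, s)
  | (.loop b c :: r, s) => if b.holds s then (c :: .loop b c :: r, s) else (r, s)

/-- The final memory of `P` started with memory `s`, if `P` halts within `τ` steps. -/
noncomputable def exec (P : Cmd) (τ : ℕ) (s : Store) : Option Store :=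
  match step^[τ] ([P], s) with
  | ([], s') => some s'
  | (_ :: _, _) => none

/-! ### Input and output -/

open Classical in
/-- The neighbours of `v` in increasing order. -/
noncomputable def SubcubicTree.nbrs (T : SubcubicTree n) (v : Fin T.m) : List (Fin T.m) :=
  ((T.graph.neighborSet v).toFinset).sort (· ≤ ·)

open Classical in
/-- The network in the memory of the machine.

* `idx 0 0 0`: number of vertices; `idx 0 0 1`: number of parties;
* `idx 1 v t`: the `t`-th neighbour of the vertex `v`; `idx 2 v 0`: the number of neighbours of `v`;
* `idx 3 v t`: the dimension of the index on the edge from `v` to its `t`-th neighbour;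
* `idx 4 l 0`: the leaf of the party `l`;
* `num 0 v i j k`: the entry of the tensor at `v` with values `i`, `j`, `k` of the indices on the
  edges to its neighbours number `0`, `1`, `2`.

All other cells are zero. -/
noncomputable def TTN.encode {T : SubcubicTree n} (N : TTN T d) : Store where
  idx a i j :=
    if a = 0 ∧ i = 0 ∧ j = 0 then T.m
    else if a = 0 ∧ i = 0 ∧ j = 1 then n
    else if a = 4 ∧ j = 0 then
      if h : i < n then ((T.leaf ⟨i, h⟩ : Fin T.m) : ℕ) else 0
    else if hv : i < T.m then
      if a = 2 ∧ j = 0 then (T.nbrs ⟨i, hv⟩).length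
      else if ht : j < (T.nbrs ⟨i, hv⟩).length then
        if a = 1 then (((T.nbrs ⟨i, hv⟩)[j] : Fin T.m) : ℕ)
        else if a = 3 then N.dim s(⟨i, hv⟩, (T.nbrs ⟨i, hv⟩)[j])
        else 0
      else 0
    else 0
  num a v i j k :=
    if hv : v < T.m then
      if hi : (T.graph.neighborSet ⟨v, hv⟩).ncard = 3 then
        let value : T.graph.neighborSet ⟨v, hv⟩ → ℕ := fun w =>
          [i, j, k].getD ((T.nbrs ⟨v, hv⟩).idxOf ↑w) 0
        if a = 0 ∧ ∀ w, value w < N.dim s(⟨v, hv⟩, ↑w) then N.tensor ⟨⟨v, hv⟩, hi⟩ value else 0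
      else 0
    else 0

/-- Presents the measurement `M` and a random number `u` to the machine: `idx 5 0 0` is the party,
`num 1 s a b 0` the entry `(a, b)` of the operator of outcome `s`, `num 2 0 0 0 0` is `u`. The rest
of the memory is kept. -/
noncomputable def Store.present {q : ℕ} (s : Store) (M : LocalMeasurement n d q) (u : ℝ) : Store where
  idx a i j := if a = 5 then (if i = 0 ∧ j = 0 then (M.party : ℕ) else 0) else s.idx a i j
  num a i j k l :=
    if a = 1 then
      if h : i < q ∧ j < d ∧ k < d ∧ l = 0 then M.kraus ⟨i, h.1⟩ ⟨j, h.2.1⟩ ⟨k, h.2.2.1⟩ else 0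
    else if a = 2 then (if i = 0 ∧ j = 0 ∧ k = 0 ∧ l = 0 then (u : ℂ) else 0)
    else s.num a i j k l

/-- Presents a list of local operators (latest first) to the machine: `idx 5 0 0` is their number,
and for the `t`-th operator in chronological order `idx 6 t 0` is the party and `num 1 t a b 0` the
entry `(a, b)`. -/
def Store.presentList (s : Store) (Ks : List (LocalOp n d)) : Store where
  idx a i j :=
    if a = 5 then (if i = 0 ∧ j = 0 then Ks.length else 0)
    else if a = 6 then
      if h : i < Ks.reverse.length ∧ j = 0 then ((Ks.reverse[i]'h.1).party : ℕ) else 0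
    else s.idx a i j
  num a i j k l :=
    if a = 1 then
      if h : i < Ks.reverse.length ∧ j < d ∧ k < d ∧ l = 0 then
        (Ks.reverse[i]'h.1).op ⟨j, h.2.1⟩ ⟨k, h.2.2.1⟩
      else 0
    else s.num a i j k l

/-! ### Classical simulation -/

/-- The programs of a simulation: `sampler` is called for each measurement of a protocol and returns
an outcome in `idx 7 0 0`; `evaluator` is called once and returns a number in `num 3 0 0 0 0`. -/
structure Simulator where
  sampler : Cmd
  evaluator : Cmd

/-- The outcomes (latest first) and the memory after `r` rounds of the simulation of the protocol
`Λ`, when each round may take `τ` steps and uses one entry of `u` as its random number; `none` if a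
round takes more time or returns no outcome. Nothing changes any more once the protocol stops. -/
noncomputable def Simulator.play {q : ℕ} (S : Simulator) (s₀ : Store) (τ : ℕ)
    (Λ : Protocol n d q) : (r : ℕ) → (Fin r → ℝ) → Option (List (Fin q) × Store)
  | 0, _ => some ([], s₀)
  | r + 1, u =>
    (S.play s₀ τ Λ r (Fin.init u)).bind fun (h, s) =>
      match Λ h with
      | none => some (h, s)
      | some M =>
        (exec S.sampler τ (s.present M (u (Fin.last r)))).bind fun s' =>
          if hq : s'.idx 7 0 0 < q then some (⟨s'.idx 7 0 0, hq⟩ :: h, s') else none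

/-- Started from the description `s₀`, the simulator simulates all adaptive protocols of local
measurements with `q` outcomes on `ψ`, with time overhead `τ`:

* each measurement of a protocol takes at most `τ` steps;
* for independent uniform random numbers in `[0, 1)`, the outcomes are distributed by Born's rule;
* the probability of a complete sequence of outcomes, with up to one measurement per party on
  average, is computed in at most `τ` steps altogether. -/
structure Simulator.Simulates (S : Simulator) (q : ℕ) (s₀ : Store) (ψ : State n d) (τ : ℕ) :
    Prop where
  inTime : ∀ (Λ : Protocol n d q) (r : ℕ) (u : Fin r → ℝ), (∀ t, u t ∈ Set.Ico (0 : ℝ) 1) →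
    (S.play s₀ τ Λ r u).isSome
  law : ∀ (Λ : Protocol n d q) (h : List (Fin q)),
    MeasureTheory.volume {u : Fin h.length → ℝ | (∀ t, u t ∈ Set.Ico (0 : ℝ) 1) ∧
      ∃ s, S.play s₀ τ Λ h.length u = some (h, s)} = ENNReal.ofReal (Λ.born ψ h)
  prob : ∀ Ks : List (LocalOp n d), Ks.length ≤ n →
    ∃ s, exec S.evaluator τ (s₀.presentList Ks) = some s ∧
      s.num 3 0 0 0 0 = ((applyOps Ks ψ).normSq : ℂ)

end MQC

/-! Operators on different parties commute and those on one party multiply to a single matrix. Hence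
`‖K_r ⋯ K_1 ψ‖²` is the sum over `y`, `y'` of `ψ(y) conj ψ(y')` times a product over the parties of
Gram matrices (`normSq_applyOps`). Inserting the network for both copies of `ψ` gives a network over
the same tree whose edge indices are pairs. A network over a tree is contracted by messages towards
one leaf (`marginal_tree`, `TTN.normSq_eq_message`). The message of an inner vertex is a matrix
indexed by the pair on its parent edge, and each entry is a sum over one pair for each of the two
children, so it costs `O(D^6)` if all dimensions are at most `D`. A subcubic tree with `n` leaves
has `2n - 2` vertices, so one probability costs `O(n D^6)`, with `D = d⌊2^χ⌋` for an optimal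
network.

The evaluator is one such contraction. The sampler keeps the operators that have acted, with
resulting unnormalized state `φ`. It computes the partial sums of `‖K_s φ‖²`, which end at `‖φ‖²` by
completeness, and inverts this distribution function at the random number (`runs_samplerCmd`). By
induction on the history, the random numbers that lead to given outcomes form the set for the
earlier outcomes times an interval whose length is the conditional probability, so the volumes
multiply to Born's rule (`simulator_law`). Histories of probability zero are never reached, because
the chosen interval is never empty (`play_ready`).

Optimal networks exist because the widths take finitely many values, and because a cut of rank `r`
admits `r` configurations of the parties below it from which `ψ` is interpolated linearly
(`exists_interpolates`). The tensor at a vertex consists of its interpolation coefficients at the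
configurations glued together from those of its two children (`SubcubicTree.exists_ttn`). For `χ ≤
c` the time bound is then linear in `n`, and for `χ ≤ c log₂ n` it is polynomial.

The programs are verified in a Hoare logic that counts steps (`Triple`). -/

namespace MQC

/-! ### Program logic with step counts. -/

/-! ### Execution of commands with a bound on the number of steps -/

/-- Started on `s`, the command `c` terminates within `B` steps with memory `s'`. -/
def Runs (c : Cmd) (s s' : Store) (B : ℕ) : Prop :=
  ∃ t ≤ B, ∀ r, step^[t] (c :: r, s) = (r, s')

def Store.setI (s : Store) (a i j v : ℕ) : Store :=
  { s with idx := fun a' i' j' => if a' = a ∧ i' = i ∧ j' = j then v else s.idx a' i' j' }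

abbrev Idx : Type := ℕ → ℕ → ℕ → ℕ

abbrev Num : Type := ℕ → ℕ → ℕ → ℕ → ℕ → ℂ

def Num.set (y : Num) (a i j k l : ℕ) (z : ℂ) : Num := fun a' i' j' k' l' =>
  if a' = a ∧ i' = i ∧ j' = j ∧ k' = k ∧ l' = l then z else y a' i' j' k' l'

theorem Runs.mono {c : Cmd} {s s' : Store} {B B' : ℕ} (h : Runs c s s' B) (hB : B ≤ B') :
    Runs c s s' B' := by
  obtain ⟨t, ht, h⟩ := h
  exact ⟨t, ht.trans hB, h⟩

theorem runs_setI (a : ℕ) (i j e : IExp) (s : Store) :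
    Runs (.setI a i j e) s (s.setI a (i.eval s) (j.eval s) (e.eval s)) 1 :=
  ⟨1, le_rfl, fun _ => rfl⟩

theorem runs_setC (a : ℕ) (i j k l : IExp) (e : CExp) (s : Store) :
    Runs (.setC a i j k l e) s
      ⟨s.idx, Num.set s.num a (i.eval s) (j.eval s) (k.eval s) (l.eval s) (e.eval s)⟩ 1 :=
  ⟨1, le_rfl, fun _ => rfl⟩

/-- The run of `c` is the same whatever commands wait behind it, because `Runs` quantifies over the
rest `r`; here `c'` waits. The extra step unfolds `seq`. -/
theorem Runs.seq {c c' : Cmd} {s s' s'' : Store} {B B' : ℕ} (h : Runs c s s' B)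
    (h' : Runs c' s' s'' B') : Runs (.seq c c') s s'' (B + B' + 1) := by
  obtain ⟨t, ht, h⟩ := h
  obtain ⟨t', ht', h'⟩ := h'
  refine ⟨t' + (t + 1), by omega, fun r => ?_⟩
  rw [Function.iterate_add_apply, Function.iterate_add_apply]
  simp only [Function.iterate_one, step]
  rw [h, h']

theorem Runs.ite_true {b : Test} {c c' : Cmd} {s s' : Store} {B : ℕ} (hb : b.holds s)
    (h : Runs c s s' B) : Runs (.ite b c c') s s' (B + 1) := by
  obtain ⟨t, ht, h⟩ := h
  refine ⟨t + 1, by omega, fun r => ?_⟩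
  rw [Function.iterate_add_apply]
  simp only [Function.iterate_one, step, if_pos hb]
  exact h r

theorem Runs.ite_false {b : Test} {c c' : Cmd} {s s' : Store} {B : ℕ} (hb : ¬ b.holds s)
    (h : Runs c' s s' B) : Runs (.ite b c c') s s' (B + 1) := by
  obtain ⟨t, ht, h⟩ := h
  refine ⟨t + 1, by omega, fun r => ?_⟩
  rw [Function.iterate_add_apply]
  simp only [Function.iterate_one, step, if_neg hb]
  exact h r

theorem runs_loop_false {b : Test} {c : Cmd} {s : Store} (hb : ¬ b.holds s) :
    Runs (.loop b c) s s 1 := by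
  refine ⟨1, le_rfl, fun r => ?_⟩
  simp [step, hb]

theorem Runs.loop_true {b : Test} {c : Cmd} {s s' s'' : Store} {B B' : ℕ} (hb : b.holds s)
    (h : Runs c s s' B) (h' : Runs (.loop b c) s' s'' B') :
    Runs (.loop b c) s s'' (B + B' + 1) := by
  obtain ⟨t, ht, h⟩ := h
  obtain ⟨t', ht', h'⟩ := h'
  refine ⟨t' + (t + 1), by omega, fun r => ?_⟩
  rw [Function.iterate_add_apply, Function.iterate_add_apply]
  simp only [Function.iterate_one, step, if_pos hb]
  rw [h, h']

/-- A halted machine is a fixed point of `step`, so spare time does no harm. -/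
theorem Runs.exec {c : Cmd} {s s' : Store} {B : ℕ} (h : Runs c s s' B) {τ : ℕ} (hτ : B ≤ τ) :
    exec c τ s = some s' := by
  obtain ⟨t, ht, h⟩ := h
  have hfix : ∀ u, step^[u] ([], s') = ([], s') := fun u =>
    Function.iterate_fixed (by simp [step]) u
  have hτ' : τ = (τ - t) + t := by omega
  unfold MQC.exec
  rw [hτ', Function.iterate_add_apply, h, hfix]

/-- The variable `a` of the machine: the cell with indices `0`, `0` of the array `a`. -/
def IExp.var (a : ℕ) : IExp := .get a (.lit 0) (.lit 0)

/-- The command `c` for the values `0, …, bound - 1` of the variable `k`. -/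
def Cmd.forLoop (k : ℕ) (bound : IExp) (c : Cmd) : Cmd :=
  .seq (.setI k (.lit 0) (.lit 0) (.lit 0))
    (.loop (.lt (.var k) bound)
      (.seq c (.setI k (.lit 0) (.lit 0) (.add (.var k) (.lit 1)))))

def Cmd.letVar (k : ℕ) (e : IExp) (c : Cmd) : Cmd :=
  .seq (.setI k (.lit 0) (.lit 0) e) c

/-- `I i` describes the memory when the counter holds `i`. The bound is evaluated anew at every
test, hence `hN`, and the body has to leave the counter at `i`. A round costs three steps beyond the
body: test, sequencing and increment. -/
theorem runs_forLoop {k : ℕ} {bound : IExp} {c : Cmd} {N B : ℕ} (I : ℕ → Store → Prop)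
    {s : Store} (h0 : I 0 (s.setI k 0 0 0))
    (hv : ∀ i s', I i s' → s'.idx k 0 0 = i)
    (hN : ∀ i s', I i s' → bound.eval s' = N)
    (hc : ∀ i < N, ∀ s', I i s' → ∃ s'', Runs c s' s'' B ∧ s''.idx k 0 0 = i ∧
      I (i + 1) (s''.setI k 0 0 (i + 1))) :
    ∃ s', Runs (.forLoop k bound c) s s' (N * (B + 3) + 3) ∧ I N s' := by
  have key : ∀ r i, i + r = N → ∀ s', I i s' → ∃ s'',
      Runs (.loop (.lt (.var k) bound)
        (.seq c (.setI k (.lit 0) (.lit 0) (.add (.var k) (.lit 1))))) s' s''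
        (r * (B + 3) + 1) ∧ I N s'' := by
    intro r
    induction r with
    | zero =>
      intro i hi s' hs'
      obtain rfl : i = N := by omega
      refine ⟨s', (runs_loop_false ?_).mono (by omega), hs'⟩
      simp [Test.holds, IExp.var, IExp.eval, hv _ _ hs', hN _ _ hs']
    | succ r ih =>
      intro i hi s' hs'
      obtain ⟨s'', hr, hk, hs''⟩ := hc i (by omega) s' hs'
      obtain ⟨s₃, hr₃, hs₃⟩ := ih (i + 1) (by omega) _ hs''
      refine ⟨s₃, (Runs.loop_true ?_ (hr.seq ?_) hr₃).mono (B := (B + 1 + 1) + (r * (B + 3) + 1) + 1)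
        (by ring_nf; omega), hs₃⟩
      · simp only [Test.holds, IExp.var, IExp.eval, hv _ _ hs', hN _ _ hs']
        omega
      · have := runs_setI k (.lit 0) (.lit 0) (.add (.var k) (.lit 1)) s''
        simpa [IExp.var, IExp.eval, hk] using this
  obtain ⟨s', hr, hs'⟩ := key N 0 (by omega) _ h0
  refine ⟨s', ?_, hs'⟩
  exact ((runs_setI k (.lit 0) (.lit 0) (.lit 0) s).seq hr).mono (by omega)

/-! ### Programs that keep the arrays of natural numbers -/

/-- The arrays with names below `20` agree, and so do the variables with names between `20`
and `k`. -/
def Agree (k : ℕ) (ι ι' : Idx) : Prop :=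
  (∀ a < 20, ι a = ι' a) ∧ ∀ a < k, ι a 0 0 = ι' a 0 0

theorem Agree.refl (k : ℕ) (ι : Idx) : Agree k ι ι := ⟨fun _ _ => rfl, fun _ _ => rfl⟩

theorem Agree.trans {k : ℕ} {ι ι' ι'' : Idx} (h : Agree k ι ι') (h' : Agree k ι' ι'') :
    Agree k ι ι'' :=
  ⟨fun a ha => (h.1 a ha).trans (h'.1 a ha), fun a ha => (h.2 a ha).trans (h'.2 a ha)⟩

theorem Agree.mono {k k' : ℕ} {ι ι' : Idx} (h : Agree k ι ι') (hk : k' ≤ k) : Agree k' ι ι' :=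
  ⟨h.1, fun a ha => h.2 a (by omega)⟩

/-- The whole array is overwritten, not only the cell of the variable. This is harmless for names
from `20` on, of which `Agree` sees only the cell `0`, `0`. -/
def Idx.upd (ι : Idx) (k v : ℕ) : Idx := fun a => if a = k then fun _ _ => v else ι a

theorem Agree.upd {k : ℕ} {ι ι' : Idx} (h : Agree k ι ι') (hk : 20 ≤ k) {v : ℕ}
    (hv : ι k 0 0 = v) : Agree (k + 1) ι (ι'.upd k v) := by
  refine ⟨fun a ha => ?_, fun a ha => ?_⟩
  · simp [Idx.upd, show a ≠ k by omega, h.1 a ha]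
  · by_cases hak : a = k
    · subst hak; simp [Idx.upd, hv]
    · simp [Idx.upd, hak, h.2 a (by omega)]

theorem Agree.of_upd {k : ℕ} {ι ι' : Idx} {v : ℕ} (h : Agree (k + 1) ι (ι'.upd k v))
    (hk : 20 ≤ k) : Agree k ι ι' := by
  refine ⟨fun a ha => ?_, fun a ha => ?_⟩
  · simpa [Idx.upd, show a ≠ k by omega] using h.1 a ha
  · simpa [Idx.upd, show a ≠ k by omega] using h.2 a (by omega)

def IExp.isZero : IExp → Bool
  | .lit 0 => true
  | _ => false

/-- The expression uses only the arrays below `20` and the variables below `k`. -/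
def IExp.usesBelow (k : ℕ) : IExp → Bool
  | lit _ => true
  | get a i j => (decide (a < 20) && i.usesBelow k && j.usesBelow k) ||
      (decide (a < k) && i.isZero && j.isZero)
  | add e f => e.usesBelow k && f.usesBelow k
  | sub e f => e.usesBelow k && f.usesBelow k

/-- Evaluation in a fixed reference memory `ι`, to which the actual memory is only `Agree`-close.
For concrete programs it reduces definitionally, and `usesBelow` is Boolean, so that side conditions
are proved by `rfl`. -/
def IExp.val (ι : Idx) : IExp → ℕ
  | lit c => c
  | get a i j => ι a (i.val ι) (j.val ι)
  | add e f => e.val ι + f.val ι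
  | sub e f => e.val ι - f.val ι

theorem IExp.val_congr {k : ℕ} {ι ι' : Idx} (h : Agree k ι ι') {e : IExp}
    (he : e.usesBelow k = true) : e.val ι = e.val ι' := by
  induction e with
  | lit c => rfl
  | get a i j hi hj =>
    simp only [usesBelow, Bool.or_eq_true, Bool.and_eq_true, decide_eq_true_eq] at he
    rcases he with ⟨⟨ha, h1⟩, h2⟩ | ⟨⟨ha, h1⟩, h2⟩
    · simp only [val, hi h1, hj h2, h.1 a ha]
    · have hz : ∀ e : IExp, e.isZero = true → e = .lit 0 := by
        intro e he
        unfold isZero at he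
        split at he <;> simp_all
      rw [hz i h1, hz j h2]
      exact h.2 a ha
  | add e f h1 h2 =>
    simp only [usesBelow, Bool.and_eq_true] at he
    simp only [val, h1 he.1, h2 he.2]
  | sub e f h1 h2 =>
    simp only [usesBelow, Bool.and_eq_true] at he
    simp only [val, h1 he.1, h2 he.2]

theorem IExp.eval_eq_val (s : Store) (e : IExp) : e.eval s = e.val s.idx := by
  induction e with
  | lit c => rfl
  | get a i j hi hj => simp only [eval, val, hi, hj]
  | add e f h1 h2 => simp only [eval, val, h1, h2]
  | sub e f h1 h2 => simp only [eval, val, h1, h2]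

def CExp.usesBelow (k : ℕ) : CExp → Bool
  | zero => true
  | one => true
  | get _ i j l m => i.usesBelow k && j.usesBelow k && l.usesBelow k && m.usesBelow k
  | add e f => e.usesBelow k && f.usesBelow k
  | mul e f => e.usesBelow k && f.usesBelow k
  | neg e => e.usesBelow k
  | inv e => e.usesBelow k
  | conj e => e.usesBelow k

noncomputable def CExp.val (ι : Idx) (y : Num) : CExp → ℂ
  | zero => 0
  | one => 1
  | get a i j k l => y a (i.val ι) (j.val ι) (k.val ι) (l.val ι)
  | add e f => e.val ι y + f.val ι y
  | mul e f => e.val ι y * f.val ι y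
  | neg e => -e.val ι y
  | inv e => (e.val ι y)⁻¹
  | conj e => (starRingEnd ℂ) (e.val ι y)

theorem CExp.eval_eq_val {k : ℕ} {ι : Idx} {s : Store} (h : Agree k s.idx ι) {e : CExp}
    (he : e.usesBelow k = true) : e.eval s = e.val ι s.num := by
  induction e with
  | zero => rfl
  | one => rfl
  | get a i j l m =>
    simp only [usesBelow, Bool.and_eq_true] at he
    simp only [eval, val, IExp.eval_eq_val, IExp.val_congr h he.1.1.1, IExp.val_congr h he.1.1.2,
      IExp.val_congr h he.1.2, IExp.val_congr h he.2]
  | add e f h1 h2 =>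
    simp only [usesBelow, Bool.and_eq_true] at he
    simp only [eval, val, h1 he.1, h2 he.2]
  | mul e f h1 h2 =>
    simp only [usesBelow, Bool.and_eq_true] at he
    simp only [eval, val, h1 he.1, h2 he.2]
  | neg e h1 => simp only [eval, val, h1 he]
  | inv e h1 => simp only [eval, val, h1 he]
  | conj e h1 => simp only [eval, val, h1 he]

/-- If the arrays of natural numbers are `ι` up to scratch variables and the numbers satisfy `P`,
then `c` terminates within `B` steps, keeps the arrays of natural numbers up to scratch variables,
and the numbers satisfy `Q` afterwards. -/
def Triple (ι : Idx) (k : ℕ) (P : Num → Prop) (c : Cmd) (Q : Num → Prop) (B : ℕ) : Prop :=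
  ∀ s : Store, Agree k s.idx ι → P s.num →
    ∃ s', Runs c s s' B ∧ Agree k s'.idx ι ∧ Q s'.num

namespace Triple

variable {ι : Idx} {k B B' : ℕ} {P Q R : Num → Prop} {c c' : Cmd}

theorem mono (h : Triple ι k P c Q B) (hB : B ≤ B') : Triple ι k P c Q B' := by
  intro s hs hP
  obtain ⟨s', h1, h2⟩ := h s hs hP
  exact ⟨s', h1.mono hB, h2⟩

theorem conseq {P' Q' : Num → Prop} (h : Triple ι k P c Q B) (hP : ∀ y, P' y → P y)
    (hQ : ∀ y, Q y → Q' y) : Triple ι k P' c Q' B := by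
  intro s hs hs'
  obtain ⟨s', h1, h2, h3⟩ := h s hs (hP _ hs')
  exact ⟨s', h1, h2, hQ _ h3⟩

/-- Names the initial numbers, so that the postcondition can refer to them. -/
theorem of_eq (h : ∀ y, P y → Triple ι k (· = y) c Q B) : Triple ι k P c Q B :=
  fun s hs hP => h s.num hP s hs rfl

theorem seq (h : Triple ι k P c Q B) (h' : Triple ι k Q c' R B') :
    Triple ι k P (.seq c c') R (B + B' + 1) := by
  intro s hs hP
  obtain ⟨s', h1, h2, h3⟩ := h s hs hP
  obtain ⟨s'', h1', h2', h3'⟩ := h' s' h2 h3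
  exact ⟨s'', h1.seq h1', h2', h3'⟩

theorem setC {a : ℕ} {i j l m : IExp} {e : CExp}
    (hb : (i.usesBelow k && j.usesBelow k && l.usesBelow k && m.usesBelow k && e.usesBelow k) = true)
    (h : ∀ y, P y → Q (y.set a (i.val ι) (j.val ι) (l.val ι) (m.val ι) (e.val ι y))) :
    Triple ι k P (.setC a i j l m e) Q 1 := by
  simp only [Bool.and_eq_true] at hb
  intro s hs hP
  refine ⟨_, runs_setC a i j l m e s, hs, ?_⟩
  simp only [IExp.eval_eq_val, IExp.val_congr hs hb.1.1.1.1, IExp.val_congr hs hb.1.1.1.2,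
    IExp.val_congr hs hb.1.1.2, IExp.val_congr hs hb.1.2, CExp.eval_eq_val hs hb.2]
  exact h _ hP

theorem ite_eq {e f : IExp} (hb : (e.usesBelow k && f.usesBelow k) = true)
    (h : e.val ι = f.val ι → Triple ι k P c Q B)
    (h' : e.val ι ≠ f.val ι → Triple ι k P c' Q B) :
    Triple ι k P (.ite (.eq e f) c c') Q (B + 1) := by
  simp only [Bool.and_eq_true] at hb
  intro s hs hP
  have hT : (Test.eq e f).holds s ↔ e.val ι = f.val ι := by
    simp only [Test.holds, IExp.eval_eq_val, IExp.val_congr hs hb.1, IExp.val_congr hs hb.2]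
  by_cases hef : e.val ι = f.val ι
  · obtain ⟨s', h1, h2⟩ := h hef s hs hP
    exact ⟨s', h1.ite_true (hT.2 hef), h2⟩
  · obtain ⟨s', h1, h2⟩ := h' hef s hs hP
    exact ⟨s', h1.ite_false (fun h => hef (hT.1 h)), h2⟩

theorem letVar {e : IExp} (hk : 20 ≤ k) (hb : e.usesBelow k = true)
    (h : Triple (ι.upd k (e.val ι)) (k + 1) P c Q B) :
    Triple ι k P (.letVar k e c) Q (B + 2) := by
  intro s hs hP
  have hr := runs_setI k (.lit 0) (.lit 0) e s
  obtain ⟨s', h1, h2, h3⟩ := h (s.setI k 0 0 (e.eval s)) (by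
    refine Agree.upd ⟨fun a ha => ?_, fun a ha => ?_⟩ hk ?_
    · rw [← hs.1 a ha]
      funext i j
      simp [Store.setI, show a ≠ k by omega]
    · rw [← hs.2 a ha]
      simp [Store.setI, show a ≠ k by omega]
    · simp [Store.setI, IExp.eval_eq_val, IExp.val_congr hs hb]) hP
  exact ⟨s', (hr.seq h1).mono (by omega), h2.of_upd hk, h3⟩

/-- The body works one level higher, where the counter `k` counts as protected. The cost is stated
with a common bound `D ≥ 1` of the lengths, so that nested loops yield powers of `D`. -/
theorem forLoop {bound : IExp} {N D : ℕ} (I : ℕ → Num → Prop) (hk : 20 ≤ k)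
    (hb : bound.usesBelow k = true) (hN : bound.val ι = N) (hD : N ≤ D) (hD0 : 0 < D)
    (h : ∀ i < N, Triple (ι.upd k i) (k + 1) (I i) c (I (i + 1)) B) :
    Triple ι k (I 0) (.forLoop k bound c) (I N) ((B + 6) * D) := by
  intro s hs hP
  have hset : ∀ (s : Store) v, Agree k s.idx ι → Agree k (s.setI k 0 0 v).idx ι := by
    intro s v hs
    refine ⟨fun a ha => ?_, fun a ha => ?_⟩
    · rw [← hs.1 a ha]
      funext i j
      simp [Store.setI, show a ≠ k by omega]
    · rw [← hs.2 a ha]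
      simp [Store.setI, show a ≠ k by omega]
  obtain ⟨s', hr, hs', -, hI⟩ := runs_forLoop (k := k) (bound := bound) (c := c) (N := N) (B := B)
    (s := s) (fun i s' => Agree k s'.idx ι ∧ s'.idx k 0 0 = i ∧ I i s'.num)
    ⟨hset s 0 hs, by simp [Store.setI], hP⟩ (fun i s' h => h.2.1)
    (fun i s' h => by rw [IExp.eval_eq_val, IExp.val_congr h.1 hb, hN])
    (by
      rintro i hi s' ⟨h1, h2, h3⟩
      obtain ⟨s'', hr, h1', h3'⟩ := h i hi s' (h1.upd hk h2) h3
      refine ⟨s'', hr, ?_, hset _ _ (h1'.of_upd hk), by simp [Store.setI], h3'⟩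
      simpa [Idx.upd] using h1'.2 k (by omega))
  refine ⟨s', hr.mono ?_, hs', hI⟩
  calc N * (B + 3) + 3 ≤ D * (B + 3) + 3 * D := by
        have := Nat.mul_le_mul_right (B + 3) hD
        omega
    _ = (B + 6) * D := by ring

/-- For subroutines whose counters start at a name `k'` above those of the caller: the variables
between `k` and `k'` have some values, and the caller does not care what becomes of them. -/
theorem weaken {k' : ℕ} (h : ∀ ι', Agree k ι' ι → Triple ι' k' P c Q B) (hk : k ≤ k') :
    Triple ι k P c Q B := by
  intro s hs hP
  obtain ⟨s', h1, h2, h3⟩ := h s.idx hs s (Agree.refl _ _) hP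
  exact ⟨s', h1, (h2.mono hk).trans hs, h3⟩

end Triple

/-! ### Sums -/

/-- The accumulator is the cell `0, 0, 0, 0` of the array `23`. -/
def Num.acc (y : Num) (z : ℂ) : Num := y.set 23 0 0 0 0 z

/-- The command adds `g` to the accumulator when the other numbers are those of `y`. -/
def Accumulates (ι : Idx) (k : ℕ) (y : Num) (c : Cmd) (g : ℂ) (B : ℕ) : Prop :=
  ∀ z, Triple ι k (· = y.acc z) c (· = y.acc (z + g)) B

theorem Accumulates.mono {ι : Idx} {k : ℕ} {y : Num} {c : Cmd} {g : ℂ} {B B' : ℕ}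
    (h : Accumulates ι k y c g B) (hB : B ≤ B') : Accumulates ι k y c g B' :=
  fun z => (h z).mono hB

def Cmd.addAcc (e : CExp) : Cmd :=
  .setC 23 (.lit 0) (.lit 0) (.lit 0) (.lit 0)
    (.add (.get 23 (.lit 0) (.lit 0) (.lit 0) (.lit 0)) e)

theorem Accumulates.addAcc {ι : Idx} {k : ℕ} {y : Num} {e : CExp} {g : ℂ}
    (hb : e.usesBelow k = true) (h : ∀ z, e.val ι (y.acc z) = g) :
    Accumulates ι k y (.addAcc e) g 1 := by
  intro z
  refine Triple.setC (by simp [IExp.usesBelow, CExp.usesBelow, hb]) ?_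
  rintro _ rfl
  simp only [CExp.val, h]
  funext a i j k l
  simp only [Num.acc, Num.set, IExp.val]
  split <;> simp_all

/-- The initial content of the accumulator is arbitrary in `Accumulates`; this is what lets an inner
sum continue an outer one. -/
theorem Accumulates.forLoop {ι : Idx} {k N D B : ℕ} {y : Num} {c : Cmd} {bound : IExp}
    {g : ℕ → ℂ} (hk : 20 ≤ k) (hb : bound.usesBelow k = true) (hN : bound.val ι = N) (hD : N ≤ D)
    (hD0 : 0 < D) (h : ∀ i < N, Accumulates (ι.upd k i) (k + 1) y c (g i) B) :
    Accumulates ι k y (.forLoop k bound c) (∑ i ∈ Finset.range N, g i) ((B + 6) * D) := by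
  intro z
  have := Triple.forLoop (ι := ι) (k := k) (c := c) (B := B)
    (fun i y' => y' = y.acc (z + ∑ j ∈ Finset.range i, g j)) hk hb hN hD hD0 (by
      intro i hi
      simp only [Finset.sum_range_succ, ← add_assoc]
      exact h i hi _)
  simpa using this

/-- The command computes a sum with the accumulator and stores it. -/
def Cmd.storeSum (c : Cmd) (a : ℕ) (i j k l : IExp) : Cmd :=
  .seq (.setC 23 (.lit 0) (.lit 0) (.lit 0) (.lit 0) .zero)
    (.seq c (.setC a i j k l (.get 23 (.lit 0) (.lit 0) (.lit 0) (.lit 0))))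

theorem Triple.storeSum {ι : Idx} {k B : ℕ} {y : Num} {c : Cmd} {g : ℂ} {a : ℕ} {i j l m : IExp}
    (h : Accumulates ι k y c g B)
    (hb : (i.usesBelow k && j.usesBelow k && l.usesBelow k && m.usesBelow k) = true) :
    Triple ι k (· = y) (.storeSum c a i j l m)
      (· = (y.acc g).set a (i.val ι) (j.val ι) (l.val ι) (m.val ι) g) (B + 4) := by
  have h1 : Triple ι k (· = y) (.setC 23 (.lit 0) (.lit 0) (.lit 0) (.lit 0) .zero)
      (· = y.acc 0) 1 := Triple.setC (by simp [IExp.usesBelow, CExp.usesBelow]) (by rintro _ rfl; rfl)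
  have h2 := h 0
  rw [zero_add] at h2
  have h3 : Triple ι k (· = y.acc g)
      (.setC a i j l m (.get 23 (.lit 0) (.lit 0) (.lit 0) (.lit 0)))
      (· = (y.acc g).set a (i.val ι) (j.val ι) (l.val ι) (m.val ι) g) 1 :=
    Triple.setC (by simpa [IExp.usesBelow, CExp.usesBelow] using hb) (by
      rintro _ rfl
      simp [CExp.val, Num.acc, Num.set, IExp.val])
  exact (h1.seq (h2.seq h3)).mono (by omega)

/-- Brings an assignment that ignores the accumulator into the form that `Triple.fillRow` expects of
its body. -/
theorem Num.acc_self (y : Num) : y.acc (y 23 0 0 0 0) = y := by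
  funext a i j k l
  simp only [Num.acc, Num.set]
  split_ifs with hc
  · obtain ⟨rfl, rfl, rfl, rfl, rfl⟩ := hc
    rfl
  · rfl

/-! ### Filling a row of an array -/

/-- The numbers agree except for the accumulator and the cells of the array `A` with first
index `i₀`. -/
def SameOff (A i₀ : ℕ) (y₀ y : Num) : Prop :=
  ∀ x i j k l, x ≠ 23 → (x ≠ A ∨ i ≠ i₀) → y x i j k l = y₀ x i j k l

theorem SameOff.refl (A i₀ : ℕ) (y : Num) : SameOff A i₀ y y := fun _ _ _ _ _ _ _ => rfl

theorem SameOff.acc_set {A i₀ : ℕ} {y₀ y : Num} (h : SameOff A i₀ y₀ y) (z g : ℂ) (a b c : ℕ) :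
    SameOff A i₀ y₀ ((y.acc z).set A i₀ a b c g) := by
  intro x i j k l hx hx'
  rw [← h x i j k l hx hx', Num.set, if_neg (by tauto), Num.acc, Num.set, if_neg (by tauto)]

/-- The cells `a, b, 0` with `a < N₁`, `b < N₂` of the row `i₀` of the array `A` get the
value `val a b`. -/
theorem Triple.fillRow {ι : Idx} {k N₁ N₂ D B A i₀ : ℕ} {b₁ b₂ : IExp} {c : Cmd} {y₀ : Num}
    (val : ℕ → ℕ → ℂ) (hA : A ≠ 23) (hk : 20 ≤ k) (hD : 0 < D)
    (hb₁ : b₁.usesBelow k = true) (hN₁ : b₁.val ι = N₁) (hD₁ : N₁ ≤ D)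
    (hb₂ : b₂.usesBelow (k + 1) = true) (hN₂ : ∀ a < N₁, b₂.val (ι.upd k a) = N₂) (hD₂ : N₂ ≤ D)
    (h : ∀ a < N₁, ∀ b < N₂, ∀ y, SameOff A i₀ y₀ y →
      Triple ((ι.upd k a).upd (k + 1) b) (k + 2) (· = y) c
        (fun y' => ∃ z, y' = (y.acc z).set A i₀ a b 0 (val a b)) B) :
    Triple ι k (· = y₀) (.forLoop k b₁ (.forLoop (k + 1) b₂ c))
      (fun y => SameOff A i₀ y₀ y ∧ ∀ a < N₁, ∀ b < N₂, y A i₀ a b 0 = val a b)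
      (((B + 6) * D + 6) * D) := by
  refine (Triple.forLoop (I := fun a y => SameOff A i₀ y₀ y ∧
    ∀ a' < a, ∀ b < N₂, y A i₀ a' b 0 = val a' b) hk hb₁ hN₁ hD₁ hD ?_).conseq ?_ fun y hy => hy
  · intro a ha
    refine (Triple.forLoop (I := fun b y => SameOff A i₀ y₀ y ∧
      (∀ a' < a, ∀ b < N₂, y A i₀ a' b 0 = val a' b) ∧ ∀ b' < b, y A i₀ a b' 0 = val a b')
      (by omega) hb₂ (hN₂ a ha) hD₂ hD ?_).conseq ?_ ?_
    · intro b hb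
      refine Triple.of_eq fun y hy => (h a ha b hb y hy.1).conseq (fun _ h => h) ?_
      rintro _ ⟨z, rfl⟩
      have hval : ∀ a' b', ((y.acc z).set A i₀ a b 0 (val a b)) A i₀ a' b' 0 =
          if a' = a ∧ b' = b then val a b else y A i₀ a' b' 0 := by
        intro a' b'
        simp [Num.set, Num.acc, hA]
      refine ⟨hy.1.acc_set _ _ _ _ _, fun a' ha' b' hb' => ?_, fun b' hb' => ?_⟩
      · rw [hval, if_neg (by omega)]
        exact hy.2.1 a' ha' b' hb'
      · rw [hval]
        rcases Nat.lt_succ_iff_lt_or_eq.1 hb' with h1 | rfl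
        · rw [if_neg (by omega)]
          exact hy.2.2 b' h1
        · rw [if_pos ⟨rfl, rfl⟩]
    · rintro y ⟨h1, h2⟩
      exact ⟨h1, h2, fun _ h => by omega⟩
    · rintro y ⟨h1, h2, h3⟩
      refine ⟨h1, fun a' ha' => ?_⟩
      rcases Nat.lt_succ_iff_lt_or_eq.1 ha' with h4 | rfl
      · exact h2 a' h4
      · exact h3
  · rintro y rfl
    exact ⟨SameOff.refl _ _ _, fun _ h => by omega⟩

/-- Absorbs the overhead of one more nested loop: the exponent grows by `1` and the constant by `6`.
-/
theorem mul_pow_add_six_le {b D : ℕ} (hD : 0 < D) (j : ℕ) :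
    (b * D ^ j + 6) * D ≤ (b + 6) * D ^ (j + 1) := by
  have : 1 ≤ D ^ j := Nat.one_le_pow _ _ hD
  calc (b * D ^ j + 6) * D ≤ (b * D ^ j + 6 * D ^ j) * D := by gcongr; omega
    _ = (b + 6) * D ^ (j + 1) := by ring

end MQC

/-! ### Contraction of tree networks by message passing. -/

namespace MQC

/-! ### Summation over some of the coordinates -/

section Marginal

variable {V X R : Type*} [Fintype V] [DecidableEq V] [CommSemiring R]

/-- The sum of `f` over the coordinates in `A`, with ranges `D`, the others being fixed by `σ`. -/
def marginal (D : V → Finset X) (A : Finset V) (f : (V → X) → R) (σ : V → X) : R :=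
  ∑ τ ∈ Fintype.piFinset fun v => if v ∈ A then D v else {σ v}, f τ

theorem marginal_empty (D : V → Finset X) (f : (V → X) → R) (σ : V → X) :
    marginal D ∅ f σ = f σ := by
  simp [marginal]

/-- Fubini: a labelling that is free on `A ∪ B` is paired with its restriction to `A`, completed by
`σ`. -/
theorem marginal_union (D : V → Finset X) {A B : Finset V} (hAB : Disjoint A B)
    (f : (V → X) → R) (σ : V → X) :
    marginal D (A ∪ B) f σ = marginal D A (marginal D B f) σ := by
  unfold marginal
  rw [Finset.sum_sigma']
  refine Finset.sum_bij' (fun ρ _ => ⟨fun v => if v ∈ A then ρ v else σ v, ρ⟩)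
    (fun p _ => p.2) ?_ ?_ ?_ ?_ ?_
  · intro ρ hρ
    simp only [Finset.mem_sigma, Fintype.mem_piFinset, Finset.mem_union] at hρ ⊢
    refine ⟨fun v => ?_, fun v => ?_⟩
    · have := hρ v
      by_cases hA : v ∈ A <;> simp_all
    · have := hρ v
      by_cases hA : v ∈ A
      · have := Finset.disjoint_left.1 hAB hA
        simp_all
      · by_cases hB : v ∈ B <;> simp_all
  · rintro ⟨τ, ρ⟩ h
    simp only [Finset.mem_sigma, Fintype.mem_piFinset, Finset.mem_union] at h ⊢
    intro v
    have h1 := h.1 v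
    have h2 := h.2 v
    by_cases hA : v ∈ A
    · have := Finset.disjoint_left.1 hAB hA
      simp_all
    · by_cases hB : v ∈ B <;> simp_all
  · intro ρ _
    rfl
  · rintro ⟨τ, ρ⟩ h
    simp only [Finset.mem_sigma, Fintype.mem_piFinset] at h
    have : (fun v => if v ∈ A then ρ v else σ v) = τ := by
      funext v
      have h1 := h.1 v
      have h2 := h.2 v
      by_cases hA : v ∈ A
      · have := Finset.disjoint_left.1 hAB hA
        simp_all
      · simp_all
    simp [this]
  · intro ρ _
    rfl

theorem marginal_singleton (D : V → Finset X) (a : V) (f : (V → X) → R) (σ : V → X) :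
    marginal D {a} f σ = ∑ i ∈ D a, f (Function.update σ a i) := by
  unfold marginal
  refine Finset.sum_bij' (fun τ _ => τ a) (fun i _ => Function.update σ a i) ?_ ?_ ?_ ?_ ?_
  · intro τ hτ
    simpa using (Fintype.mem_piFinset.1 hτ) a
  · intro i hi
    rw [Fintype.mem_piFinset]
    intro v
    by_cases hv : v = a
    · subst hv; simpa using hi
    · simp [hv]
  · intro τ hτ
    funext v
    have := (Fintype.mem_piFinset.1 hτ) v
    by_cases hv : v = a
    · subst hv; simp
    · simp_all
  · intro i _
    simp
  · intro τ hτ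
    congr 1
    funext v
    have := (Fintype.mem_piFinset.1 hτ) v
    by_cases hv : v = a
    · subst hv; simp
    · simp_all

theorem marginal_pair (D : V → Finset X) {a b : V} (hab : a ≠ b) (f : (V → X) → R) (σ : V → X) :
    marginal D {a, b} f σ =
      ∑ i ∈ D a, ∑ j ∈ D b, f (Function.update (Function.update σ a i) b j) := by
  have : ({a, b} : Finset V) = {a} ∪ {b} := rfl
  rw [this, marginal_union D (by simpa using hab), marginal_singleton]
  simp only [marginal_singleton]

theorem marginal_congr (D : V → Finset X) {A : Finset V} {f g : (V → X) → R} {σ : V → X}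
    (h : ∀ τ, (∀ v ∉ A, τ v = σ v) → (∀ v ∈ A, τ v ∈ D v) → f τ = g τ) :
    marginal D A f σ = marginal D A g σ := by
  refine Finset.sum_congr rfl fun τ hτ => h τ (fun v hv => ?_) fun v hv => ?_
  · simpa [hv] using (Fintype.mem_piFinset.1 hτ) v
  · simpa [hv] using (Fintype.mem_piFinset.1 hτ) v

theorem marginal_mul_left (D : V → Finset X) {A : Finset V} {f g : (V → X) → R} {σ : V → X}
    (hg : ∀ τ, (∀ v ∉ A, τ v = σ v) → g τ = g σ) :
    marginal D A (fun τ => g τ * f τ) σ = g σ * marginal D A f σ := by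
  unfold marginal
  rw [Finset.mul_sum]
  refine Finset.sum_congr rfl fun τ hτ => ?_
  have := hg τ fun v hv => by simpa [hv] using (Fintype.mem_piFinset.1 hτ) v
  simp only [this]

/-- Contraction of a rooted tree. The coordinate `v` belongs to the edge from `v` to its parent; the
factor `F v` depends on the edges at `v`; the message `M v` is the contraction of the part of the
tree below `v`. -/
theorem marginal_tree (root : V) (par : V → V) (rk : V → ℕ)
    (hrk : ∀ v, v ≠ root → rk (par v) < rk v) (D : V → Finset X)
    (F : V → (V → X) → R) (M : V → X → R)
    (hF : ∀ v τ τ', (v ≠ root → τ v = τ' v) → (∀ c, c ≠ root → par c = v → τ c = τ' c) →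
      F v τ = F v τ')
    (hM : ∀ v σ, (v ≠ root → σ v ∈ D v) →
      marginal D (Finset.univ.filter fun c => c ≠ root ∧ par c = v)
      (fun τ => F v τ * ∏ c ∈ Finset.univ.filter (fun c => c ≠ root ∧ par c = v), M c (τ c)) σ =
        M v (σ v)) (σ : V → X) :
    marginal D (Finset.univ.filter fun v => v ≠ root) (fun τ => ∏ v, F v τ) σ = M root (σ root) := by
  -- Take a subtree `U` that contains the root. Below it, the branches hanging off `U` are already
  -- replaced by their messages, and the value of the contraction does not change. The induction
  -- adds to `U` a vertex of maximal `rk`; the case of all vertices, where no messages are left, is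
  -- the claim.
  have key : ∀ U : Finset V, root ∈ U → (∀ v ∈ U, v ≠ root → par v ∈ U) →
      marginal D (Finset.univ.filter fun w => w ≠ root ∧ par w ∈ U)
        (fun τ => (∏ v ∈ U, F v τ) *
          ∏ w ∈ Finset.univ.filter (fun w => (w ≠ root ∧ par w ∈ U) ∧ w ∉ U), M w (τ w)) σ =
      M root (σ root) := by
    intro U
    induction U using Finset.induction_on_max_value rk with
    | empty => simp
    | insert k U hk hmax ih =>
      intro hroot hclosed
      have hUpar : ∀ v ∈ U, v ≠ root → par v ∈ U := by
        intro v hv hvr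
        rcases Finset.mem_insert.1 (hclosed v (Finset.mem_insert_of_mem hv) hvr) with h | h
        · have h1 := hmax v hv
          have h2 := hrk v hvr
          rw [h] at h2
          omega
        · exact h
      set C := Finset.univ.filter fun c => c ≠ root ∧ par c = k with hC
      have hCU : ∀ c ∈ C, c ∉ U ∧ c ≠ k := by
        intro c hc
        simp only [hC, Finset.mem_filter, Finset.mem_univ, true_and] at hc
        have := hrk c hc.1
        rw [hc.2] at this
        refine ⟨fun h => ?_, fun h => ?_⟩
        · have := hmax c h
          omega
        · subst h; omega
      have hA : (Finset.univ.filter fun w => w ≠ root ∧ par w ∈ insert k U) =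
          (Finset.univ.filter fun w => w ≠ root ∧ par w ∈ U) ∪ C := by
        ext w
        simp only [hC, Finset.mem_filter, Finset.mem_univ, true_and, Finset.mem_insert,
          Finset.mem_union]
        tauto
      have hdisj : Disjoint (Finset.univ.filter fun w => w ≠ root ∧ par w ∈ U) C := by
        rw [Finset.disjoint_left]
        intro w hw hw'
        simp only [hC, Finset.mem_filter, Finset.mem_univ, true_and] at hw hw'
        rw [hw'.2] at hw
        exact hk hw.2
      set Fr := Finset.univ.filter (fun w => (w ≠ root ∧ par w ∈ U) ∧ w ∉ insert k U) with hFr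
      have hFr1 : (Finset.univ.filter fun w => (w ≠ root ∧ par w ∈ insert k U) ∧ w ∉ insert k U) =
          Fr ∪ C := by
        ext w
        have := hCU w
        simp only [hC, hFr, Finset.mem_filter, Finset.mem_univ, true_and, Finset.mem_insert,
          Finset.mem_union] at this ⊢
        tauto
      have hdisj' : Disjoint Fr C := by
        refine Finset.disjoint_of_subset_left ?_ hdisj
        intro w hw
        simp only [hFr, Finset.mem_filter, Finset.mem_univ, true_and] at hw ⊢
        exact hw.1
      rw [hA, marginal_union D hdisj, hFr1]
      -- The edges in `C` occur only in `F k` and in the messages of the children of `k`, so summing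
      -- over them produces `M k` and leaves all other factors alone.
      have step1 : ∀ τ : V → X, (k ≠ root → τ k ∈ D k) →
          marginal D C (fun τ => (∏ v ∈ insert k U, F v τ) * ∏ w ∈ Fr ∪ C, M w (τ w)) τ =
          ((∏ v ∈ U, F v τ) * ∏ w ∈ Fr, M w (τ w)) * M k (τ k) := by
        intro τ hτ
        rw [← hM k τ hτ, ← marginal_mul_left D (A := C)
          (g := fun τ => (∏ v ∈ U, F v τ) * ∏ w ∈ Fr, M w (τ w))]
        · refine marginal_congr D fun τ' _ _ => ?_
          rw [Finset.prod_insert hk, Finset.prod_union hdisj']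
          ring
        · intro τ' hτ'
          congr 1
          · refine Finset.prod_congr rfl fun v hv => hF v _ _ (fun _ => hτ' v ?_) ?_
            · intro hvC
              exact (hCU v hvC).1 hv
            · intro c hc hcv
              refine hτ' c fun hcC => ?_
              simp only [hC, Finset.mem_filter, Finset.mem_univ, true_and] at hcC
              rw [hcv] at hcC
              exact hk (hcC.2 ▸ hv)
          · refine Finset.prod_congr rfl fun w hw => ?_
            rw [hτ' w (Finset.disjoint_left.1 hdisj' hw)]
      rw [marginal_congr D (g := fun τ => ((∏ v ∈ U, F v τ) * ∏ w ∈ Fr, M w (τ w)) * M k (τ k))]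
      · by_cases hkr : k = root
        · subst hkr
          -- A vertex of least `rk` in `U` would not be the root, so its parent would lie in `U`
          -- with smaller `rk`.
          have hU : U = ∅ := by
            by_contra hne
            obtain ⟨v, hv⟩ := Finset.nonempty_iff_ne_empty.2 hne
            obtain ⟨w, hw, hmin⟩ := Finset.exists_min_image U rk ⟨v, hv⟩
            have hwr : w ≠ k := fun h => hk (h ▸ hw)
            have := hmin _ (hUpar w hw hwr)
            have := hrk w hwr
            omega
          subst hU
          have hFr0 : Fr = ∅ := by simp [hFr]
          have h0 : (Finset.univ.filter fun w => w ≠ k ∧ par w ∈ (∅ : Finset V)) = ∅ := by simp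
          rw [hFr0, h0, marginal_empty]
          simp
        · have hrU : root ∈ U := by
            rcases Finset.mem_insert.1 hroot with h | h
            · exact (hkr h.symm).elim
            · exact h
          rw [← ih hrU hUpar]
          refine marginal_congr D fun τ _ _ => ?_
          have hkU : par k ∈ U := by
            rcases Finset.mem_insert.1 (hclosed k (Finset.mem_insert_self _ _) hkr) with h | h
            · have := hrk k hkr
              rw [h] at this
              omega
            · exact h
          have : (Finset.univ.filter fun w => (w ≠ root ∧ par w ∈ U) ∧ w ∉ U) = insert k Fr := by
            ext w
            simp only [hFr, Finset.mem_filter, Finset.mem_univ, true_and, Finset.mem_insert]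
            by_cases hwk : w = k
            · subst hwk; simp [hkr, hkU, hk]
            · simp [hwk]
          rw [this, Finset.prod_insert (by simp [hFr])]
          ring
      · intro τ hτ1 hτ2
        refine step1 τ fun hkr => hτ2 k ?_
        simp only [Finset.mem_filter, Finset.mem_univ, true_and]
        refine ⟨hkr, ?_⟩
        rcases Finset.mem_insert.1 (hclosed k (Finset.mem_insert_self _ _) hkr) with h | h
        · have := hrk k hkr
          rw [h] at this
          omega
        · exact h
  have := key Finset.univ (Finset.mem_univ _) (fun _ _ _ => Finset.mem_univ _)
  simpa using this

end Marginal

end MQC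

namespace MQC

/-! ### Rooted trees -/

section Rooted

variable {V : Type*} (G : SimpleGraph V) (r : V)

open Classical in
/-- The neighbour of `v` that is closer to the root `r`. -/
noncomputable def parent (v : V) : V :=
  if h : ∃ w, G.Adj v w ∧ G.dist r w < G.dist r v then h.choose else v

variable {G r}

theorem parent_spec (hG : G.IsTree) {v : V} (hv : v ≠ r) :
    G.Adj v (parent G r v) ∧ G.dist r (parent G r v) < G.dist r v := by
  have h : ∃ w, G.Adj v w ∧ G.dist r w < G.dist r v := by
    obtain ⟨p, hp⟩ := (hG.connected.preconnected v r).exists_walk_length_eq_dist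
    cases p with
    | nil => exact (hv rfl).elim
    | cons h q =>
      refine ⟨_, h, ?_⟩
      rw [SimpleGraph.Walk.length_cons] at hp
      rw [G.dist_comm, G.dist_comm (u := r) (v := v), ← hp]
      exact Nat.lt_succ_of_le (SimpleGraph.dist_le q)
  rw [parent, dif_pos h]
  exact h.choose_spec

/-- Acyclicity: every neighbour of `v` closer to the root lies on the shortest path from the root to
`v`, and the only neighbour of `v` on this path is the last vertex before `v`. -/
theorem eq_parent (hG : G.IsTree) {v w : V} (hvw : G.Adj v w) (hd : G.dist r w < G.dist r v) :
    w = parent G r v := by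
  have hv : v ≠ r := by
    rintro rfl
    simp at hd
  obtain ⟨h1, h2⟩ := parent_spec hG hv
  obtain ⟨p, hp, hpl⟩ := (hG.connected.preconnected r v).exists_path_of_dist
  have mem : ∀ u, G.Adj v u → G.dist r u < G.dist r v → u ∈ p.support := by
    intro u hu hud
    obtain ⟨q, hq, hql⟩ := (hG.connected.preconnected r u).exists_path_of_dist
    refine hG.isAcyclic.mem_support_of_ne_mem_support_of_adj_of_isPath hp hq hu ?_
    intro hvq
    have := hG.isAcyclic.path_concat hp hq hu hvq
    have := congrArg SimpleGraph.Walk.length this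
    rw [SimpleGraph.Walk.length_concat] at this
    omega
  rw [hG.isAcyclic.eq_penultimate_of_adj_end hp hvw (mem _ hvw hd),
    hG.isAcyclic.eq_penultimate_of_adj_end hp h1 (mem _ h1 h2)]

theorem parent_adj_cases (hG : G.IsTree) {v w : V} (hvw : G.Adj v w) :
    (v ≠ r ∧ w = parent G r v) ∨ (w ≠ r ∧ v = parent G r w) := by
  rcases hG.dist_eq_dist_add_one_of_adj r hvw with h | h
  · refine Or.inl ⟨?_, eq_parent hG hvw (by omega)⟩
    rintro rfl
    simp at h
  · refine Or.inr ⟨?_, eq_parent hG hvw.symm (by omega)⟩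
    rintro rfl
    simp at h

theorem parent_adj (hG : G.IsTree) {v : V} (hv : v ≠ r) : G.Adj v (parent G r v) :=
  (parent_spec hG hv).1

theorem dist_parent_lt (hG : G.IsTree) {v : V} (hv : v ≠ r) :
    G.dist r (parent G r v) < G.dist r v :=
  (parent_spec hG hv).2

/-- A neighbour other than the parent is a child. -/
theorem parent_eq_of_adj_of_ne (hG : G.IsTree) {v w : V} (hvw : G.Adj v w)
    (hw : v ≠ r → w ≠ parent G r v) : w ≠ r ∧ parent G r w = v := by
  rcases parent_adj_cases (r := r) hG hvw with h | h
  · exact (hw h.1 h.2).elim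
  · exact ⟨h.1, h.2.symm⟩

theorem parent_ne_of_child (hG : G.IsTree) {v w : V} (hv : v ≠ r) (hw : w ≠ r)
    (h : parent G r w = v) : w ≠ parent G r v := by
  rintro rfl
  have h1 := dist_parent_lt hG hv
  have h2 := dist_parent_lt hG hw
  rw [h] at h2
  omega

/-- If the two edges coincided with their ends exchanged, `v` and `w` would be parents of each
other. -/
theorem edge_parent_inj (hG : G.IsTree) {v w : V} (hv : v ≠ r) (hw : w ≠ r)
    (h : s(v, parent G r v) = s(w, parent G r w)) : v = w := by
  rcases Sym2.eq_iff.1 h with h | h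
  · exact h.1
  · exact (parent_ne_of_child hG hw hv h.2 h.1).elim

variable (G r) in
open Classical in
/-- The end of an edge that is farther from the root. -/
noncomputable def lowerEnd (e : Sym2 V) : V :=
  if h : ∃ v, v ≠ r ∧ s(v, parent G r v) = e then h.choose else r

theorem lowerEnd_parent (hG : G.IsTree) {v : V} (hv : v ≠ r) :
    lowerEnd G r s(v, parent G r v) = v := by
  have h : ∃ w, w ≠ r ∧ s(w, parent G r w) = s(v, parent G r v) := ⟨v, hv, rfl⟩
  rw [lowerEnd, dif_pos h]
  exact edge_parent_inj hG h.choose_spec.1 hv h.choose_spec.2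

theorem lowerEnd_child (hG : G.IsTree) {v w : V} (hw : w ≠ r) (h : parent G r w = v) :
    lowerEnd G r s(v, w) = w := by
  subst h
  rw [Sym2.eq_swap]
  exact lowerEnd_parent hG hw

theorem lowerEnd_spec (hG : G.IsTree) {e : Sym2 V} (he : e ∈ G.edgeSet) :
    lowerEnd G r e ≠ r ∧ s(lowerEnd G r e, parent G r (lowerEnd G r e)) = e := by
  have h : ∃ w, w ≠ r ∧ s(w, parent G r w) = e := by
    induction e using Sym2.ind with
    | _ v w =>
      have he : G.Adj v w := he
      rcases parent_adj_cases (r := r) hG he with h | h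
      · exact ⟨v, h.1, by rw [h.2]⟩
      · exact ⟨w, h.1, by rw [Sym2.eq_swap, h.2]⟩
  rw [lowerEnd, dif_pos h]
  exact h.choose_spec

/-- Edges correspond to the vertices other than the root by taking lower ends. The coordinate of the
root belongs to no edge and is held at an arbitrary `σ₀ r`. -/
theorem sum_edges_eq_marginal {X R : Type*} [Fintype V] [DecidableEq V]
    [CommSemiring R] [Fintype G.edgeSet] [DecidableEq G.edgeSet] (hG : G.IsTree)
    (D : Sym2 V → Finset X) (f : (G.edgeSet → X) → R) (σ₀ : V → X) :
    ∑ σ ∈ Fintype.piFinset (fun e : G.edgeSet => D e), f σ =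
      marginal (fun v => D s(v, parent G r v)) (Finset.univ.filter fun v => v ≠ r)
        (fun τ => f fun e => τ (lowerEnd G r e)) σ₀ := by
  unfold marginal
  refine Finset.sum_bij' (fun σ _ v => if hv : v ≠ r then
      σ ⟨s(v, parent G r v), parent_adj hG hv⟩ else σ₀ v)
    (fun τ _ e => τ (lowerEnd G r e)) ?_ ?_ ?_ ?_ ?_
  · intro σ hσ
    rw [Fintype.mem_piFinset] at hσ ⊢
    intro v
    by_cases hv : v = r
    · simp [hv]
    · simpa [hv] using hσ ⟨s(v, parent G r v), parent_adj hG hv⟩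
  · intro τ hτ
    rw [Fintype.mem_piFinset] at hτ ⊢
    intro e
    have h := lowerEnd_spec (r := r) hG e.2
    simpa [h.1, h.2] using hτ (lowerEnd G r e)
  · intro σ hσ
    funext e
    have h := lowerEnd_spec (r := r) hG e.2
    simp [h.1, h.2]
  · intro τ hτ
    rw [Fintype.mem_piFinset] at hτ
    funext v
    by_cases hv : v = r
    · simpa [hv, eq_comm] using hτ v
    · simp [hv, lowerEnd_parent hG hv]
  · intro σ hσ
    congr 1
    funext e
    have h := lowerEnd_spec (r := r) hG e.2
    simp [h.1, h.2]

end Rooted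

/-! ### Neighbours in a subcubic tree -/

namespace SubcubicTree

variable {n : ℕ} (T : SubcubicTree n)

theorem mem_nbrs {v w : Fin T.m} : w ∈ T.nbrs v ↔ T.graph.Adj v w := by
  simp [nbrs]

theorem nodup_nbrs (v : Fin T.m) : (T.nbrs v).Nodup := by
  simp [nbrs]

theorem length_nbrs (v : Fin T.m) : (T.nbrs v).length = (T.graph.neighborSet v).ncard := by
  classical
  rw [nbrs, Finset.length_sort, Set.ncard_eq_toFinset_card']

/-- The `t`-th neighbour of `v`. -/
noncomputable def nbr (v : Fin T.m) (t : ℕ) : Fin T.m := (T.nbrs v).getD t v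

theorem nbr_eq {v : Fin T.m} {t : ℕ} (ht : t < (T.nbrs v).length) : T.nbr v t = (T.nbrs v)[t] := by
  simp [nbr, ht]

theorem adj_nbr {v : Fin T.m} {t : ℕ} (ht : t < (T.nbrs v).length) :
    T.graph.Adj v (T.nbr v t) := by
  rw [nbr_eq T ht, ← mem_nbrs]
  exact List.getElem_mem ht

theorem nbr_inj {v : Fin T.m} {t u : ℕ} (ht : t < (T.nbrs v).length) (hu : u < (T.nbrs v).length)
    (h : T.nbr v t = T.nbr v u) : t = u := by
  rw [nbr_eq T ht, nbr_eq T hu] at h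
  exact (T.nodup_nbrs v).getElem_inj_iff.1 h

theorem exists_nbr {v w : Fin T.m} (h : T.graph.Adj v w) :
    ∃ t < (T.nbrs v).length, T.nbr v t = w := by
  obtain ⟨t, ht, h⟩ := List.getElem_of_mem ((T.mem_nbrs).2 h)
  exact ⟨t, ht, by rw [nbr_eq T ht, h]⟩

theorem ncard_leaf (l : Fin n) : (T.graph.neighborSet (T.leaf l)).ncard = 1 := (T.leaf l).2

theorem adj_leaf {l : Fin n} {w : Fin T.m} (h : T.graph.Adj (T.leaf l) w) :
    w = T.nbr (T.leaf l) 0 := by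
  obtain ⟨t, ht, rfl⟩ := T.exists_nbr h
  rw [length_nbrs, ncard_leaf] at ht
  obtain rfl : t = 0 := by omega
  rfl

theorem adj_leaf_nbr (l : Fin n) : T.graph.Adj (T.leaf l) (T.nbr (T.leaf l) 0) :=
  T.adj_nbr (by rw [length_nbrs, ncard_leaf]; omega)

theorem leaf_injective {l l' : Fin n} (h : (T.leaf l : Fin T.m) = T.leaf l') : l = l' :=
  T.leaf.injective (Subtype.ext h)

/-- The edge at the leaf of the party `l`. -/
noncomputable def leafEdge (l : Fin n) : T.graph.edgeSet :=
  ⟨s(↑(T.leaf l), T.nbr (T.leaf l) 0), T.adj_leaf_nbr l⟩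

theorem inner_ne_leaf (v : T.Inner) (l : Fin n) : (v : Fin T.m) ≠ T.leaf l := by
  intro h
  have h1 := v.2
  rw [h, ncard_leaf] at h1
  omega

theorem prod_vertices {R : Type*} [CommMonoid R] (f : Fin T.m → R) :
    ∏ v, f v = (∏ v : T.Inner, f v) * ∏ l, f (T.leaf l) := by
  classical
  rw [← Fintype.prod_subtype_mul_prod_subtype (fun v => (T.graph.neighborSet v).ncard = 3) f]
  congr 1
  refine (Fintype.prod_equiv (T.leaf.trans (Equiv.subtypeEquivRight fun v => ?_)) _ _ ?_).symm
  · have := T.subcubic v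
    omega
  · intro l
    rfl

theorem eq_of_adj_inner {v : T.Inner} {a b c w : Fin T.m} (ha : T.graph.Adj v a)
    (hb : T.graph.Adj v b) (hc : T.graph.Adj v c) (hab : a ≠ b) (hac : a ≠ c) (hbc : b ≠ c)
    (hw : T.graph.Adj v w) : w = a ∨ w = b ∨ w = c := by
  have h : ({a, b, c} : Set (Fin T.m)) = T.graph.neighborSet v := by
    refine Set.eq_of_subset_of_ncard_le ?_ ?_ (Set.toFinite _)
    · rintro x (rfl | rfl | rfl)
      exacts [ha, hb, hc]
    · rw [v.2, Set.ncard_eq_three.2 ⟨a, b, c, hab, hac, hbc, rfl⟩]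
  have : w ∈ ({a, b, c} : Set (Fin T.m)) := by
    rw [h]
    exact hw
  simpa using this

open Classical in
/-- Contraction of a network over a subcubic tree by messages towards the leaf of `l₀`. -/
theorem sum_edges_eq_message {X R : Type*} [CommSemiring R] (l₀ : Fin n)
    (D : Sym2 (Fin T.m) → Finset X) (t : (v : T.Inner) → (T.graph.neighborSet v → X) → R)
    (E : Fin n → X → R) (M : Fin T.m → X → R)
    (hleaf : ∀ l, l ≠ l₀ → ∀ i ∈ D (T.leafEdge l), M (T.leaf l) i = E l i)
    (hinner : ∀ v : T.Inner, ∃ c₁ c₂ : Fin T.m, c₁ ≠ c₂ ∧ c₁ ≠ parent T.graph (T.leaf l₀) v ∧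
      c₂ ≠ parent T.graph (T.leaf l₀) v ∧ T.graph.Adj v c₁ ∧ T.graph.Adj v c₂ ∧
      ∀ i ∈ D s(↑v, parent T.graph (T.leaf l₀) v), M v i =
        ∑ j ∈ D s(↑v, c₁), ∑ k ∈ D s(↑v, c₂),
          t v (fun w => if (w : Fin T.m) = c₁ then j else if (w : Fin T.m) = c₂ then k else i) *
            (M c₁ j * M c₂ k)) :
    ∑ ρ ∈ Fintype.piFinset (fun e : T.graph.edgeSet => D e),
      (∏ v : T.Inner, t v fun w => ρ ⟨s(↑v, ↑w), w.2⟩) * ∏ l, E l (ρ (T.leafEdge l)) =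
    ∑ i ∈ D (T.leafEdge l₀), E l₀ i * M (T.nbr (T.leaf l₀) 0) i := by
  -- A dummy label is needed for the root coordinate; without labels both sides vanish.
  by_cases hX : IsEmpty X
  · have hempty : ∀ s : Finset X, s = ∅ := fun s => Finset.eq_empty_of_isEmpty s
    rw [hempty (D (T.leafEdge l₀)), Finset.sum_empty]
    refine Finset.sum_eq_zero fun ρ _ => ?_
    exact hX.elim (ρ (T.leafEdge l₀))
  obtain ⟨x₀⟩ := not_isEmpty_iff.1 hX
  set r : Fin T.m := (T.leaf l₀).1 with hr
  have hG := T.isTree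
  set c₀ := T.nbr r 0 with hc₀
  have hc₀adj : T.graph.Adj r c₀ := T.adj_leaf_nbr l₀
  have hc₀c : c₀ ≠ r ∧ parent T.graph r c₀ = r :=
    parent_eq_of_adj_of_ne hG hc₀adj fun h => (h rfl).elim
  rw [sum_edges_eq_marginal (r := r) hG D _ (fun _ => x₀)]
  -- The last branch never occurs, since every vertex has one or three neighbours.
  set F : Fin T.m → (Fin T.m → X) → R := fun v τ =>
    if h : (T.graph.neighborSet v).ncard = 3 then
      t ⟨v, h⟩ fun w => τ (lowerEnd T.graph r s(v, ↑w))
    else if h' : (T.graph.neighborSet v).ncard = 1 then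
      E (T.leaf.symm ⟨v, h'⟩) (τ (lowerEnd T.graph r s(v, T.nbr v 0)))
    else 1 with hFdef
  have hFinner : ∀ (v : T.Inner) τ, F v τ = t v fun w => τ (lowerEnd T.graph r s(↑v, ↑w)) := by
    intro v τ
    simp only [hFdef, dif_pos v.2]
  have hFleaf : ∀ (l : Fin n) τ,
      F (T.leaf l) τ = E l (τ (lowerEnd T.graph r s(↑(T.leaf l), T.nbr (T.leaf l) 0))) := by
    intro l τ
    have h1 := T.ncard_leaf l
    simp only [hFdef, h1, dif_pos, dif_neg (show ¬ (1 = 3) by omega), Subtype.coe_eta,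
      Equiv.symm_apply_apply]
  -- No edge leads upwards from the root, so its message is the value of the whole contraction and
  -- ignores the label.
  set M' : Fin T.m → X → R := fun v i =>
    if v = r then ∑ i ∈ D (T.leafEdge l₀), E l₀ i * M c₀ i else M v i with hM'
  have hchild_leaf : ∀ l, l ≠ l₀ → (Finset.univ.filter fun c => c ≠ r ∧ parent T.graph r c =
      (T.leaf l : Fin T.m)) = ∅ := by
    intro l hl
    have hlr : (T.leaf l : Fin T.m) ≠ r := fun h => hl (T.leaf_injective h)
    refine Finset.filter_eq_empty_iff.2 fun c _ hc => ?_
    have h1 : T.graph.Adj (T.leaf l) c := by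
      have := parent_adj hG hc.1
      rw [hc.2] at this
      exact this.symm
    have h2 := T.adj_leaf h1
    have h3 := T.adj_leaf (parent_adj hG hlr)
    exact parent_ne_of_child hG hlr hc.1 hc.2 (h2.trans h3.symm)
  have hchild_root : (Finset.univ.filter fun c => c ≠ r ∧ parent T.graph r c = r) = {c₀} := by
    ext c
    simp only [Finset.mem_filter, Finset.mem_univ, true_and, Finset.mem_singleton]
    refine ⟨fun hc => ?_, fun hc => hc ▸ hc₀c⟩
    have h1 : T.graph.Adj r c := by
      have := parent_adj hG hc.1
      rw [hc.2] at this
      exact this.symm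
    exact T.adj_leaf h1
  have main := marginal_tree (R := R) (X := X) r (parent T.graph r) (T.graph.dist r)
    (fun v hv => dist_parent_lt hG hv) (fun v => D s(v, parent T.graph r v)) F M' ?_ ?_
    (fun _ => x₀)
  · refine Eq.trans (marginal_congr _ fun τ _ _ => ?_) (main.trans ?_)
    · rw [T.prod_vertices]
      congr 1
      · exact Finset.prod_congr rfl fun v _ => (hFinner v τ).symm
      · exact Finset.prod_congr rfl fun l _ => (hFleaf l τ).symm
    · simp [hM']
  · intro v τ τ' h1 h2
    have hτ : ∀ w, T.graph.Adj v w →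
        τ (lowerEnd T.graph r s(v, w)) = τ' (lowerEnd T.graph r s(v, w)) := by
      intro w hw
      rcases parent_adj_cases (r := r) hG hw with h | h
      · rw [h.2, lowerEnd_parent hG h.1]
        exact h1 h.1
      · rw [lowerEnd_child hG h.1 h.2.symm]
        exact h2 w h.1 h.2.symm
    rcases T.subcubic v with h | h
    · obtain ⟨l, hl⟩ := T.leaf.surjective ⟨v, h⟩
      obtain rfl : (T.leaf l : Fin T.m) = v := by rw [hl]
      rw [hFleaf, hFleaf, hτ _ (T.adj_leaf_nbr l)]
    · have e1 := hFinner ⟨v, h⟩ τ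
      have e2 := hFinner ⟨v, h⟩ τ'
      simp only at e1 e2
      rw [e1, e2]
      congr 1
      funext w
      exact hτ w w.2
  · intro v σ hσ
    rcases T.subcubic v with h | h
    · obtain ⟨l, hl⟩ := T.leaf.surjective ⟨v, h⟩
      obtain rfl : (T.leaf l : Fin T.m) = v := by rw [hl]
      by_cases hll : l = l₀
      · subst hll
        rw [← hr, hchild_root, marginal_singleton]
        simp only [Finset.prod_singleton, Function.update_self, hM', if_pos, if_neg hc₀c.1]
        have e : (s(c₀, parent T.graph r c₀) : Sym2 _) = (T.leafEdge l : Sym2 (Fin T.m)) := by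
          rw [hc₀c.2, Sym2.eq_swap]
          rfl
        rw [e]
        refine Finset.sum_congr rfl fun i _ => ?_
        rw [hr, hFleaf, ← hr, ← hc₀, lowerEnd_child hG hc₀c.1 hc₀c.2, Function.update_self]
      · have hlr : (T.leaf l : Fin T.m) ≠ r := fun h => hll (T.leaf_injective h)
        rw [hchild_leaf l hll, marginal_empty]
        have hp := T.adj_leaf (parent_adj hG hlr)
        simp only [Finset.prod_empty, mul_one, hM', if_neg hlr]
        rw [hFleaf, ← hp, lowerEnd_parent hG hlr, hleaf l hll]
        have := hσ hlr
        rwa [hp] at this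
    · obtain ⟨c₁, c₂, hcc, h1, h2, ha1, ha2, hM⟩ := hinner ⟨v, h⟩
      simp only at h1 h2 ha1 ha2 hM
      have hvr : v ≠ r := T.inner_ne_leaf ⟨v, h⟩ l₀
      have hc1 := parent_eq_of_adj_of_ne hG ha1 (fun _ => h1)
      have hc2 := parent_eq_of_adj_of_ne hG ha2 (fun _ => h2)
      have hpar := parent_adj hG hvr
      have hch : (Finset.univ.filter fun c => c ≠ r ∧ parent T.graph r c = v) = {c₁, c₂} := by
        ext c
        simp only [Finset.mem_filter, Finset.mem_univ, true_and, Finset.mem_insert,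
          Finset.mem_singleton]
        constructor
        · intro hc
          have hadj : T.graph.Adj v c := by
            have := parent_adj hG hc.1
            rw [hc.2] at this
            exact this.symm
          rcases T.eq_of_adj_inner (v := ⟨v, h⟩) hpar ha1 ha2 h1.symm h2.symm hcc hadj with e | e
          · exact (parent_ne_of_child hG hvr hc.1 hc.2 e).elim
          · exact e
        · rintro (rfl | rfl)
          exacts [hc1, hc2]
      rw [hch, marginal_pair _ hcc]
      have hv1 : v ≠ c₁ := ha1.ne
      have hv2 : v ≠ c₂ := ha2.ne
      simp only [hM', if_neg hvr]
      rw [hM _ (hσ hvr), hc1.2, hc2.2, Sym2.eq_swap (a := c₁), Sym2.eq_swap (a := c₂)]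
      refine Finset.sum_congr rfl fun j _ => Finset.sum_congr rfl fun k _ => ?_
      rw [Finset.prod_pair hcc, Function.update_self, Function.update_of_ne hcc,
        Function.update_self, if_neg hc1.1, if_neg hc2.1]
      congr 1
      have e := hFinner ⟨v, h⟩ (Function.update (Function.update σ c₁ j) c₂ k)
      simp only at e
      rw [e]
      congr 1
      funext w
      rcases T.eq_of_adj_inner (v := ⟨v, h⟩) hpar ha1 ha2 h1.symm h2.symm hcc w.2 with e | e | e
      · rw [e, lowerEnd_parent hG hvr, Function.update_of_ne hv2, Function.update_of_ne hv1,
          if_neg h1.symm, if_neg h2.symm]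
      · rw [e, lowerEnd_child hG hc1.1 hc1.2, Function.update_of_ne hcc, Function.update_self,
          if_pos rfl]
      · rw [e, lowerEnd_child hG hc2.1 hc2.2, Function.update_self, if_neg hcc.symm, if_pos rfl]

/-- With `I` inner vertices, the degrees add up to `n + 3 I`, which is twice the number `m - 1` of
edges of a tree, and `m = n + I`. -/
theorem card_vertices : T.m + 2 = 2 * n := by
  classical
  have h1 := T.graph.sum_degrees_eq_twice_card_edges
  have h2 := T.isTree.card_edgeFinset
  have hdeg : ∀ v, T.graph.degree v = (T.graph.neighborSet v).ncard := by
    intro v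
    rw [← T.graph.card_neighborSet_eq_degree, Set.ncard_eq_toFinset_card', Set.toFinset_card]
  have hv : ∀ v : T.Inner, (T.graph.neighborSet v).ncard = 3 := fun v => v.2
  -- Sums over vertices are obtained from `prod_vertices` by way of `Multiplicative`.
  have h3 := congrArg Multiplicative.toAdd
    (T.prod_vertices (fun v => Multiplicative.ofAdd (T.graph.degree v)))
  simp only [toAdd_prod, toAdd_mul, toAdd_ofAdd, hdeg, hv, T.ncard_leaf,
    Finset.sum_const, Finset.card_univ, Fintype.card_fin, smul_eq_mul, mul_one] at h3
  have h4 := congrArg Multiplicative.toAdd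
    (T.prod_vertices (fun _ => Multiplicative.ofAdd 1))
  simp only [toAdd_prod, toAdd_mul, toAdd_ofAdd, Finset.sum_const, Finset.card_univ,
    Fintype.card_fin, smul_eq_mul, mul_one] at h4
  simp only [hdeg] at h1
  simp only [Fintype.card_fin] at h2
  omega

end SubcubicTree

end MQC

/-! ### Norms as contractions of the doubled network. -/

namespace MQC

open scoped ComplexConjugate

/-! ### Norms after local operators -/

variable {n d : ℕ}

/-- The operator on the party `l` that a list of local operators amounts to. -/
def localProduct : List (LocalOp n d) → Fin n → Matrix (Fin d) (Fin d) ℂ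
  | [] => fun _ => 1
  | K :: Ks => Function.update (localProduct Ks) K.party (K.op * localProduct Ks K.party)

theorem applyOps_eq_sum (Ks : List (LocalOp n d)) (ψ : State n d) (x : Fin n → Fin d) :
    applyOps Ks ψ x = ∑ y, (∏ l, localProduct Ks l (x l) (y l)) * ψ y := by
  induction Ks generalizing x with
  | nil =>
    have h : ∀ y : Fin n → Fin d, (∏ l, localProduct ([] : List (LocalOp n d)) l (x l) (y l)) =
        if x = y then 1 else 0 := by
      intro y
      simp only [localProduct, Matrix.one_apply]
      by_cases hxy : x = y
      · simp [hxy]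
      · obtain ⟨l, hl⟩ := Function.ne_iff.1 hxy
        rw [if_neg hxy]
        exact Finset.prod_eq_zero (Finset.mem_univ l) (by simp [hl])
    simp [h, applyOps]
  | cons K Ks ih =>
    simp only [applyOps, LocalOp.apply, ih, Finset.mul_sum]
    rw [Finset.sum_comm]
    refine Finset.sum_congr rfl fun y _ => ?_
    have h1 : ∀ z, (∏ l, localProduct Ks l (Function.update x K.party z l) (y l)) =
        localProduct Ks K.party z (y K.party) *
          ∏ l ∈ Finset.univ.erase K.party, localProduct Ks l (x l) (y l) := by
      intro z
      rw [← Finset.mul_prod_erase _ _ (Finset.mem_univ K.party), Function.update_self]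
      congr 1
      refine Finset.prod_congr rfl fun l hl => ?_
      rw [Function.update_of_ne (Finset.ne_of_mem_erase hl)]
    have h2 : (∏ l, localProduct (K :: Ks) l (x l) (y l)) =
        (∑ z, K.op (x K.party) z * localProduct Ks K.party z (y K.party)) *
          ∏ l ∈ Finset.univ.erase K.party, localProduct Ks l (x l) (y l) := by
      rw [← Finset.mul_prod_erase _ _ (Finset.mem_univ K.party)]
      congr 1
      · simp [localProduct, Matrix.mul_apply]
      · refine Finset.prod_congr rfl fun l hl => ?_
        rw [localProduct, Function.update_of_ne (Finset.ne_of_mem_erase hl)]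
    simp only [h1, h2, Finset.sum_mul]
    exact Finset.sum_congr rfl fun z _ => by ring

/-- The matrix entry with natural indices, zero out of range. -/
def entry (A : Matrix (Fin d) (Fin d) ℂ) (i j : ℕ) : ℂ :=
  if h : i < d ∧ j < d then A ⟨i, h.1⟩ ⟨j, h.2⟩ else 0

theorem entry_fin (A : Matrix (Fin d) (Fin d) ℂ) (i j : Fin d) : entry A i j = A i j := by
  simp [entry]

/-- The inner products of the columns of `A`. -/
noncomputable def gram (A : Matrix (Fin d) (Fin d) ℂ) (i j : ℕ) : ℂ :=
  ∑ a ∈ Finset.range d, entry A a i * conj (entry A a j)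

theorem gram_fin (A : Matrix (Fin d) (Fin d) ℂ) (i j : Fin d) :
    gram A i j = ∑ a, A a i * conj (A a j) := by
  rw [gram, Finset.sum_range]
  simp only [entry_fin]

theorem State.normSq_eq (ψ : State n d) : (ψ.normSq : ℂ) = ∑ x, ψ x * conj (ψ x) := by
  rw [State.normSq, Complex.ofReal_sum]
  refine Finset.sum_congr rfl fun x _ => ?_
  rw [Complex.mul_conj, Complex.normSq_eq_norm_sq]

theorem State.normSq_nonneg (ψ : State n d) : 0 ≤ ψ.normSq :=
  Finset.sum_nonneg fun _ _ => by positivity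

/-- The total operator is a product of one matrix per party, so the sum over the output index
factorizes and leaves at each party the inner product of two columns. -/
theorem normSq_applyOps (Ks : List (LocalOp n d)) (ψ : State n d) :
    ((applyOps Ks ψ).normSq : ℂ) =
      ∑ y, ψ y * ∑ y', conj (ψ y') * ∏ l, gram (localProduct Ks l) (y l) (y' l) := by
  simp only [gram_fin, Finset.prod_univ_sum, Fintype.piFinset_univ, State.normSq_eq,
    applyOps_eq_sum, map_sum, map_mul, Finset.mul_sum, Finset.sum_mul, map_prod,
    Finset.prod_mul_distrib]
  rw [Finset.sum_comm]
  conv_lhs => enter [2, y]; rw [Finset.sum_comm]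
  rw [Finset.sum_comm]
  refine Finset.sum_congr rfl fun y _ => Finset.sum_congr rfl fun y' _ =>
    Finset.sum_congr rfl fun x _ => ?_
  ring

/-- Only the Gram matrix at the measured party depends on `s`, and by completeness these matrices
add up to the identity. -/
theorem sum_normSq_kraus {q : ℕ} (M : LocalMeasurement n d q) (φ : State n d) :
    ∑ s, (LocalOp.apply ⟨M.party, M.kraus s⟩ φ).normSq = φ.normSq := by
  have h0 := normSq_applyOps ([] : List (LocalOp n d)) φ
  have h1 := fun s => normSq_applyOps [(⟨M.party, M.kraus s⟩ : LocalOp n d)] φ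
  simp only [applyOps] at h0 h1
  have : ((∑ s, (LocalOp.apply ⟨M.party, M.kraus s⟩ φ).normSq : ℝ) : ℂ) = φ.normSq := by
    rw [Complex.ofReal_sum, h0]
    simp only [h1]
    rw [Finset.sum_comm]
    refine Finset.sum_congr rfl fun y _ => ?_
    rw [← Finset.mul_sum, Finset.sum_comm]
    congr 1
    refine Finset.sum_congr rfl fun y' _ => ?_
    rw [← Finset.mul_sum]
    congr 1
    rw [← Finset.mul_prod_erase _ _ (Finset.mem_univ M.party)]
    have h2 : ∀ s, ∏ l, gram (localProduct [(⟨M.party, M.kraus s⟩ : LocalOp n d)] l)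
        (y l) (y' l) = (∑ a, M.kraus s a (y M.party) * conj (M.kraus s a (y' M.party))) *
          ∏ l ∈ Finset.univ.erase M.party,
            gram (localProduct ([] : List (LocalOp n d)) l) (y l) (y' l) := by
      intro s
      rw [← Finset.mul_prod_erase _ _ (Finset.mem_univ M.party)]
      congr 1
      · rw [gram_fin]
        simp [localProduct]
      · refine Finset.prod_congr rfl fun l hl => ?_
        simp [localProduct, Function.update_of_ne (Finset.ne_of_mem_erase hl)]
    simp only [h2, ← Finset.sum_mul]
    congr 1
    have h3 := congrFun (congrFun M.complete (y' M.party)) (y M.party)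
    rw [Matrix.sum_apply] at h3
    simp only [Matrix.mul_apply, Matrix.conjTranspose_apply] at h3
    rw [gram_fin]
    simp only [localProduct]
    rw [show (∑ a, (1 : Matrix (Fin d) (Fin d) ℂ) a (y M.party) *
      conj ((1 : Matrix (Fin d) (Fin d) ℂ) a (y' M.party))) =
        (1 : Matrix (Fin d) (Fin d) ℂ) (y' M.party) (y M.party) by
      simp [Matrix.one_apply, apply_ite], ← h3]
    refine Finset.sum_congr rfl fun s _ => Finset.sum_congr rfl fun a _ => ?_
    rw [mul_comm]
    rfl
  exact_mod_cast this

/-! ### Contraction of the doubled network -/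

variable {T : SubcubicTree n}

theorem TTN.dim_leafEdge (N : TTN T d) (l : Fin n) : N.dim (T.leafEdge l) = d :=
  N.dim_open l _ (T.adj_leaf_nbr l)

open Classical in
-- The indicator in `contract` ties the labels at the leaves to `y`, so the sum over `y` merely
-- frees these labels.
theorem TTN.sum_contract_mul (N : TTN T d) (g : (Fin n → ℕ) → ℂ) :
    ∑ y, N.contract y * g (fun l => y l) =
      ∑ σ ∈ Fintype.piFinset fun e : T.graph.edgeSet => Finset.range (N.dim e),
        (∏ v : T.Inner, N.tensor v fun w => σ ⟨s(↑v, ↑w), w.2⟩) *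
          g (fun l => σ (T.leafEdge l)) := by
  simp only [contract, Finset.sum_mul]
  rw [Finset.sum_comm]
  refine Finset.sum_congr rfl fun σ hσ => ?_
  have hd : ∀ l, σ (T.leafEdge l) < d := by
    intro l
    have := (Fintype.mem_piFinset.1 hσ) (T.leafEdge l)
    rwa [N.dim_leafEdge, Finset.mem_range] at this
  rw [Finset.sum_eq_single (fun l => (⟨σ (T.leafEdge l), hd l⟩ : Fin d))]
  · rw [if_pos]
    intro l w h
    obtain rfl := T.adj_leaf h
    rfl
  · intro y _ hy
    rw [if_neg, zero_mul]
    intro h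
    refine hy (funext fun l => Fin.ext ?_)
    exact (h l _ (T.adj_leaf_nbr l)).symm
  · simp

/-- Two copies of a network with the same edges are one network labelled by pairs. -/
theorem sum_piFinset_product {ι X : Type*} [Fintype ι] [DecidableEq ι]
    (D : ι → Finset X) (f : (ι → X) → (ι → X) → ℂ) :
    ∑ σ ∈ Fintype.piFinset D, ∑ σ' ∈ Fintype.piFinset D, f σ σ' =
      ∑ ρ ∈ Fintype.piFinset fun i => D i ×ˢ D i,
        f (fun i => (ρ i).1) (fun i => (ρ i).2) := by
  rw [← Finset.sum_product']
  refine Finset.sum_bij' (fun p _ i => (p.1 i, p.2 i))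
    (fun ρ _ => (fun i => (ρ i).1, fun i => (ρ i).2)) ?_ ?_ ?_ ?_ ?_
  · intro p hp
    simp only [Finset.mem_product, Fintype.mem_piFinset] at hp ⊢
    exact fun i => ⟨hp.1 i, hp.2 i⟩
  · intro ρ hρ
    simp only [Finset.mem_product, Fintype.mem_piFinset] at hρ ⊢
    exact ⟨fun i => (hρ i).1, fun i => (hρ i).2⟩
  · intro p _
    rfl
  · intro ρ _
    rfl
  · intro p _
    rfl

open Classical in
/-- The norm of the state after local operators, in terms of messages `M` in the doubled network
towards the leaf of `l₀`. -/
theorem TTN.normSq_eq_message (N : TTN T d) (Ks : List (LocalOp n d)) (l₀ : Fin n)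
    (M : Fin T.m → ℕ → ℕ → ℂ)
    (hleaf : ∀ l, l ≠ l₀ → ∀ i < d, ∀ i' < d, M (T.leaf l) i i' = gram (localProduct Ks l) i i')
    (hinner : ∀ v : T.Inner, ∃ c₁ c₂ : Fin T.m, c₁ ≠ c₂ ∧ c₁ ≠ parent T.graph (T.leaf l₀) v ∧
      c₂ ≠ parent T.graph (T.leaf l₀) v ∧ T.graph.Adj v c₁ ∧ T.graph.Adj v c₂ ∧
      ∀ i < N.dim s(↑v, parent T.graph (T.leaf l₀) v),
      ∀ i' < N.dim s(↑v, parent T.graph (T.leaf l₀) v), M v i i' =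
        ∑ j ∈ Finset.range (N.dim s(↑v, c₁)), ∑ j' ∈ Finset.range (N.dim s(↑v, c₁)),
        ∑ k ∈ Finset.range (N.dim s(↑v, c₂)), ∑ k' ∈ Finset.range (N.dim s(↑v, c₂)),
          N.tensor v (fun w => if (w : Fin T.m) = c₁ then j else
            if (w : Fin T.m) = c₂ then k else i) *
          conj (N.tensor v (fun w => if (w : Fin T.m) = c₁ then j' else
            if (w : Fin T.m) = c₂ then k' else i')) *
            (M c₁ j j' * M c₂ k k')) :
    ((applyOps Ks N.contract).normSq : ℂ) =
      ∑ i ∈ Finset.range d, ∑ i' ∈ Finset.range d,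
        gram (localProduct Ks l₀) i i' * M (T.nbr (T.leaf l₀) 0) i i' := by
  have h1 := T.sum_edges_eq_message l₀ (fun e => Finset.range (N.dim e) ×ˢ Finset.range (N.dim e))
    (fun v f => N.tensor v (fun w => (f w).1) * conj (N.tensor v (fun w => (f w).2)))
    (fun l p => gram (localProduct Ks l) p.1 p.2) (fun v p => M v p.1 p.2) ?_ ?_
  · rw [N.dim_leafEdge, Finset.sum_product] at h1
    rw [← h1, normSq_applyOps]
    -- `sum_contract_mul` speaks of the unconjugated coefficients, so the inner sum is conjugated,
    -- rewritten and conjugated back.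
    have h2 : ∀ (u : Fin n → ℕ), ∑ y', conj (N.contract y') *
        ∏ l, gram (localProduct Ks l) (u l) (y' l) =
        conj (∑ σ ∈ Fintype.piFinset fun e : T.graph.edgeSet => Finset.range (N.dim e),
        (∏ v : T.Inner, N.tensor v fun w => σ ⟨s(↑v, ↑w), w.2⟩) *
          conj (∏ l, gram (localProduct Ks l) (u l) (σ (T.leafEdge l)))) := by
      intro u
      rw [← N.sum_contract_mul (fun y' => conj (∏ l, gram (localProduct Ks l) (u l) (y' l)))]
      simp only [map_sum, map_mul, Complex.conj_conj]
    have h3 : ∀ y : Fin n → Fin d, ∑ y', conj (N.contract y') *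
        ∏ l, gram (localProduct Ks l) (y l) (y' l) = _ := fun y => h2 fun l => y l
    simp only [h3]
    rw [N.sum_contract_mul (fun u => conj (∑ σ ∈ Fintype.piFinset fun e : T.graph.edgeSet =>
      Finset.range (N.dim e), (∏ v : T.Inner, N.tensor v fun w => σ ⟨s(↑v, ↑w), w.2⟩) *
          conj (∏ l, gram (localProduct Ks l) (u l) (σ (T.leafEdge l)))))]
    simp only [map_sum, map_mul, Complex.conj_conj, Finset.mul_sum]
    rw [sum_piFinset_product (fun e : T.graph.edgeSet => Finset.range (N.dim e))
      (fun σ σ' => (∏ v : T.Inner, N.tensor v fun w => σ ⟨s(↑v, ↑w), w.2⟩) *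
        (conj (∏ v : T.Inner, N.tensor v fun w => σ' ⟨s(↑v, ↑w), w.2⟩) *
        ∏ l, gram (localProduct Ks l) (σ (T.leafEdge l)) (σ' (T.leafEdge l))))]
    refine Finset.sum_congr rfl fun ρ _ => ?_
    rw [map_prod, ← mul_assoc, ← Finset.prod_mul_distrib]
  · intro l hl p hp
    rw [N.dim_leafEdge, Finset.mem_product, Finset.mem_range, Finset.mem_range] at hp
    exact hleaf l hl _ hp.1 _ hp.2
  · intro v
    obtain ⟨c₁, c₂, h1, h2, h3, h4, h5, h⟩ := hinner v
    refine ⟨c₁, c₂, h1, h2, h3, h4, h5, fun p hp => ?_⟩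
    rw [Finset.mem_product, Finset.mem_range, Finset.mem_range] at hp
    rw [h _ hp.1 _ hp.2, Finset.sum_product]
    refine Finset.sum_congr rfl fun j _ => Finset.sum_congr rfl fun j' _ => ?_
    rw [Finset.sum_product]
    refine Finset.sum_congr rfl fun k _ => Finset.sum_congr rfl fun k' _ => ?_
    congr 3
    · funext w
      simp only [apply_ite Prod.fst]
    · congr 1
      funext w
      simp only [apply_ite Prod.snd]

end MQC

/-! ### Reading the network from memory and rooting the tree. -/

namespace MQC

variable {n d : ℕ} {T : SubcubicTree n}

/-! ### The description of the network -/

theorem TTN.encode_vertices (N : TTN T d) : N.encode.idx 0 0 0 = T.m := by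
  simp [encode]

theorem TTN.encode_parties (N : TTN T d) : N.encode.idx 0 0 1 = n := by
  simp [encode]

theorem TTN.encode_nbr (N : TTN T d) {v : Fin T.m} {t : ℕ} (ht : t < (T.nbrs v).length) :
    N.encode.idx 1 v t = T.nbr v t := by
  simp [encode, ht, T.nbr_eq ht]

theorem TTN.encode_degree (N : TTN T d) (v : Fin T.m) :
    N.encode.idx 2 v 0 = (T.nbrs v).length := by
  simp [encode]

theorem TTN.encode_dim (N : TTN T d) {v : Fin T.m} {t : ℕ} (ht : t < (T.nbrs v).length) :
    N.encode.idx 3 v t = N.dim s(v, T.nbr v t) := by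
  simp [encode, ht, T.nbr_eq ht]

theorem TTN.encode_leaf (N : TTN T d) (l : Fin n) :
    N.encode.idx 4 l 0 = (T.leaf l : Fin T.m) := by
  simp [encode]

theorem TTN.encode_num_eq_zero (N : TTN T d) {a : ℕ} (ha : a ≠ 0) (i j k l : ℕ) :
    N.encode.num a i j k l = 0 := by
  simp only [encode]
  split_ifs <;> first | rfl | omega

/-! ### Breadth-first traversal of the tree -/

theorem Store.setI_idx_of_ne {s : Store} {a a' : ℕ} (h : a' ≠ a) (i j v : ℕ) :
    (s.setI a i j v).idx a' = s.idx a' := by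
  funext i' j'
  simp [setI, h]

theorem Store.setI_idx_self {s : Store} {a i j v i' j' : ℕ} :
    (s.setI a i j v).idx a i' j' = if i' = i ∧ j' = j then v else s.idx a i' j' := by
  simp [setI]

theorem SubcubicTree.length_nbrs_le (T : SubcubicTree n) (v : Fin T.m) :
    (T.nbrs v).length ≤ 3 := by
  rw [T.length_nbrs]
  rcases T.subcubic v with h | h <;> omega

/-- The root is its own parent in memory as well, so the comparison with the parent in `traverse`
fails for all its neighbours and they are listed as children. -/
theorem parent_self {V : Type*} {G : SimpleGraph V} {r : V} : parent G r r = r := by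
  unfold parent
  simp

/-- The array `10` lists the vertices such that every vertex other than the root `r` comes after its
parent, and the array `12` holds the position of the parent among the neighbours. -/
structure Traversal (T : SubcubicTree n) (r : Fin T.m) (ι : Idx) (L : List (Fin T.m)) : Prop where
  nodup : L.Nodup
  mem : ∀ w, w ∈ L
  list : ∀ (j : ℕ) (w : Fin T.m), L[j]? = some w → ι 10 j 0 = w
  order : ∀ (j : ℕ) (w : Fin T.m), L[j]? = some w → w ≠ r → parent T.graph r w ∈ L.take j
  pos_lt : ∀ w, w ≠ r → ι 12 w 0 < (T.nbrs w).length
  nbr_pos : ∀ w, w ≠ r → T.nbr w (ι 12 w 0) = parent T.graph r w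

/-- The state of the traversal when the first `h` vertices of the list `L` and the first `t`
neighbours of the next vertex have been inspected. -/
structure TraversalState (T : SubcubicTree n) (r : Fin T.m) (s₀ : Store) (h t : ℕ)
    (L : List (Fin T.m)) (s : Store) : Prop where
  frame : ∀ a < 10, s.idx a = s₀.idx a
  num : s.num = s₀.num
  nodup : L.Nodup
  len : s.idx 13 0 0 = L.length
  list : ∀ (j : ℕ) (w : Fin T.m), L[j]? = some w → s.idx 10 j 0 = w
  par : ∀ w ∈ L, s.idx 11 w 0 = parent T.graph r w
  mem : ∀ w, w ∈ L ↔ w = r ∨ (w ≠ r ∧ (parent T.graph r w ∈ L.take h ∨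
    (L[h]? = some (parent T.graph r w) ∧ ∃ t' < t, T.nbr (parent T.graph r w) t' = w)))
  order : ∀ (j : ℕ) (w : Fin T.m), L[j]? = some w → w ≠ r → parent T.graph r w ∈ L.take j
  pos : ∀ w ∈ L.take h, w ≠ r →
    s.idx 12 w 0 < (T.nbrs w).length ∧ T.nbr w (s.idx 12 w 0) = parent T.graph r w
  pos_next : ∀ w, L[h]? = some w → w ≠ r → ∀ t' < t, T.nbr w t' = parent T.graph r w →
    s.idx 12 w 0 = t'

namespace TraversalState

variable {r : Fin T.m} {s₀ s : Store} {h t : ℕ} {L : List (Fin T.m)}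

theorem of_agree (H : TraversalState T r s₀ h t L s) {s' : Store}
    (hidx : ∀ a < 14, s'.idx a = s.idx a) (hnum : s'.num = s.num) :
    TraversalState T r s₀ h t L s' where
  frame a ha := by rw [hidx a (by omega), H.frame a ha]
  num := by rw [hnum, H.num]
  nodup := H.nodup
  len := by rw [hidx 13 (by omega), H.len]
  list := by rw [hidx 10 (by omega)]; exact H.list
  par := by rw [hidx 11 (by omega)]; exact H.par
  mem := H.mem
  order := H.order
  pos := by rw [hidx 12 (by omega)]; exact H.pos
  pos_next := by rw [hidx 12 (by omega)]; exact H.pos_next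

/-- If every listed vertex has been inspected, the list contains the root and is closed under
children; induction on the distance from the root. -/
theorem mem_of_closed (H : TraversalState T r s₀ h 0 L s) (hL : L.length ≤ h) (w : Fin T.m) :
    w ∈ L := by
  induction hd : T.graph.dist r w using Nat.strong_induction_on generalizing w with
  | _ k ih =>
    rw [H.mem]
    by_cases hw : w = r
    · exact Or.inl hw
    · refine Or.inr ⟨hw, Or.inl ?_⟩
      rw [List.take_of_length_le hL]
      exact ih _ (hd ▸ dist_parent_lt T.isTree hw) _ rfl

theorem length_le (H : TraversalState T r s₀ h t L s) : L.length ≤ T.m := by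
  simpa using H.nodup.length_le_card

/-- The queue cannot run empty early: an exhausted list contains all vertices and thus has at least
`T.m > h` entries. -/
theorem exists_next (H : TraversalState T r s₀ h 0 L s) (hh : h < T.m) : ∃ v, L[h]? = some v := by
  by_contra hcon
  have hL : L.length ≤ h := by
    by_contra hlt
    exact hcon ⟨L[h], List.getElem?_eq_getElem (by omega)⟩
  have h1 : Finset.univ ⊆ L.toFinset := fun w _ => List.mem_toFinset.2 (H.mem_of_closed hL w)
  have h2 := Finset.card_le_card h1
  have h3 := L.toFinset_card_le
  simp only [Finset.card_univ, Fintype.card_fin] at h2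
  omega

theorem finish (H : TraversalState T r s₀ T.m 0 L s) : Traversal T r s.idx L := by
  have hmem := H.mem_of_closed H.length_le
  refine ⟨H.nodup, hmem, H.list, H.order, fun w hw => ?_, fun w hw => ?_⟩
  · exact (H.pos w (by rw [List.take_of_length_le H.length_le]; exact hmem w) hw).1
  · exact (H.pos w (by rw [List.take_of_length_le H.length_le]; exact hmem w) hw).2

theorem next (H : TraversalState T r s₀ h t L s) {v : Fin T.m} (hv : L[h]? = some v)
    (ht : t = (T.nbrs v).length) : TraversalState T r s₀ (h + 1) 0 L s where
  frame := H.frame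
  num := H.num
  nodup := H.nodup
  len := H.len
  list := H.list
  par := H.par
  order := H.order
  mem w := by
    rw [H.mem]
    simp only [List.take_add_one, hv, Option.toList_some, List.mem_append, List.mem_singleton,
      Option.some.injEq]
    constructor
    · rintro (h1 | ⟨h1, h2 | ⟨h2, -⟩⟩)
      · exact Or.inl h1
      · exact Or.inr ⟨h1, Or.inl (Or.inl h2)⟩
      · exact Or.inr ⟨h1, Or.inl (Or.inr h2.symm)⟩
    · rintro (h1 | ⟨h1, (h2 | h2) | ⟨-, t', h2, -⟩⟩)
      · exact Or.inl h1
      · exact Or.inr ⟨h1, Or.inl h2⟩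
      · refine Or.inr ⟨h1, Or.inr ⟨h2.symm, ?_⟩⟩
        have := (parent_adj T.isTree h1).symm
        obtain ⟨t', ht', e⟩ := T.exists_nbr this
        exact ⟨t', by rw [ht, ← h2]; exact ht', e⟩
      · omega
  pos w hw hwr := by
    simp only [List.take_add_one, hv, Option.toList_some, List.mem_append,
      List.mem_singleton] at hw
    rcases hw with hw | rfl
    · exact H.pos w hw hwr
    · obtain ⟨t', ht', e⟩ := T.exists_nbr (parent_adj T.isTree hwr)
      rw [H.pos_next w hv hwr t' (by omega) e]
      exact ⟨ht', e⟩
  pos_next w _ _ t' ht' := by omega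

/-- The neighbour inspected is the parent: its position is recorded and the list does not change. -/
theorem skip (H : TraversalState T r s₀ h t L s) {v : Fin T.m} (hv : L[h]? = some v)
    (ht : t < (T.nbrs v).length) (hp : T.nbr v t = parent T.graph r v) :
    TraversalState T r s₀ h (t + 1) L (s.setI 12 v 0 t) := by
  have hadj := T.adj_nbr ht
  have hvr : v ≠ r := by
    rintro rfl
    rw [parent_self] at hp
    rw [hp] at hadj
    exact hadj.ne rfl
  constructor
  case frame => exact fun a ha => by rw [Store.setI_idx_of_ne (by omega), H.frame a ha]
  case num => exact H.num
  case nodup => exact H.nodup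
  case len => rw [Store.setI_idx_of_ne (by omega), H.len]
  case list => rw [Store.setI_idx_of_ne (by omega)]; exact H.list
  case par => rw [Store.setI_idx_of_ne (by omega)]; exact H.par
  case order => exact H.order
  case mem =>
    intro w
    rw [H.mem]
    refine or_congr_right (and_congr_right fun hw => or_congr_right (and_congr_right fun h1 => ?_))
    have h2 : parent T.graph r w = v := by
      rw [hv] at h1
      exact (Option.some.inj h1).symm
    refine ⟨fun ⟨t', h3, h4⟩ => ⟨t', by omega, h4⟩, fun ⟨t', h3, h4⟩ => ⟨t', ?_, h4⟩⟩
    rcases Nat.lt_succ_iff_lt_or_eq.1 h3 with h5 | rfl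
    · exact h5
    · rw [h2, hp] at h4
      exact (parent_ne_of_child T.isTree hvr hw h2 h4.symm).elim
  case pos =>
    intro w hw hwr
    rw [Store.setI_idx_self, if_neg]
    · exact H.pos w hw hwr
    · rintro ⟨h1, -⟩
      obtain rfl := Fin.ext h1
      obtain ⟨j, hj, hjw⟩ := List.getElem_of_mem hw
      rw [List.length_take] at hj
      rw [List.getElem_take] at hjw
      obtain ⟨hh, hhw⟩ := List.getElem?_eq_some_iff.1 hv
      have := (H.nodup.getElem_inj_iff (hi := by omega) (hj := hh)).1 (hjw.trans hhw.symm)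
      omega
  case pos_next =>
    intro w hw hwr t' ht' h1
    rw [hv] at hw
    obtain rfl := Option.some.inj hw
    rw [Store.setI_idx_self, if_pos ⟨rfl, rfl⟩]
    rcases Nat.lt_succ_iff_lt_or_eq.1 ht' with h5 | rfl
    · exact T.nbr_inj ht (by omega) (hp.trans h1.symm)
    · rfl

/-- The neighbour inspected is a child of `v`. It is not listed yet: `v` occurs only at position
`h`, so it is not among the vertices already finished, and earlier neighbours of `v` are different.
-/
theorem push (H : TraversalState T r s₀ h t L s) {v : Fin T.m} (hv : L[h]? = some v)
    (ht : t < (T.nbrs v).length) (hp : T.nbr v t ≠ parent T.graph r v) :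
    TraversalState T r s₀ h (t + 1) (L ++ [T.nbr v t])
      (((s.setI 11 (T.nbr v t) 0 v).setI 10 L.length 0 (T.nbr v t)).setI 13 0 0
        (L.length + 1)) := by
  set u := T.nbr v t with hu
  have hadj : T.graph.Adj v u := T.adj_nbr ht
  obtain ⟨hur, hpu⟩ := parent_eq_of_adj_of_ne (r := r) T.isTree hadj fun _ => hp
  obtain ⟨hh, hhv⟩ := List.getElem?_eq_some_iff.1 hv
  have huL : u ∉ L := by
    rw [H.mem]
    rintro (h1 | ⟨-, h1 | ⟨-, t', h1, h2⟩⟩)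
    · exact hur h1
    · rw [hpu] at h1
      obtain ⟨j, hj, hjw⟩ := List.getElem_of_mem h1
      rw [List.length_take] at hj
      rw [List.getElem_take] at hjw
      have := (H.nodup.getElem_inj_iff (hi := by omega) (hj := hh)).1 (hjw.trans hhv.symm)
      omega
    · rw [hpu] at h2
      have := T.nbr_inj (by omega) ht h2
      omega
  have htake : ∀ j ≤ L.length, (L ++ [u]).take j = L.take j := fun j hj =>
    List.take_append_of_le_length hj
  have hget : ∀ (j : ℕ) (w : Fin T.m), (L ++ [u])[j]? = some w → L[j]? = some w ∨ (j = L.length ∧ w = u) := by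
    intro j w hj
    rcases lt_trichotomy j L.length with h1 | rfl | h1
    · rw [List.getElem?_append_left h1] at hj
      exact Or.inl hj
    · simp at hj
      exact Or.inr ⟨rfl, hj.symm⟩
    · rw [List.getElem?_eq_none (by simp; omega)] at hj
      cases hj
  have hgeth : (L ++ [u])[h]? = some v := by rw [List.getElem?_append_left hh, hv]
  constructor
  case frame =>
    intro a ha
    rw [Store.setI_idx_of_ne (by omega), Store.setI_idx_of_ne (by omega),
      Store.setI_idx_of_ne (by omega), H.frame a ha]
  case num => exact H.num
  case nodup =>
    rw [List.nodup_append]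
    refine ⟨H.nodup, by simp, ?_⟩
    intro a ha b hb
    simp only [List.mem_singleton] at hb
    subst hb
    rintro rfl
    exact huL ha
  case len => simp [Store.setI_idx_self]
  case list =>
    intro j w hj
    rw [Store.setI_idx_of_ne (by omega), Store.setI_idx_self]
    rcases hget j w hj with h1 | ⟨rfl, rfl⟩
    · have := (List.getElem?_eq_some_iff.1 h1).1
      rw [if_neg (by omega), Store.setI_idx_of_ne (by omega)]
      exact H.list j w h1
    · simp
  case par =>
    intro w hw
    rw [Store.setI_idx_of_ne (by omega), Store.setI_idx_of_ne (by omega), Store.setI_idx_self]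
    by_cases hwu : w = u
    · subst hwu
      simp [hpu]
    · rw [if_neg (by simpa [Fin.ext_iff] using hwu)]
      refine H.par w ?_
      simpa [hwu] using hw
  case order =>
    intro j w hj hwr
    rcases hget j w hj with h1 | ⟨rfl, rfl⟩
    · rw [htake j (List.getElem?_eq_some_iff.1 h1).1.le]
      exact H.order j w h1 hwr
    · rw [htake _ le_rfl, List.take_length, hpu]
      exact hhv ▸ List.getElem_mem hh
  case mem =>
    intro w
    rw [htake h hh.le, hgeth, List.mem_append, List.mem_singleton, H.mem, hv]
    constructor
    · rintro ((h1 | ⟨h1, h2 | ⟨h2, t', h3, h4⟩⟩) | rfl)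
      · exact Or.inl h1
      · exact Or.inr ⟨h1, Or.inl h2⟩
      · exact Or.inr ⟨h1, Or.inr ⟨h2, t', by omega, h4⟩⟩
      · exact Or.inr ⟨hur, Or.inr ⟨by rw [hpu], t, by omega, by rw [hpu]⟩⟩
    · rintro (h1 | ⟨h1, h2 | ⟨h2, t', h3, h4⟩⟩)
      · exact Or.inl (Or.inl h1)
      · exact Or.inl (Or.inr ⟨h1, Or.inl h2⟩)
      · rcases Nat.lt_succ_iff_lt_or_eq.1 h3 with h5 | rfl
        · exact Or.inl (Or.inr ⟨h1, Or.inr ⟨h2, t', h5, h4⟩⟩)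
        · right
          rw [hu, ← h4, ← Option.some.inj h2]
  case pos =>
    rw [htake h hh.le, Store.setI_idx_of_ne (by omega), Store.setI_idx_of_ne (by omega),
      Store.setI_idx_of_ne (by omega)]
    exact H.pos
  case pos_next =>
    intro w hw hwr t' ht' h1
    rw [hgeth] at hw
    obtain rfl := Option.some.inj hw
    rw [Store.setI_idx_of_ne (by omega), Store.setI_idx_of_ne (by omega),
      Store.setI_idx_of_ne (by omega)]
    rcases Nat.lt_succ_iff_lt_or_eq.1 ht' with h5 | rfl
    · exact H.pos_next v hv hwr t' h5 h1
    · exact (hp h1).elim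

end TraversalState

/-- The vertex that is inspected by the traversal. -/
def traverseVertex : IExp := .get 10 (.var 20) (.lit 0)

def traverseNbr : IExp := .get 1 traverseVertex (.var 21)

/-- Breadth-first traversal from the leaf of the party `0`. -/
def traverse : Cmd :=
  .seq (.setI 10 (.lit 0) (.lit 0) (.var 4))
  (.seq (.setI 11 (.var 4) (.lit 0) (.var 4))
  (.seq (.setI 13 (.lit 0) (.lit 0) (.lit 1))
  (.forLoop 20 (.var 0)
    (.forLoop 21 (.get 2 traverseVertex (.lit 0))
      (.ite (.eq traverseNbr (.get 11 traverseVertex (.lit 0)))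
        (.setI 12 traverseVertex (.lit 0) (.var 21))
        (.seq (.setI 11 traverseNbr (.lit 0) traverseVertex)
        (.seq (.setI 10 (.var 13) (.lit 0) traverseNbr)
          (.setI 13 (.lit 0) (.lit 0) (.add (.var 13) (.lit 1))))))))))

/-- Only the description of the tree is required of the initial memory, so the traversal may be
repeated at every measurement. With at most three neighbours a vertex costs `3 · 9 + 3 = 30` steps
and `3` for the outer loop; `33 m + 9 ≤ 42 m`. -/
theorem runs_traverse (N : TTN T d) (l₀ : Fin n) (hl₀ : (l₀ : ℕ) = 0) {s₀ : Store}
    (hs₀ : ∀ a < 5, s₀.idx a = N.encode.idx a) :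
    ∃ s L, Runs traverse s₀ s (42 * T.m) ∧ (∀ a < 10, s.idx a = s₀.idx a) ∧
      s.num = s₀.num ∧ Traversal T (T.leaf l₀) s.idx L := by
  set r : Fin T.m := (T.leaf l₀).1 with hr
  have hroot : ∀ s : Store, (∀ a < 10, s.idx a = s₀.idx a) → (IExp.var 4).eval s = r := by
    intro s hs
    simp only [IExp.var, IExp.eval, hs 4 (by omega), hs₀ 4 (by omega)]
    have := N.encode_leaf l₀
    rwa [hl₀] at this
  have hm : 0 < T.m := Fin.pos r
  obtain ⟨s₁, hs₁⟩ : ∃ s₁, s₁ = ((s₀.setI 10 0 0 r).setI 11 r 0 r).setI 13 0 0 1 := ⟨_, rfl⟩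
  have hinit : TraversalState T r s₀ 0 0 [r] s₁ := by
    subst hs₁
    constructor
    case frame =>
      intro a ha
      rw [Store.setI_idx_of_ne (by omega), Store.setI_idx_of_ne (by omega),
        Store.setI_idx_of_ne (by omega)]
    case num => rfl
    case nodup => simp
    case len => simp [Store.setI_idx_self]
    case list =>
      intro j w hj
      obtain ⟨h1, h2⟩ := List.getElem?_eq_some_iff.1 hj
      simp only [List.length_singleton] at h1
      obtain rfl : j = 0 := by omega
      simp only [List.getElem_cons_zero] at h2
      subst h2
      rw [Store.setI_idx_of_ne (by omega), Store.setI_idx_of_ne (by omega), Store.setI_idx_self]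
      simp
    case par =>
      intro w hw
      simp only [List.mem_singleton] at hw
      subst hw
      rw [Store.setI_idx_of_ne (by omega), Store.setI_idx_self, parent_self]
      simp
    case mem => simp
    case order =>
      intro j w hj hw
      have := List.mem_of_getElem? hj
      simp only [List.mem_singleton] at this
      exact (hw this).elim
    case pos => simp
    case pos_next => intro _ _ _ t' ht'; omega
  have hrun₁ : ∀ {s' B}, Runs (.forLoop 20 (.var 0)
    (.forLoop 21 (.get 2 traverseVertex (.lit 0))
      (.ite (.eq traverseNbr (.get 11 traverseVertex (.lit 0)))
        (.setI 12 traverseVertex (.lit 0) (.var 21))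
        (.seq (.setI 11 traverseNbr (.lit 0) traverseVertex)
        (.seq (.setI 10 (.var 13) (.lit 0) traverseNbr)
          (.setI 13 (.lit 0) (.lit 0) (.add (.var 13) (.lit 1)))))))) s₁ s' B →
      Runs traverse s₀ s' (B + 6) := by
    intro s' B hrun
    subst hs₁
    have e1 := hroot s₀ fun _ _ => rfl
    have e2 := hroot (s₀.setI 10 0 0 r) fun a ha => Store.setI_idx_of_ne (by omega) _ _ _
    have r1 := runs_setI 10 (.lit 0) (.lit 0) (.var 4) s₀
    have r2 := runs_setI 11 (.var 4) (.lit 0) (.var 4) (s₀.setI 10 0 0 r)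
    have r3 := runs_setI 13 (.lit 0) (.lit 0) (.lit 1) ((s₀.setI 10 0 0 r).setI 11 r 0 r)
    rw [e1] at r1
    rw [e2] at r2
    exact (r1.seq (r2.seq (r3.seq hrun))).mono (by omega)
  have key : ∃ s', Runs (.forLoop 20 (.var 0)
    (.forLoop 21 (.get 2 traverseVertex (.lit 0))
      (.ite (.eq traverseNbr (.get 11 traverseVertex (.lit 0)))
        (.setI 12 traverseVertex (.lit 0) (.var 21))
        (.seq (.setI 11 traverseNbr (.lit 0) traverseVertex)
        (.seq (.setI 10 (.var 13) (.lit 0) traverseNbr)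
          (.setI 13 (.lit 0) (.lit 0) (.add (.var 13) (.lit 1)))))))) s₁ s'
        (T.m * (30 + 3) + 3) ∧ (∃ L, TraversalState T r s₀ T.m 0 L s') ∧
          s'.idx 20 0 0 = T.m := by
    refine runs_forLoop (I := fun h s => (∃ L, TraversalState T r s₀ h 0 L s) ∧ s.idx 20 0 0 = h)
      ⟨⟨[r], hinit.of_agree (fun a ha => Store.setI_idx_of_ne (by omega) _ _ _) rfl⟩,
        by simp [Store.setI_idx_self]⟩ (fun h s H => H.2) ?_ ?_
    · rintro h s ⟨⟨L, H⟩, -⟩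
      simp only [IExp.var, IExp.eval, H.frame 0 (by omega), hs₀ 0 (by omega), N.encode_vertices]
    · rintro h hh s ⟨⟨L, H⟩, hs20⟩
      obtain ⟨v, hv⟩ := H.exists_next hh
      have hvtx : ∀ (s : Store) (L : List (Fin T.m)) (t : ℕ), TraversalState T r s₀ h t L s →
          L[h]? = some v → s.idx 20 0 0 = h → traverseVertex.eval s = v := by
        intro s L t H hv h20
        simp only [traverseVertex, IExp.var, IExp.eval, h20]
        exact H.list h v hv
      have inner := runs_forLoop (k := 21) (bound := .get 2 traverseVertex (.lit 0))
        (c := .ite (.eq traverseNbr (.get 11 traverseVertex (.lit 0)))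
        (.setI 12 traverseVertex (.lit 0) (.var 21))
        (.seq (.setI 11 traverseNbr (.lit 0) traverseVertex)
        (.seq (.setI 10 (.var 13) (.lit 0) traverseNbr)
          (.setI 13 (.lit 0) (.lit 0) (.add (.var 13) (.lit 1))))))
        (N := (T.nbrs v).length) (B := 6) (s := s)
        (I := fun t s => (∃ L, TraversalState T r s₀ h t L s ∧ L[h]? = some v) ∧
          s.idx 20 0 0 = h ∧ s.idx 21 0 0 = t)
        ⟨⟨L, H.of_agree (fun a ha => Store.setI_idx_of_ne (by omega) _ _ _) rfl, hv⟩,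
          by rw [Store.setI_idx_of_ne (by omega), hs20], by simp [Store.setI_idx_self]⟩
        (fun t s H => H.2.2) ?_ ?_
      · obtain ⟨s', hrun, ⟨L', H', hv'⟩, h20, -⟩ := inner
        refine ⟨s', hrun.mono ?_, h20, ⟨L', ?_⟩, by simp [Store.setI_idx_self]⟩
        · have := T.length_nbrs_le v
          omega
        · exact (H'.next hv' rfl).of_agree (fun a ha => Store.setI_idx_of_ne (by omega) _ _ _) rfl
      · rintro t s ⟨⟨L, H, hv⟩, h20, h21⟩
        simp only [IExp.eval, hvtx s L t H hv h20, H.frame 2 (by omega), hs₀ 2 (by omega),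
          N.encode_degree]
      · rintro t ht s ⟨⟨L, H, hv⟩, h20, h21⟩
        have ev := hvtx s L t H hv h20
        have en : traverseNbr.eval s = T.nbr v t := by
          simp only [traverseNbr, IExp.eval, ev, IExp.var, h21, H.frame 1 (by omega),
            hs₀ 1 (by omega), N.encode_nbr ht]
        have ep : (IExp.get 11 traverseVertex (.lit 0)).eval s = parent T.graph r v := by
          simp only [IExp.eval, ev]
          exact H.par v (List.mem_of_getElem? hv)
        have et : (IExp.var 21).eval s = t := h21
        by_cases hp : T.nbr v t = parent T.graph r v
        · refine ⟨_, (Runs.ite_true ?_ (runs_setI _ _ _ _ _)).mono (by omega), ?_,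
            ⟨L, (H.skip hv ht hp).of_agree (fun a ha => ?_) rfl, hv⟩, ?_, ?_⟩
          · simp only [Test.holds, en, ep, hp]
          · rw [Store.setI_idx_of_ne (by omega), h21]
          · rw [Store.setI_idx_of_ne (by omega), ev, et]
            rfl
          · rw [Store.setI_idx_of_ne (by omega), Store.setI_idx_of_ne (by omega), h20]
          · simp [Store.setI_idx_self]
        · have hvt := (List.getElem?_eq_some_iff.1 hv).1
          refine ⟨((s.setI 11 (T.nbr v t) 0 v).setI 10 L.length 0 (T.nbr v t)).setI 13 0 0
            (L.length + 1), (Runs.ite_false (B := 5) ?_ ?_).mono (by omega), ?_,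
            ⟨L ++ [T.nbr v t], (H.push hv ht hp).of_agree
              (fun a ha => Store.setI_idx_of_ne (by omega) _ _ _) rfl, ?_⟩, ?_, ?_⟩
          · simp only [Test.holds, en, ep]
            exact fun h => hp (Fin.ext h)
          · have r1 := runs_setI 11 traverseNbr (.lit 0) traverseVertex s
            have r2 := runs_setI 10 (.var 13) (.lit 0) traverseNbr (s.setI 11 (T.nbr v t) 0 v)
            have r3 := runs_setI 13 (.lit 0) (.lit 0) (.add (.var 13) (.lit 1))
              ((s.setI 11 (T.nbr v t) 0 v).setI 10 L.length 0 (T.nbr v t))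
            have e2 : traverseNbr.eval (s.setI 11 (T.nbr v t) 0 v) = T.nbr v t := by
              rw [← en]
              simp [traverseNbr, traverseVertex, IExp.var, IExp.eval, Store.setI_idx_of_ne]
            have e3 : (IExp.var 13).eval (s.setI 11 (T.nbr v t) 0 v) = L.length := by
              rw [← H.len]
              simp [IExp.var, IExp.eval, Store.setI_idx_of_ne]
            have e4 : (IExp.add (.var 13) (.lit 1)).eval
                ((s.setI 11 (T.nbr v t) 0 v).setI 10 L.length 0 (T.nbr v t)) = L.length + 1 := by
              rw [← H.len]
              simp [IExp.var, IExp.eval, Store.setI_idx_of_ne]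
            rw [en, ev] at r1
            rw [e2, e3] at r2
            rw [e4] at r3
            exact (r1.seq (r2.seq r3)).mono (by omega)
          · rw [Store.setI_idx_of_ne (by omega), Store.setI_idx_of_ne (by omega),
              Store.setI_idx_of_ne (by omega), h21]
          · rw [List.getElem?_append_left hvt, hv]
          · rw [Store.setI_idx_of_ne (by omega), Store.setI_idx_of_ne (by omega),
              Store.setI_idx_of_ne (by omega), Store.setI_idx_of_ne (by omega), h20]
          · simp [Store.setI_idx_self]
  obtain ⟨s', hrun, ⟨L, H⟩, -⟩ := key
  exact ⟨s', L, (hrun₁ hrun).mono (by omega), H.frame, H.num, H.finish⟩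

end MQC

/-! ### The contraction program. -/

namespace MQC

open scoped ComplexConjugate

variable {n d : ℕ} {T : SubcubicTree n}

/-! ### Contraction of the network -/

/-- The arrays of natural numbers hold the tree and its traversal from the leaf of the
party `l₀ = 0`. -/
structure Loaded (N : TTN T d) (l₀ : Fin n) (ι : Idx) (L : List (Fin T.m)) : Prop where
  zero : (l₀ : ℕ) = 0
  tree : ∀ a < 5, ι a = N.encode.idx a
  trav : Traversal T (T.leaf l₀) ι L

theorem Loaded.of_agree {N : TTN T d} {l₀ : Fin n} {ι ι' : Idx} {L : List (Fin T.m)}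
    (h : Loaded N l₀ ι L) (hι : ∀ a < 20, ι' a = ι a) : Loaded N l₀ ι' L where
  zero := h.zero
  tree a ha := by rw [hι a (by omega), h.tree a ha]
  trav := by
    obtain ⟨h1, h2, h3, h4, h5, h6⟩ := h.trav
    refine ⟨h1, h2, ?_, h4, ?_, ?_⟩
    · rw [hι 10 (by omega)]; exact h3
    · rw [hι 12 (by omega)]; exact h5
    · rw [hι 12 (by omega)]; exact h6

/-- The entry `(a, b)` of the operator that has acted on the party `l`; the array `14` holds the
difference from the identity, which is in the array `15`. -/
def opEntry (l a b : IExp) : CExp := .add (.get 14 l a b (.lit 0)) (.get 15 (.lit 0) a b (.lit 0))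

/-- The numbers hold the tensors of the network and the operators `Ks`. -/
structure Holds (N : TTN T d) (Ks : List (LocalOp n d)) (y : Num) : Prop where
  tensors : y 0 = N.encode.num 0
  ops : ∀ l : Fin n, ∀ a < d, ∀ b < d,
    y 14 l a b 0 + y 15 0 a b 0 = entry (localProduct Ks l) a b

def leafMessages (d : ℕ) : Cmd :=
  .forLoop 30 (.get 0 (.lit 0) (.lit 1))
    (.forLoop 31 (.lit d) (.forLoop 32 (.lit d)
      (.storeSum (.forLoop 33 (.lit d)
        (.addAcc (.mul (opEntry (.var 30) (.var 33) (.var 31))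
          (.conj (opEntry (.var 30) (.var 33) (.var 32))))))
        20 (.get 4 (.var 30) (.lit 0)) (.var 31) (.var 32) (.lit 0))))

/-- Each party writes in the row of its own leaf, so the rows filled before survive. The root leaf
gets its Gram matrix too, to be paired with the incoming message in `rootSum`. -/
theorem triple_leafMessages {N : TTN T d} {Ks : List (LocalOp n d)} {l₀ : Fin n} {ι : Idx}
    {L : List (Fin T.m)} {y₀ : Num} {D : ℕ} (hι : Loaded N l₀ ι L) (hy : Holds N Ks y₀)
    (hD : 0 < D) (hdD : d ≤ D) :
    Triple ι 30 (· = y₀) (leafMessages d)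
      (fun y => (∀ x, x ≠ 20 → x ≠ 23 → y x = y₀ x) ∧
        ∀ l : Fin n, ∀ i < d, ∀ i' < d, y 20 (T.leaf l) i i' 0 = gram (localProduct Ks l) i i')
      (29 * D ^ 3 * n) := by
  have hn : 0 < n := Fin.pos l₀
  have hparties : (IExp.get 0 (.lit 0) (.lit 1)).val ι = n := by
    simp only [IExp.val, hι.tree 0 (by omega), N.encode_parties]
  -- Constants: `1 → 7` for the sum, `7 + 4 = 11` for storing it, `11 → 17 → 23` for the matrix
  -- entries, and `6` for the loop over the parties.
  refine Triple.mono (B := (23 * D ^ 3 + 6) * n) ?_ ?_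
  · refine (Triple.forLoop (I := fun m y => (∀ x, x ≠ 20 → x ≠ 23 → y x = y₀ x) ∧
      ∀ l : Fin n, (l : ℕ) < m → ∀ i < d, ∀ i' < d,
        y 20 (T.leaf l) i i' 0 = gram (localProduct Ks l) i i') (by omega) rfl hparties le_rfl hn
      ?_).conseq ?_ ?_
    · intro m hm
      refine Triple.of_eq fun y hyI => ?_
      have hleafval : ι 4 m 0 = T.leaf ⟨m, hm⟩ := by
        rw [hι.tree 4 (by omega)]
        exact N.encode_leaf ⟨m, hm⟩
      have key := Triple.fillRow (ι := ι.upd 30 m) (k := 31) (N₁ := d) (N₂ := d) (D := D)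
        (B := 11 * D ^ 1) (A := 20) (i₀ := T.leaf ⟨m, hm⟩) (b₁ := .lit d) (b₂ := .lit d) (y₀ := y)
        (c := .storeSum (.forLoop 33 (.lit d)
          (.addAcc (.mul (opEntry (.var 30) (.var 33) (.var 31))
          (.conj (opEntry (.var 30) (.var 33) (.var 32))))))
          20 (.get 4 (.var 30) (.lit 0)) (.var 31) (.var 32) (.lit 0))
        (fun i i' => gram (localProduct Ks ⟨m, hm⟩) i i') (by omega) (by omega) hD rfl rfl hdD rfl
        (fun _ _ => rfl) hdD ?_
      · refine (key.conseq (fun _ h => h) ?_).mono ?_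
        · rintro y' ⟨h1, h2⟩
          refine ⟨fun x hx hx' => ?_, fun l hl i hi i' hi' => ?_⟩
          · rw [← hyI.1 x hx hx']
            funext a b c e
            exact h1 x a b c e hx' (Or.inl hx)
          · rcases Nat.lt_succ_iff_lt_or_eq.1 hl with h3 | h3
            · rw [h1 20 _ _ _ _ (by omega) (Or.inr ?_)]
              · exact hyI.2 l h3 i hi i' hi'
              · intro h4
                have := T.leaf_injective (Fin.ext h4)
                rw [this] at h3
                simp at h3
            · obtain rfl : l = ⟨m, hm⟩ := Fin.ext h3
              exact h2 i hi i' hi'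
        · exact (Nat.mul_le_mul_right _ (Nat.add_le_add_right (mul_pow_add_six_le hD 1) 6)).trans
            (mul_pow_add_six_le hD 2)
      · intro i hi i' hi' y' hy'
        have hacc : Accumulates (((ι.upd 30 m).upd 31 i).upd 32 i') 33 y'
            (.forLoop 33 (.lit d) (.addAcc (.mul (opEntry (.var 30) (.var 33) (.var 31))
              (.conj (opEntry (.var 30) (.var 33) (.var 32))))))
            (gram (localProduct Ks ⟨m, hm⟩) i i') ((1 + 6) * D) := by
          refine Accumulates.forLoop (by omega) rfl rfl hdD hD fun a ha => ?_
          refine Accumulates.addAcc rfl fun z => ?_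
          have e : ∀ b < d, y' 14 m a b 0 + y' 15 0 a b 0 =
              entry (localProduct Ks ⟨m, hm⟩) a b := by
            intro b hb
            rw [hy' 14 _ _ _ _ (by omega) (Or.inl (by omega)),
              hy' 15 _ _ _ _ (by omega) (Or.inl (by omega)), hyI.1 14 (by omega) (by omega),
              hyI.1 15 (by omega) (by omega)]
            exact hy.ops ⟨m, hm⟩ a ha b hb
          have e1 := e i hi
          have e2 := e i' hi'
          rw [← e1, ← e2]
          rfl
        refine ((Triple.storeSum hacc rfl).conseq (fun _ h => h) ?_).mono ?_
        · rintro _ rfl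
          refine ⟨gram (localProduct Ks ⟨m, hm⟩) i i', ?_⟩
          have e : (IExp.get 4 (.var 30) (.lit 0)).val (((ι.upd 30 m).upd 31 i).upd 32 i') =
            T.leaf ⟨m, hm⟩ := hleafval
          rw [e]
          rfl
        · rw [pow_one]
          omega
    · rintro y rfl
      exact ⟨fun _ _ _ => rfl, fun _ h => by omega⟩
    · rintro y ⟨h1, h2⟩
      exact ⟨h1, fun l => h2 l l.2⟩
  · have : 1 ≤ D ^ 3 := Nat.one_le_pow _ _ hD
    exact Nat.mul_le_mul_right n (by omega)

/-! #### Messages of the inner vertices -/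

theorem TTN.encode_tensor (N : TTN T d) (v : T.Inner) (f : T.graph.neighborSet v → ℕ)
    (hf : ∀ w, f w < N.dim s(↑v, ↑w)) {i : Fin 3 → ℕ}
    (hi : ∀ (t : Fin 3) (w : T.graph.neighborSet v), T.nbr v t = w → f w = i t) :
    N.encode.num 0 (v : Fin T.m) (i 0) (i 1) (i 2) = N.tensor v f := by
  classical
  have hlen : (T.nbrs v).length = 3 := by rw [T.length_nbrs, v.2]
  have hval : (fun w : T.graph.neighborSet v =>
      [i 0, i 1, i 2].getD ((T.nbrs v).idxOf (w : Fin T.m)) 0) = f := by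
    funext w
    obtain ⟨t, ht, hw⟩ := T.exists_nbr w.2
    have hidx : (T.nbrs v).idxOf (w : Fin T.m) = t := by
      rw [← hw, T.nbr_eq ht]
      exact (T.nodup_nbrs v).idxOf_getElem t ht
    rw [hidx]
    rw [hlen] at ht
    have h3 := hi ⟨t, ht⟩ w hw
    rw [h3]
    interval_cases t <;> rfl
  have h2 := v.2
  simp only [encode, Fin.is_lt, dif_pos, Fin.eta, h2, true_and]
  have hlt : ∀ w : T.graph.neighborSet v,
      [i 0, i 1, i 2].getD ((T.nbrs v).idxOf (w : Fin T.m)) 0 < N.dim s(↑v, ↑w) := by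
    intro w
    rw [congrFun hval w]
    exact hf w
  rw [if_pos hlt, hval]

/-- The children of `v` in a traversal, from the position of the parent. -/
noncomputable def child₁ (T : SubcubicTree n) (ι : Idx) (v : Fin T.m) : Fin T.m :=
  T.nbr v (1 - ι 12 v 0)

/-- Truncated subtraction gives the two positions other than that of the parent: for parent position
`0`, `1`, `2` the children are at `1, 2`, at `0, 2` and at `0, 1`. -/
noncomputable def child₂ (T : SubcubicTree n) (ι : Idx) (v : Fin T.m) : Fin T.m :=
  T.nbr v (2 - (ι 12 v 0 - 1))

open Classical in
/-- The tensor at `v` with the indices of the parent and the two children. -/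
noncomputable def TTN.childTensor (N : TTN T d) (ι : Idx) (v : T.Inner) (a b c : ℕ) : ℂ :=
  N.tensor v fun w => if (w : Fin T.m) = child₁ T ι v then b else
    if (w : Fin T.m) = child₂ T ι v then c else a

/-- The message from `v` to its parent, from the messages of the children. -/
noncomputable def TTN.innerMessage (N : TTN T d) (ι : Idx) (v : T.Inner) (y : Num) (a a' : ℕ) :
    ℂ :=
  ∑ b ∈ Finset.range (N.dim s(↑v, child₁ T ι v)), ∑ b' ∈ Finset.range (N.dim s(↑v, child₁ T ι v)),
  ∑ c ∈ Finset.range (N.dim s(↑v, child₂ T ι v)), ∑ c' ∈ Finset.range (N.dim s(↑v, child₂ T ι v)),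
    N.childTensor ι v a b c * conj (N.childTensor ι v a' b' c') *
      (y 20 (child₁ T ι v) b b' 0 * y 20 (child₂ T ι v) c c' 0)

section Inner

variable {N : TTN T d} {l₀ : Fin n} {ι : Idx} {L : List (Fin T.m)}

theorem Loaded.pos_lt (hι : Loaded N l₀ ι L) (v : T.Inner) : ι 12 (v : Fin T.m) 0 < 3 := by
  have := hι.trav.pos_lt v (T.inner_ne_leaf v l₀)
  rwa [T.length_nbrs, v.2] at this

theorem Loaded.children (hι : Loaded N l₀ ι L) (v : T.Inner) :
    child₁ T ι v ≠ child₂ T ι v ∧ child₁ T ι v ≠ parent T.graph (T.leaf l₀) v ∧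
      child₂ T ι v ≠ parent T.graph (T.leaf l₀) v ∧ T.graph.Adj v (child₁ T ι v) ∧
      T.graph.Adj v (child₂ T ι v) := by
  have hp := hι.pos_lt v
  have hlen : (T.nbrs v).length = 3 := by rw [T.length_nbrs, v.2]
  rw [← hι.trav.nbr_pos v (T.inner_ne_leaf v l₀)]
  refine ⟨fun h => ?_, fun h => ?_, fun h => ?_, T.adj_nbr (by omega), T.adj_nbr (by omega)⟩
  · have := T.nbr_inj (by omega) (by omega) h
    omega
  · have := T.nbr_inj (by omega) (by omega) h
    omega
  · have := T.nbr_inj (by omega) (by omega) h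
    omega

/-- The memory orders the indices by the numbering of the neighbours, the message equation by parent
and children. The three possible positions of the parent are the three branches of `messageSum`. -/
theorem Loaded.num_tensor (hι : Loaded N l₀ ι L) (v : T.Inner) {a b c : ℕ}
    (ha : a < N.dim s(↑v, parent T.graph (T.leaf l₀) v)) (hb : b < N.dim s(↑v, child₁ T ι v))
    (hc : c < N.dim s(↑v, child₂ T ι v)) :
    N.childTensor ι v a b c = if ι 12 (v : Fin T.m) 0 = 0 then N.encode.num 0 (v : Fin T.m) a b c
      else if ι 12 (v : Fin T.m) 0 = 1 then N.encode.num 0 (v : Fin T.m) b a c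
      else N.encode.num 0 (v : Fin T.m) b c a := by
  classical
  obtain ⟨h12, h1, h2, ha1, ha2⟩ := hι.children v
  have hpar := parent_adj T.isTree (T.inner_ne_leaf v l₀)
  have hpos := hι.pos_lt v
  have hnp := hι.trav.nbr_pos v (T.inner_ne_leaf v l₀)
  have hn1 : T.nbr v (1 - ι 12 (v : Fin T.m) 0) = child₁ T ι v := rfl
  have hn2 : T.nbr v (2 - (ι 12 (v : Fin T.m) 0 - 1)) = child₂ T ι v := rfl
  have hf : ∀ w : T.graph.neighborSet v, (if (w : Fin T.m) = child₁ T ι v then b else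
      if (w : Fin T.m) = child₂ T ι v then c else a) < N.dim s(↑v, ↑w) := by
    intro w
    rcases T.eq_of_adj_inner hpar ha1 ha2 h1.symm h2.symm h12 w.2 with e | e | e
    · rw [e, if_neg h1.symm, if_neg h2.symm]
      exact ha
    · rw [e, if_pos rfl]
      exact hb
    · rw [e, if_neg h12.symm, if_pos rfl]
      exact hc
  obtain ⟨p, hp⟩ : ∃ p, p = ι 12 (v : Fin T.m) 0 := ⟨_, rfl⟩
  rw [← hp] at hpos hnp hn1 hn2 ⊢
  interval_cases p
  · rw [if_pos rfl]
    refine (N.encode_tensor v _ hf (i := ![a, b, c]) ?_).symm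
    intro t w hw
    rw [← hw]
    fin_cases t
    · simp only [hnp, if_neg h1.symm, if_neg h2.symm]; rfl
    · simp only [hn1]; rfl
    · simp only [hn2, if_neg h12.symm]; rfl
  · rw [if_neg (by omega), if_pos rfl]
    refine (N.encode_tensor v _ hf (i := ![b, a, c]) ?_).symm
    intro t w hw
    rw [← hw]
    fin_cases t
    · simp only [hn1]; rfl
    · simp only [hnp, if_neg h1.symm, if_neg h2.symm]; rfl
    · simp only [hn2, if_neg h12.symm]; rfl
  · rw [if_neg (by omega), if_neg (by omega)]
    refine (N.encode_tensor v _ hf (i := ![b, c, a]) ?_).symm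
    intro t w hw
    rw [← hw]
    fin_cases t
    · simp only [hn1]; rfl
    · simp only [hn2, if_neg h12.symm]; rfl
    · simp only [hnp, if_neg h1.symm, if_neg h2.symm]; rfl

end Inner

end MQC

namespace MQC

open scoped ComplexConjugate

variable {n d : ℕ} {T : SubcubicTree n}

/-- The product of the tensor at the vertex `31` with indices `i`, `j`, `k`, the conjugate tensor
with indices `i'`, `j'`, `k'`, and the messages of the children. -/
def messageTerm (i j k i' j' k' : ℕ) : CExp :=
  .mul (.mul (.get 0 (.var 31) (.var i) (.var j) (.var k))
      (.conj (.get 0 (.var 31) (.var i') (.var j') (.var k'))))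
    (.mul (.get 20 (.get 1 (.var 31) (.var 33)) (.var 37) (.var 38) (.lit 0))
      (.get 20 (.get 1 (.var 31) (.var 34)) (.var 39) (.var 40) (.lit 0)))

def messageSum : Cmd :=
  .forLoop 37 (.get 3 (.var 31) (.var 33)) (.forLoop 38 (.get 3 (.var 31) (.var 33))
    (.forLoop 39 (.get 3 (.var 31) (.var 34)) (.forLoop 40 (.get 3 (.var 31) (.var 34))
      (.ite (.eq (.var 32) (.lit 0)) (.addAcc (messageTerm 35 37 39 36 38 40))
        (.ite (.eq (.var 32) (.lit 1)) (.addAcc (messageTerm 37 35 39 38 36 40))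
          (.addAcc (messageTerm 37 39 35 38 40 36)))))))

/-- The traversal list is read backwards, so that children precede their parents. At a leaf the
message is already present, and clearing the accumulator serves as an idle command. -/
def innerMessages : Cmd :=
  .forLoop 30 (.var 0)
    (.letVar 31 (.get 10 (.sub (.sub (.var 0) (.lit 1)) (.var 30)) (.lit 0))
      (.ite (.eq (.get 2 (.var 31) (.lit 0)) (.lit 3))
        (.letVar 32 (.get 12 (.var 31) (.lit 0))
        (.letVar 33 (.sub (.lit 1) (.var 32))
        (.letVar 34 (.sub (.lit 2) (.sub (.var 32) (.lit 1)))
          (.forLoop 35 (.get 3 (.var 31) (.var 32)) (.forLoop 36 (.get 3 (.var 31) (.var 32))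
            (.storeSum messageSum 20 (.var 31) (.var 35) (.var 36) (.lit 0)))))))
        (.setC 23 (.lit 0) (.lit 0) (.lit 0) (.lit 0) .zero)))

section

variable {N : TTN T d} {l₀ : Fin n} {ι : Idx} {L : List (Fin T.m)} {D : ℕ}

theorem Loaded.length (hι : Loaded N l₀ ι L) : L.length = T.m := by
  classical
  have h1 : L.toFinset = Finset.univ := Finset.eq_univ_iff_forall.2 fun w =>
    List.mem_toFinset.2 (hι.trav.mem w)
  rw [← List.toFinset_card_of_nodup hι.trav.nodup, h1, Finset.card_univ, Fintype.card_fin]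

/-- A child is listed after its parent. -/
theorem Loaded.lt_of_child (hι : Loaded N l₀ ι L) {v c : Fin T.m} {i j : ℕ}
    (hv : L[i]? = some v) (hc : L[j]? = some c) (hadj : T.graph.Adj v c)
    (hne : c ≠ parent T.graph (T.leaf l₀) v) : i < j := by
  obtain ⟨h1, h2⟩ := parent_eq_of_adj_of_ne T.isTree hadj fun _ => hne
  have h3 := hι.trav.order j c hc h1
  rw [h2] at h3
  obtain ⟨k, hk, hkv⟩ := List.getElem_of_mem h3
  rw [List.length_take] at hk
  rw [List.getElem_take] at hkv
  obtain ⟨hi, hiv⟩ := List.getElem?_eq_some_iff.1 hv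
  have := (hι.trav.nodup.getElem_inj_iff (hi := by omega) (hj := hi)).1 (hkv.trans hiv.symm)
  omega

/-- Six nested loops, two for the entry of the message and four for the pairs of indices of the
children, give the exponent `6`. The children differ from `v`, so filling the row of `v` does not
disturb their messages. -/
theorem triple_message (hι : Loaded N l₀ ι L) (v : T.Inner) (hD : 0 < D)
    (hdim : ∀ w, T.graph.Adj v w → N.dim s(↑v, w) ≤ D) {h : ℕ} {y : Num}
    (htens : y 0 = N.encode.num 0) :
    Triple ((ι.upd 30 h).upd 31 (v : Fin T.m)) 32 (· = y)
      (.letVar 32 (.get 12 (.var 31) (.lit 0))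
        (.letVar 33 (.sub (.lit 1) (.var 32))
        (.letVar 34 (.sub (.lit 2) (.sub (.var 32) (.lit 1)))
          (.forLoop 35 (.get 3 (.var 31) (.var 32)) (.forLoop 36 (.get 3 (.var 31) (.var 32))
            (.storeSum messageSum 20 (.var 31) (.var 35) (.var 36) (.lit 0)))))))
      (fun y' => SameOff 20 (v : Fin T.m) y y' ∧
        ∀ a < N.dim s(↑v, parent T.graph (T.leaf l₀) v),
        ∀ a' < N.dim s(↑v, parent T.graph (T.leaf l₀) v),
          y' 20 (v : Fin T.m) a a' 0 = N.innerMessage ι v y a a')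
      (49 * D ^ 6) := by
  obtain ⟨h12, h1, h2, ha1, ha2⟩ := hι.children v
  have hvr := T.inner_ne_leaf v l₀
  have hpar := parent_adj T.isTree hvr
  have hlen : (T.nbrs v).length = 3 := by rw [T.length_nbrs, v.2]
  have hp3 := hι.pos_lt v
  have hdimp : ι 3 (v : Fin T.m) (ι 12 (v : Fin T.m) 0) =
      N.dim s(↑v, parent T.graph (T.leaf l₀) v) := by
    rw [hι.tree 3 (by omega), N.encode_dim (by omega), hι.trav.nbr_pos v hvr]
  have hdim1 : ι 3 (v : Fin T.m) (1 - ι 12 (v : Fin T.m) 0) = N.dim s(↑v, child₁ T ι v) := by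
    rw [hι.tree 3 (by omega), N.encode_dim (by omega)]
    rfl
  have hdim2 : ι 3 (v : Fin T.m) (2 - (ι 12 (v : Fin T.m) 0 - 1)) =
      N.dim s(↑v, child₂ T ι v) := by
    rw [hι.tree 3 (by omega), N.encode_dim (by omega)]
    rfl
  have hch1 : ι 1 (v : Fin T.m) (1 - ι 12 (v : Fin T.m) 0) = child₁ T ι v := by
    rw [hι.tree 1 (by omega), N.encode_nbr (by omega)]
    rfl
  have hch2 : ι 1 (v : Fin T.m) (2 - (ι 12 (v : Fin T.m) 0 - 1)) = child₂ T ι v := by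
    rw [hι.tree 1 (by omega), N.encode_nbr (by omega)]
    rfl
  obtain ⟨p, hp⟩ : ∃ p, p = ι 12 (v : Fin T.m) 0 := ⟨_, rfl⟩
  obtain ⟨ι', hι'⟩ : ∃ ι', ι' = ((((ι.upd 30 h).upd 31 (v : Fin T.m)).upd 32 p).upd 33
    (1 - p)).upd 34 (2 - (p - 1)) := ⟨_, rfl⟩
  -- Constants: a term costs `3`, four sums make it `27`, storing `31`, the two loops over the
  -- entries `43`, and three variables at `2` each `49`.
  have hb := fun b j => @mul_pow_add_six_le b D hD j
  refine Triple.mono (B := 43 * D ^ 6 + 2 + 2 + 2) ?_ (by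
    have : 1 ≤ D ^ 6 := Nat.one_le_pow _ _ hD
    omega)
  refine Triple.letVar (by omega) rfl (Triple.letVar (by omega) rfl
    (Triple.letVar (by omega) rfl ?_))
  have key := Triple.fillRow (ι := ι') (k := 35)
    (N₁ := N.dim s(↑v, parent T.graph (T.leaf l₀) v))
    (N₂ := N.dim s(↑v, parent T.graph (T.leaf l₀) v)) (D := D)
    (B := 31 * D ^ 4) (A := 20) (i₀ := (v : Fin T.m)) (b₁ := .get 3 (.var 31) (.var 32))
    (b₂ := .get 3 (.var 31) (.var 32)) (y₀ := y)
    (c := .storeSum messageSum 20 (.var 31) (.var 35) (.var 36) (.lit 0))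
    (fun a a' => N.innerMessage ι v y a a') (by omega) (by omega) hD rfl
    (by subst hι' hp; exact hdimp) (hdim _ hpar) rfl
    (fun _ _ => by subst hι' hp; exact hdimp) (hdim _ hpar) ?_
  · subst hι' hp
    exact key.mono ((Nat.mul_le_mul_right _ (Nat.add_le_add_right (hb 31 4) 6)).trans (hb 37 5))
  · intro a ha a' ha' y' hy'
    have hacc : Accumulates ((ι'.upd 35 a).upd 36 a') 37 y' messageSum
        (N.innerMessage ι v y a a') (27 * D ^ 4) := by
      refine Accumulates.mono (B := ((((3 + 6) * D + 6) * D + 6) * D + 6) * D) ?_ (by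
        have e1 := hb 9 1
        have e2 := hb 15 2
        have e3 := hb 21 3
        rw [pow_one] at e1
        calc ((((3 + 6) * D + 6) * D + 6) * D + 6) * D
            ≤ (((9 + 6) * D ^ 2 + 6) * D + 6) * D := by gcongr
          _ ≤ ((15 + 6) * D ^ 3 + 6) * D := by gcongr
          _ ≤ 27 * D ^ 4 := e3)
      refine Accumulates.forLoop (by omega) rfl (by subst hι' hp; exact hdim1) (hdim _ ha1) hD
        fun b hb => ?_
      refine Accumulates.forLoop (by omega) rfl (by subst hι' hp; exact hdim1) (hdim _ ha1) hD
        fun b' hb' => ?_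
      refine Accumulates.forLoop (by omega) rfl (by subst hι' hp; exact hdim2) (hdim _ ha2) hD
        fun c hc => ?_
      refine Accumulates.forLoop (by omega) rfl (by subst hι' hp; exact hdim2) (hdim _ ha2) hD
        fun c' hc' => ?_
      have t1 := hι.num_tensor v ha hb hc
      have t2 := hι.num_tensor v ha' hb' hc'
      have m1 : y' 20 (ι 1 (v : Fin T.m) (1 - ι 12 (v : Fin T.m) 0)) b b' 0 =
          y 20 (child₁ T ι v) b b' 0 := by
        rw [hch1, hy' 20 _ _ _ _ (by omega) (Or.inr fun h => ha1.ne (Fin.ext h).symm)]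
      have m2 : y' 20 (ι 1 (v : Fin T.m) (2 - (ι 12 (v : Fin T.m) 0 - 1))) c c' 0 =
          y 20 (child₂ T ι v) c c' 0 := by
        rw [hch2, hy' 20 _ _ _ _ (by omega) (Or.inr fun h => ha2.ne (Fin.ext h).symm)]
      have m0 : ∀ i j k, N.encode.num 0 (v : Fin T.m) i j k = y' 0 (v : Fin T.m) i j k := by
        intro i j k
        rw [hy' 0 _ _ _ _ (by omega) (Or.inl (by omega)), htens]
      rw [t1, t2, ← m1, ← m2]
      simp only [m0]
      subst hι'
      intro z
      refine Triple.ite_eq rfl (fun hq => ?_) (fun hq => ?_)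
      · have hq : p = 0 := hq
        refine (Accumulates.addAcc (y := y') rfl (fun z => ?_) z).mono (by omega : 1 ≤ 2)
        rw [← hp, if_pos hq, if_pos hq]
        rfl
      · have hq : p ≠ 0 := hq
        refine Triple.ite_eq rfl (fun hq' => ?_) (fun hq' => ?_)
        · have hq' : p = 1 := hq'
          refine Accumulates.addAcc (y := y') rfl (fun z => ?_) z
          rw [← hp, if_neg hq, if_neg hq, if_pos hq', if_pos hq']
          rfl
        · have hq' : p ≠ 1 := hq'
          refine Accumulates.addAcc (y := y') rfl (fun z => ?_) z
          rw [← hp, if_neg hq, if_neg hq, if_neg hq', if_neg hq']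
          rfl
    refine ((Triple.storeSum hacc rfl).conseq (fun _ h => h) ?_).mono ?_
    · rintro _ rfl
      refine ⟨N.innerMessage ι v y a a', ?_⟩
      subst hι'
      rfl
    · have : 1 ≤ D ^ 4 := Nat.one_le_pow _ _ hD
      omega

/-- The message of the inner vertex `v` is the one obtained from the messages of its children. -/
def MessageAt (N : TTN T d) (l₀ : Fin n) (ι : Idx) (v : T.Inner) (y : Num) : Prop :=
  ∀ a < N.dim s(↑v, parent T.graph (T.leaf l₀) v),
  ∀ a' < N.dim s(↑v, parent T.graph (T.leaf l₀) v),
    y 20 (v : Fin T.m) a a' 0 = N.innerMessage ι v y a a'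

theorem innerMessage_congr {v : T.Inner} {y y' : Num}
    (h1 : ∀ b b', y' 20 (child₁ T ι v) b b' 0 = y 20 (child₁ T ι v) b b' 0)
    (h2 : ∀ b b', y' 20 (child₂ T ι v) b b' 0 = y 20 (child₂ T ι v) b b' 0) (a a' : ℕ) :
    N.innerMessage ι v y' a a' = N.innerMessage ι v y a a' := by
  simp only [TTN.innerMessage, h1, h2]

/-- The equations of the last `h` listed vertices survive the next write: the row written belongs to
an earlier vertex, which is neither one of them nor a child of one. -/
theorem triple_innerMessages {Ks : List (LocalOp n d)} {y₀ : Num} (hι : Loaded N l₀ ι L)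
    (hD : 0 < D) (hdim : ∀ (v : T.Inner) w, T.graph.Adj v w → N.dim s(↑v, w) ≤ D)
    (htens : y₀ 0 = N.encode.num 0) :
    Triple ι 30 (fun y => (∀ x, x ≠ 20 → x ≠ 23 → y x = y₀ x) ∧
        ∀ l : Fin n, ∀ i < d, ∀ i' < d, y 20 (T.leaf l) i i' 0 = gram (localProduct Ks l) i i')
      innerMessages
      (fun y => (∀ x, x ≠ 20 → x ≠ 23 → y x = y₀ x) ∧
        (∀ l : Fin n, ∀ i < d, ∀ i' < d,
          y 20 (T.leaf l) i i' 0 = gram (localProduct Ks l) i i') ∧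
        ∀ v : T.Inner, MessageAt N l₀ ι v y)
      (58 * D ^ 6 * T.m) := by
  have hm : 0 < T.m := Fin.pos (T.leaf l₀).1
  have hvert : (IExp.var 0).val ι = T.m := by
    simp only [IExp.var, IExp.val, hι.tree 0 (by omega), N.encode_vertices]
  have hlen := hι.length
  have hpow : 1 ≤ D ^ 6 := Nat.one_le_pow _ _ hD
  refine Triple.mono (B := (52 * D ^ 6 + 6) * T.m) ?_ (Nat.mul_le_mul_right _ (by omega))
  refine (Triple.forLoop (I := fun h y => (∀ x, x ≠ 20 → x ≠ 23 → y x = y₀ x) ∧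
    (∀ l : Fin n, ∀ i < d, ∀ i' < d,
          y 20 (T.leaf l) i i' 0 = gram (localProduct Ks l) i i') ∧
    ∀ h' < h, ∀ v : T.Inner, L[T.m - 1 - h']? = some v.1 → MessageAt N l₀ ι v y)
    (by omega) rfl hvert le_rfl hm ?_).conseq ?_ ?_
  · intro h hh
    obtain ⟨v, hv⟩ : ∃ v, L[T.m - 1 - h]? = some v :=
      ⟨L[T.m - 1 - h], List.getElem?_eq_getElem (by omega)⟩
    have hv10 : ι 10 (ι 0 0 0 - 1 - h) 0 = v := by
      rw [show ι 0 0 0 = T.m from hvert]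
      exact hι.trav.list _ _ hv
    have hdeg : ι 2 v 0 = (T.graph.neighborSet v).ncard := by
      rw [hι.tree 2 (by omega), N.encode_degree, T.length_nbrs]
    refine (Triple.letVar (B := 50 * D ^ 6) (by omega) rfl ?_).mono (by omega)
    rw [show (IExp.get 10 (.sub (.sub (.var 0) (.lit 1)) (.var 30)) (.lit 0)).val (ι.upd 30 h) = v
      from hv10]
    refine (Triple.ite_eq (B := 49 * D ^ 6) rfl (fun hq => ?_) (fun hq => ?_)).mono (by omega)
    · have hq : ι 2 v 0 = 3 := hq
      rw [hdeg] at hq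
      refine Triple.of_eq fun y hy => ?_
      have htens' : y 0 = N.encode.num 0 := by rw [hy.1 0 (by omega) (by omega), htens]
      refine (triple_message hι ⟨v, hq⟩ hD (hdim _) htens').conseq (fun _ h => h) ?_
      rintro y' ⟨h1, h2⟩
      simp only at h1 h2
      have hrow : ∀ w : Fin T.m, w ≠ v → ∀ b b', y' 20 w b b' 0 = y 20 w b b' 0 :=
        fun w hw b b' => h1 20 _ _ _ _ (by omega) (Or.inr fun h => hw (Fin.ext h))
      refine ⟨fun x hx hx' => ?_, fun l i hi i' hi' => ?_, fun h' hh' u hu => ?_⟩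
      · rw [← hy.1 x hx hx']
        funext a b c e
        exact h1 x a b c e hx' (Or.inl hx)
      · rw [hrow _ (T.inner_ne_leaf ⟨v, hq⟩ l).symm]
        exact hy.2.1 l i hi i' hi'
      · obtain ⟨h12, hc1, hc2, ha1, ha2⟩ := hι.children u
        -- `u` stands at or behind the position of `v`, and its children stand strictly behind `u`.
        have hcv : ∀ c, T.graph.Adj u c → c ≠ parent T.graph (T.leaf l₀) u → c ≠ v := by
          rintro c hadj hne rfl
          have := hι.lt_of_child hu hv hadj hne
          omega
        have hcongr := innerMessage_congr (N := N) (ι := ι) (v := u) (y := y) (y' := y')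
          (hrow _ (hcv _ ha1 hc1)) (hrow _ (hcv _ ha2 hc2))
        intro a ha a' ha'
        rw [hcongr]
        by_cases huv : u.1 = v
        · obtain rfl : u = ⟨v, hq⟩ := Subtype.ext huv
          exact h2 a ha a' ha'
        · rw [hrow _ huv]
          refine hy.2.2 h' ?_ u hu a ha a' ha'
          rcases Nat.lt_succ_iff_lt_or_eq.1 hh' with h3 | rfl
          · exact h3
          · rw [hv] at hu
            exact (huv (Option.some.inj hu).symm).elim
    · have hq' : ι 2 v 0 ≠ 3 := hq
      rw [hdeg] at hq'
      refine Triple.mono (B := 1) (Triple.setC rfl ?_) (by omega)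
      intro y hy
      have hset : ∀ x, x ≠ 23 → (y.set 23 0 0 0 0 0) x = y x := by
        intro x hx
        funext i j k l
        simp [Num.set, hx]
      change _ ∧ _ ∧ _
      refine ⟨fun x hx hx' => ?_, fun l i hi i' hi' => ?_, fun h' hh' u hu => ?_⟩
      · exact (hset x hx').trans (hy.1 x hx hx')
      · rw [← hy.2.1 l i hi i' hi']
        exact congrFun (congrFun (congrFun (congrFun (hset 20 (by omega)) _) _) _) _
      · rcases Nat.lt_succ_iff_lt_or_eq.1 hh' with h3 | rfl
        · have := hy.2.2 h' h3 u hu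
          unfold MessageAt TTN.innerMessage at this ⊢
          have e : (y.set 23 ((IExp.lit 0).val ((ι.upd 30 h).upd 31 ↑v))
            ((IExp.lit 0).val ((ι.upd 30 h).upd 31 ↑v)) ((IExp.lit 0).val ((ι.upd 30 h).upd 31 ↑v))
            ((IExp.lit 0).val ((ι.upd 30 h).upd 31 ↑v))
            (CExp.zero.val ((ι.upd 30 h).upd 31 ↑v) y)) 20 = y 20 := hset 20 (by omega)
          rw [e]
          exact this
        · rw [hv] at hu
          have := u.2
          rw [← Option.some.inj hu] at this
          exact (hq' this).elim
  · rintro y ⟨h1, h2⟩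
    exact ⟨h1, h2, fun _ h => by omega⟩
  · rintro y ⟨h1, h2, h3⟩
    refine ⟨h1, h2, fun v => ?_⟩
    obtain ⟨j, hj, hjv⟩ := List.getElem_of_mem (hι.trav.mem v)
    refine h3 (T.m - 1 - j) (by omega) v ?_
    rw [show T.m - 1 - (T.m - 1 - j) = j by omega, List.getElem?_eq_getElem hj, hjv]

/-- The root is a leaf; its Gram matrix is paired with the message of its only neighbour across the
edge between them. -/
def rootSum (d : ℕ) : Cmd :=
  .storeSum (.forLoop 30 (.lit d) (.forLoop 31 (.lit d)
    (.addAcc (.mul (.get 20 (.var 4) (.var 30) (.var 31) (.lit 0))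
      (.get 20 (.get 1 (.var 4) (.lit 0)) (.var 30) (.var 31) (.lit 0))))))
    22 (.lit 0) (.lit 0) (.lit 0) (.lit 0)

/-- Computes the squared norm of the current state. -/
def contractCmd (d : ℕ) : Cmd := .seq (leafMessages d) (.seq innerMessages (rootSum d))

theorem triple_contractCmd {Ks : List (LocalOp n d)} {y₀ : Num} (hι : Loaded N l₀ ι L)
    (hy₀ : Holds N Ks y₀) (hD : 0 < D) (hdD : d ≤ D)
    (hdim : ∀ (v : T.Inner) w, T.graph.Adj v w → N.dim s(↑v, w) ≤ D) :
    Triple ι 30 (· = y₀) (contractCmd d)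
      (fun y => (∀ x, x ≠ 20 → x ≠ 22 → x ≠ 23 → y x = y₀ x) ∧
        y 22 0 0 0 0 = ((applyOps Ks N.contract).normSq : ℂ))
      (164 * n * D ^ 6) := by
  classical
  have hn : 0 < n := Fin.pos l₀
  have hroot : ι 4 0 0 = T.leaf l₀ := by
    have := N.encode_leaf l₀
    rwa [hι.zero, ← hι.tree 4 (by omega)] at this
  have hchild : ι 1 (T.leaf l₀ : Fin T.m) 0 = T.nbr (T.leaf l₀) 0 := by
    rw [hι.tree 1 (by omega), N.encode_nbr]
    rw [T.length_nbrs, T.ncard_leaf]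
    omega
  refine Triple.mono (B := 29 * D ^ 3 * n + (58 * D ^ 6 * T.m + 17 * D ^ 2 + 1) + 1)
    ((triple_leafMessages hι hy₀ hD hdD).seq ((triple_innerMessages (Ks := Ks) hι hD hdim
      hy₀.tensors).seq ?_)) ?_
  · refine Triple.of_eq fun y hy => ?_
    have hsum : ((applyOps Ks N.contract).normSq : ℂ) =
        ∑ i ∈ Finset.range d, ∑ i' ∈ Finset.range d,
          y 20 (T.leaf l₀ : Fin T.m) i i' 0 * y 20 (T.nbr (T.leaf l₀) 0) i i' 0 := by
      rw [N.normSq_eq_message Ks l₀ (fun v i i' => y 20 v i i' 0)]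
      · refine Finset.sum_congr rfl fun i hi => Finset.sum_congr rfl fun i' hi' => ?_
        rw [hy.2.1 l₀ i (Finset.mem_range.1 hi) i' (Finset.mem_range.1 hi')]
      · intro l _ i hi i' hi'
        exact hy.2.1 l i hi i' hi'
      · intro v
        obtain ⟨h12, hc1, hc2, ha1, ha2⟩ := hι.children v
        exact ⟨child₁ T ι v, child₂ T ι v, h12, hc1, hc2, ha1, ha2, hy.2.2 v⟩
    have hacc : Accumulates ι 30 y (.forLoop 30 (.lit d) (.forLoop 31 (.lit d)
        (.addAcc (.mul (.get 20 (.var 4) (.var 30) (.var 31) (.lit 0))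
          (.get 20 (.get 1 (.var 4) (.lit 0)) (.var 30) (.var 31) (.lit 0))))))
        ((applyOps Ks N.contract).normSq : ℂ) (((1 + 6) * D + 6) * D) := by
      rw [hsum]
      refine Accumulates.forLoop (by omega) rfl rfl hdD hD fun i hi => ?_
      refine Accumulates.forLoop (by omega) rfl rfl hdD hD fun i' hi' => ?_
      refine Accumulates.addAcc rfl fun z => ?_
      rw [← hchild, ← hroot]
      rfl
    refine ((Triple.storeSum hacc rfl).conseq (fun _ h => h) ?_).mono ?_
    · rintro _ rfl
      refine ⟨fun x h20 h22 h23 => ?_, ?_⟩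
      · rw [← hy.1 x h20 h23]
        funext i j k l
        simp [Num.set, Num.acc, h22, h23]
      · simp [Num.set, IExp.val]
    · have : ((1 + 6) * D + 6) * D ≤ 13 * D ^ 2 := by
        simpa using mul_pow_add_six_le (b := 7) hD 1
      have h2 : 1 ≤ D ^ 2 := Nat.one_le_pow _ _ hD
      omega
  -- `29 + 58 · 2 + 17 + 2 = 164`, as there are at most `2 n` vertices.
  · have hm := T.card_vertices
    have h3 : D ^ 3 ≤ D ^ 6 := Nat.pow_le_pow_right hD (by omega)
    have h2 : D ^ 2 ≤ D ^ 6 := Nat.pow_le_pow_right hD (by omega)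
    have h1 : 1 ≤ D ^ 6 := Nat.one_le_pow _ _ hD
    have h4 : D ^ 6 ≤ n * D ^ 6 := Nat.le_mul_of_pos_left _ hn
    have h5 : D ^ 3 * n ≤ n * D ^ 6 := by
      rw [mul_comm]
      exact Nat.mul_le_mul_left n h3
    have h6 : D ^ 6 * T.m ≤ 2 * (n * D ^ 6) := by
      calc D ^ 6 * T.m ≤ D ^ 6 * (2 * n) := Nat.mul_le_mul_left _ (by omega)
        _ = 2 * (n * D ^ 6) := by ring
    rw [mul_assoc 29, mul_assoc 58, mul_assoc 164]
    omega

end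

end MQC

/-! ### Keeping track of the local operators, and the evaluator. -/

namespace MQC

open scoped ComplexConjugate

variable {n d : ℕ} {T : SubcubicTree n}

/-! ### Local operators -/

/-- Fills the array `15` with the identity matrix. -/
def identityCmd (d : ℕ) : Cmd :=
  .forLoop 30 (.lit d) (.forLoop 31 (.lit d)
    (.ite (.eq (.var 30) (.var 31))
      (.setC 15 (.lit 0) (.var 30) (.var 31) (.lit 0) .one)
      (.setC 15 (.lit 0) (.var 30) (.var 31) (.lit 0) .zero)))

def HasId (d : ℕ) (y : Num) : Prop :=
  ∀ a < d, ∀ b < d, y 15 0 a b 0 = if a = b then 1 else 0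

theorem triple_identityCmd {ι : Idx} {y₀ : Num} {D : ℕ} (hD : 0 < D) (hdD : d ≤ D) :
    Triple ι 30 (· = y₀) (identityCmd d)
      (fun y => HasId d y ∧ ∀ x, x ≠ 15 → x ≠ 23 → y x = y₀ x) (14 * D ^ 2) := by
  have key := Triple.fillRow (ι := ι) (k := 30) (N₁ := d) (N₂ := d) (D := D) (B := 2) (A := 15)
    (i₀ := 0) (b₁ := .lit d) (b₂ := .lit d) (y₀ := y₀)
    (c := .ite (.eq (.var 30) (.var 31))
      (.setC 15 (.lit 0) (.var 30) (.var 31) (.lit 0) .one)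
      (.setC 15 (.lit 0) (.var 30) (.var 31) (.lit 0) .zero))
    (fun a b => if a = b then 1 else 0) (by omega) (by omega) hD rfl rfl hdD rfl
    (fun _ _ => rfl) hdD ?_
  · refine (key.conseq (fun _ h => h) ?_).mono ?_
    · rintro y ⟨h1, h2⟩
      refine ⟨h2, fun x hx hx' => ?_⟩
      funext i j k l
      exact h1 x i j k l hx' (Or.inl hx)
    · simpa using mul_pow_add_six_le (b := 8) hD 1
  · intro a ha b hb y _
    refine Triple.ite_eq rfl (fun hq => ?_) (fun hq => ?_)
    · have hq : a = b := hq
      refine Triple.setC rfl ?_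
      rintro y rfl
      refine ⟨y 23 0 0 0 0, ?_⟩
      rw [Num.acc_self, if_pos hq]
      rfl
    · have hq : a ≠ b := hq
      refine Triple.setC rfl ?_
      rintro y rfl
      refine ⟨y 23 0 0 0 0, ?_⟩
      rw [Num.acc_self, if_neg hq]
      rfl

/-- The array `14` holds the operators `Ks` of the party `l`, up to the identity. -/
def OpsAt (Ks : List (LocalOp n d)) (l : Fin n) (y : Num) : Prop :=
  ∀ a < d, ∀ b < d, y 14 l a b 0 = entry (localProduct Ks l) a b - if a = b then 1 else 0

theorem holds_of_opsAt {N : TTN T d} {Ks : List (LocalOp n d)} {y : Num}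
    (htens : y 0 = N.encode.num 0) (hid : HasId d y) (hops : ∀ l, OpsAt Ks l y) :
    Holds N Ks y := by
  refine ⟨htens, fun l a ha b hb => ?_⟩
  rw [hops l a ha b hb, hid a ha b hb]
  ring

theorem entry_mul (A B : Matrix (Fin d) (Fin d) ℂ) {a b : ℕ} (ha : a < d) (hb : b < d) :
    entry (A * B) a b = ∑ c ∈ Finset.range d, entry A a c * entry B c b := by
  have h1 := entry_fin (A * B) ⟨a, ha⟩ ⟨b, hb⟩
  simp only at h1
  rw [h1, Matrix.mul_apply, Finset.sum_range]
  refine Finset.sum_congr rfl fun c _ => ?_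
  rw [← entry_fin A, ← entry_fin B]

/-- Applies the operator number `20` to the party `21`. -/
def applyCmd (d : ℕ) : Cmd :=
  .seq
    (.forLoop 30 (.lit d) (.forLoop 31 (.lit d)
      (.storeSum (.forLoop 32 (.lit d)
        (.addAcc (.mul (.get 1 (.var 20) (.var 30) (.var 32) (.lit 0))
          (opEntry (.var 21) (.var 32) (.var 31)))))
        21 (.lit 0) (.var 30) (.var 31) (.lit 0))))
    (.forLoop 30 (.lit d) (.forLoop 31 (.lit d)
      (.setC 14 (.var 21) (.var 30) (.var 31) (.lit 0)
        (.add (.get 21 (.lit 0) (.var 30) (.var 31) (.lit 0))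
          (.neg (.get 15 (.lit 0) (.var 30) (.var 31) (.lit 0)))))))

/-- The product is formed in the scratch array `21`, because its entries need all old entries of the
operator; only then is the array `14` overwritten. The rows of other parties are untouched, whatever
operators they encode. -/
theorem triple_applyCmd {ι : Idx} {y₀ : Num} {D : ℕ} {Ks : List (LocalOp n d)} {K : LocalOp n d}
    (hD : 0 < D) (hdD : d ≤ D) (hid : HasId d y₀) (hops : OpsAt Ks K.party y₀)
    (hl : ι 21 0 0 = K.party)
    (hK : ∀ a < d, ∀ b < d, y₀ 1 (ι 20 0 0) a b 0 = entry K.op a b) :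
    Triple ι 30 (· = y₀) (applyCmd d)
      (fun y => OpsAt (K :: Ks) K.party y ∧
        (∀ l, l ≠ K.party → ∀ Ks' : List (LocalOp n d), OpsAt Ks' l y₀ → OpsAt Ks' l y) ∧
        ∀ x, x ≠ 14 → x ≠ 21 → x ≠ 23 → y x = y₀ x) (37 * D ^ 3) := by
  have hb := fun b j => @mul_pow_add_six_le b D hD j
  have first := Triple.fillRow (ι := ι) (k := 30) (N₁ := d) (N₂ := d) (D := D) (B := 11 * D ^ 1)
    (A := 21) (i₀ := 0) (b₁ := .lit d) (b₂ := .lit d) (y₀ := y₀)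
    (c := .storeSum (.forLoop 32 (.lit d)
        (.addAcc (.mul (.get 1 (.var 20) (.var 30) (.var 32) (.lit 0))
          (opEntry (.var 21) (.var 32) (.var 31)))))
        21 (.lit 0) (.var 30) (.var 31) (.lit 0))
    (fun a b => entry (localProduct (K :: Ks) K.party) a b) (by omega) (by omega) hD rfl rfl hdD
    rfl (fun _ _ => rfl) hdD (by
      intro a ha b hb y hy
      have hacc : Accumulates ((ι.upd 30 a).upd 31 b) 32 y (.forLoop 32 (.lit d)
          (.addAcc (.mul (.get 1 (.var 20) (.var 30) (.var 32) (.lit 0))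
            (opEntry (.var 21) (.var 32) (.var 31)))))
          (entry (localProduct (K :: Ks) K.party) a b) ((1 + 6) * D) := by
        rw [localProduct, Function.update_self, entry_mul _ _ ha hb]
        refine Accumulates.forLoop (by omega) rfl rfl hdD hD fun c hc => ?_
        refine Accumulates.addAcc rfl fun z => ?_
        have e1 : y 14 K.party c b 0 + y 15 0 c b 0 = entry (localProduct Ks K.party) c b := by
          rw [hy 14 _ _ _ _ (by omega) (Or.inl (by omega)),
            hy 15 _ _ _ _ (by omega) (Or.inl (by omega)), hid c hc b hb, hops c hc b hb]
          ring
        have e2 : y 1 (ι 20 0 0) a c 0 = entry K.op a c := by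
          rw [hy 1 _ _ _ _ (by omega) (Or.inl (by omega)), hK a ha c hc]
        rw [← e1, ← e2, ← hl]
        rfl
      refine ((Triple.storeSum hacc rfl).conseq (fun _ h => h) ?_).mono ?_
      · rintro _ rfl
        exact ⟨entry (localProduct (K :: Ks) K.party) a b, rfl⟩
      · rw [pow_one]
        omega)
  have second : ∀ y, (SameOff 21 0 y₀ y ∧ ∀ a < d, ∀ b < d,
      y 21 0 a b 0 = entry (localProduct (K :: Ks) K.party) a b) →
      Triple ι 30 (· = y) (.forLoop 30 (.lit d) (.forLoop 31 (.lit d)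
      (.setC 14 (.var 21) (.var 30) (.var 31) (.lit 0)
        (.add (.get 21 (.lit 0) (.var 30) (.var 31) (.lit 0))
          (.neg (.get 15 (.lit 0) (.var 30) (.var 31) (.lit 0)))))))
      (fun y' => SameOff 14 K.party y y' ∧ ∀ a < d, ∀ b < d, y' 14 K.party a b 0 =
        entry (localProduct (K :: Ks) K.party) a b - if a = b then 1 else 0)
      (((1 + 6) * D + 6) * D) := by
    rintro y ⟨hy1, hy2⟩
    refine Triple.fillRow (ι := ι) (k := 30) (N₁ := d) (N₂ := d) (D := D) (B := 1)
      (A := 14) (i₀ := K.party) (b₁ := .lit d) (b₂ := .lit d) (y₀ := y)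
      (fun a b => entry (localProduct (K :: Ks) K.party) a b - if a = b then 1 else 0) (by omega)
      (by omega) hD rfl rfl hdD rfl (fun _ _ => rfl) hdD ?_
    intro a ha b hb y' hy'
    refine Triple.setC rfl ?_
    rintro y' rfl
    refine ⟨y' 23 0 0 0 0, ?_⟩
    have e1 : y' 21 0 a b 0 = entry (localProduct (K :: Ks) K.party) a b := by
      rw [hy' 21 _ _ _ _ (by omega) (Or.inl (by omega)), hy2 a ha b hb]
    have e2 : y' 15 0 a b 0 = if a = b then 1 else 0 := by
      rw [hy' 15 _ _ _ _ (by omega) (Or.inl (by omega)),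
        hy1 15 _ _ _ _ (by omega) (Or.inl (by omega)), hid a ha b hb]
    rw [Num.acc_self, ← e1, ← e2, sub_eq_add_neg, ← hl]
    rfl
  refine Triple.mono (B := 23 * D ^ 3 + 13 * D ^ 2 + 1) ((first.mono ?_).seq
    (Triple.of_eq fun y hy => ((second y hy).conseq (fun _ h => h) ?_).mono ?_)) ?_
  · exact (Nat.mul_le_mul_right _ (Nat.add_le_add_right (hb 11 1) 6)).trans (hb 17 2)
  · rintro y' ⟨h1, h2⟩
    refine ⟨h2, fun l hl' Ks' h a ha b hb => ?_, fun x h14 h21 h23 => ?_⟩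
    · rw [h1 14 _ _ _ _ (by omega) (Or.inr fun e => hl' (Fin.ext e)),
        hy.1 14 _ _ _ _ (by omega) (Or.inl (by omega))]
      exact h a ha b hb
    · funext i j k l
      rw [h1 x _ _ _ _ h23 (Or.inl h14), hy.1 x _ _ _ _ h23 (Or.inl h21)]
  · simpa using hb 7 1
  · have h2 : D ^ 2 ≤ D ^ 3 := Nat.pow_le_pow_right hD (by omega)
    have h1 : 1 ≤ D ^ 3 := Nat.one_le_pow _ _ hD
    omega

theorem opsAt_cons_of_ne {Ks : List (LocalOp n d)} {K : LocalOp n d} {l : Fin n} {y : Num}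
    (hl : l ≠ K.party) (h : OpsAt Ks l y) : OpsAt (K :: Ks) l y := by
  intro a ha b hb
  rw [h a ha b hb, localProduct, Function.update_of_ne hl]

theorem triple_applyCmd_cons {ι : Idx} {y₀ : Num} {D : ℕ} {Ks : List (LocalOp n d)}
    {K : LocalOp n d} (hD : 0 < D) (hdD : d ≤ D) (hid : HasId d y₀) (hops : ∀ l, OpsAt Ks l y₀)
    (hl : ι 21 0 0 = K.party)
    (hK : ∀ a < d, ∀ b < d, y₀ 1 (ι 20 0 0) a b 0 = entry K.op a b) :
    Triple ι 30 (· = y₀) (applyCmd d)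
      (fun y => (∀ l, OpsAt (K :: Ks) l y) ∧
        (∀ l, l ≠ K.party → OpsAt Ks l y) ∧
        ∀ x, x ≠ 14 → x ≠ 21 → x ≠ 23 → y x = y₀ x) (37 * D ^ 3) := by
  refine (triple_applyCmd hD hdD hid (hops K.party) hl hK).conseq (fun _ h => h) ?_
  rintro y ⟨h1, h2, h3⟩
  refine ⟨fun l => ?_, fun l hl' => h2 l hl' _ (hops l), h3⟩
  by_cases hl' : l = K.party
  · exact hl' ▸ h1
  · exact opsAt_cons_of_ne hl' (h2 l hl' _ (hops l))

/-- Copies the operator of the party `5` to the array `16`. -/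
def saveCmd (d : ℕ) : Cmd :=
  .forLoop 30 (.lit d) (.forLoop 31 (.lit d)
    (.setC 16 (.lit 0) (.var 30) (.var 31) (.lit 0)
      (.get 14 (.var 5) (.var 30) (.var 31) (.lit 0))))

def restoreCmd (d : ℕ) : Cmd :=
  .forLoop 30 (.lit d) (.forLoop 31 (.lit d)
    (.setC 14 (.var 5) (.var 30) (.var 31) (.lit 0)
      (.get 16 (.lit 0) (.var 30) (.var 31) (.lit 0))))

theorem triple_saveCmd {ι : Idx} {y₀ : Num} {D : ℕ} (hD : 0 < D) (hdD : d ≤ D) :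
    Triple ι 30 (· = y₀) (saveCmd d)
      (fun y => (∀ a < d, ∀ b < d, y 16 0 a b 0 = y₀ 14 (ι 5 0 0) a b 0) ∧
        ∀ x, x ≠ 16 → x ≠ 23 → y x = y₀ x) (13 * D ^ 2) := by
  refine ((Triple.fillRow (ι := ι) (k := 30) (N₁ := d) (N₂ := d) (D := D) (B := 1)
    (A := 16) (i₀ := 0) (b₁ := .lit d) (b₂ := .lit d) (y₀ := y₀)
    (fun a b => y₀ 14 (ι 5 0 0) a b 0) (by omega) (by omega) hD rfl rfl hdD rfl (fun _ _ => rfl)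
    hdD ?_).conseq (fun _ h => h) ?_).mono ?_
  · intro a ha b hb y hy
    refine Triple.setC rfl ?_
    rintro y rfl
    refine ⟨y 23 0 0 0 0, ?_⟩
    rw [Num.acc_self, ← hy 14 _ _ _ _ (by omega) (Or.inl (by omega))]
    rfl
  · rintro y ⟨h1, h2⟩
    refine ⟨h2, fun x hx hx' => ?_⟩
    funext i j k l
    exact h1 x i j k l hx' (Or.inl hx)
  · simpa using mul_pow_add_six_le (b := 7) hD 1

theorem triple_restoreCmd {ι : Idx} {y₀ : Num} {D : ℕ} (hD : 0 < D) (hdD : d ≤ D) :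
    Triple ι 30 (· = y₀) (restoreCmd d)
      (fun y => (∀ a < d, ∀ b < d, y 14 (ι 5 0 0) a b 0 = y₀ 16 0 a b 0) ∧
        SameOff 14 (ι 5 0 0) y₀ y) (13 * D ^ 2) := by
  refine ((Triple.fillRow (ι := ι) (k := 30) (N₁ := d) (N₂ := d) (D := D) (B := 1)
    (A := 14) (i₀ := ι 5 0 0) (b₁ := .lit d) (b₂ := .lit d) (y₀ := y₀)
    (fun a b => y₀ 16 0 a b 0) (by omega) (by omega) hD rfl rfl hdD rfl (fun _ _ => rfl)
    hdD ?_).conseq (fun _ h => h) ?_).mono ?_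
  · intro a ha b hb y hy
    refine Triple.setC rfl ?_
    rintro y rfl
    refine ⟨y 23 0 0 0 0, ?_⟩
    rw [Num.acc_self, ← hy 16 _ _ _ _ (by omega) (Or.inl (by omega))]
    rfl
  · rintro y ⟨h1, h2⟩
    exact ⟨h2, h1⟩
  · simpa using mul_pow_add_six_le (b := 7) hD 1

/-! ### The evaluator -/

/-- The memory describes the network and the operators `Ks` that have acted. -/
structure Ready (N : TTN T d) (Ks : List (LocalOp n d)) (s : Store) : Prop where
  tree : ∀ a < 5, s.idx a = N.encode.idx a
  tensors : s.num 0 = N.encode.num 0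
  ops : ∀ l, OpsAt Ks l s.num

/-- Storing the difference from the identity makes the zero array describe parties on which nothing
has acted, so no initialization over the parties is needed. -/
theorem ready_encode (N : TTN T d) : Ready N [] N.encode where
  tree _ _ := rfl
  tensors := rfl
  ops l a ha b hb := by
    rw [N.encode_num_eq_zero (by omega)]
    simp [localProduct, entry, ha, hb, Matrix.one_apply]

def evaluatorCmd (d : ℕ) : Cmd :=
  .seq traverse (.seq (identityCmd d)
    (.seq (.forLoop 20 (.var 5) (.letVar 21 (.get 6 (.var 20) (.lit 0)) (applyCmd d)))
      (.seq (contractCmd d)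
        (.setC 3 (.lit 0) (.lit 0) (.lit 0) (.lit 0)
          (.get 22 (.lit 0) (.lit 0) (.lit 0) (.lit 0))))))

/-- At most `n` operators are applied at cost `O(D^3)` each, and a single contraction follows. -/
theorem runs_evaluatorCmd {N : TTN T d} {D : ℕ} (hn : 0 < n) (hD : 0 < D) (hdD : d ≤ D)
    (hdim : ∀ (v : T.Inner) w, T.graph.Adj v w → N.dim s(↑v, w) ≤ D)
    (Ks : List (LocalOp n d)) (hKs : Ks.length ≤ n) :
    ∃ s, Runs (evaluatorCmd d) (N.encode.presentList Ks) s (400 * n * D ^ 6) ∧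
      s.num 3 0 0 0 0 = ((applyOps Ks N.contract).normSq : ℂ) := by
  set s₀ := N.encode.presentList Ks with hs₀
  have hpow : 1 ≤ D ^ 6 := Nat.one_le_pow _ _ hD
  obtain ⟨s₁, L, hr₁, hidx, hnum, htrav⟩ := runs_traverse N ⟨0, hn⟩ rfl (s₀ := s₀) (by
    intro a ha
    funext i j
    simp [hs₀, Store.presentList, show a ≠ 5 by omega, show a ≠ 6 by omega])
  have hι : Loaded N ⟨0, hn⟩ s₁.idx L := ⟨rfl, fun a ha => by
    rw [hidx a (by omega)]
    funext i j
    simp [hs₀, Store.presentList, show a ≠ 5 by omega, show a ≠ 6 by omega], htrav⟩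
  have hcount : (IExp.var 5).val s₁.idx = Ks.length := by
    simp [IExp.var, IExp.val, hidx 5 (by omega), hs₀, Store.presentList]
  have hlen : Ks.reverse.length = Ks.length := List.length_reverse
  have main : Triple s₁.idx 20 (· = s₁.num) (.seq (identityCmd d)
    (.seq (.forLoop 20 (.var 5) (.letVar 21 (.get 6 (.var 20) (.lit 0)) (applyCmd d)))
      (.seq (contractCmd d)
        (.setC 3 (.lit 0) (.lit 0) (.lit 0) (.lit 0)
          (.get 22 (.lit 0) (.lit 0) (.lit 0) (.lit 0))))))
      (fun y => y 3 0 0 0 0 = ((applyOps Ks N.contract).normSq : ℂ))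
      (14 * D ^ 2 + ((37 * D ^ 3 + 2 + 6) * n + (164 * n * D ^ 6 + 1 + 1) + 1) + 1) := by
    refine (Triple.weaken (fun ι' _ => triple_identityCmd hD hdD) (by omega : 20 ≤ 30)).seq ?_
    refine Triple.seq (Q := fun y => y 0 = N.encode.num 0 ∧ HasId d y ∧ ∀ l, OpsAt Ks l y) ?_ ?_
    -- The memory is chronological while `Ks` starts with the latest operator, hence the two
    -- reversals.
    · refine (Triple.forLoop (I := fun i y => (y 0 = N.encode.num 0 ∧ y 1 = s₀.num 1) ∧ HasId d y ∧
        ∀ l, OpsAt ((Ks.reverse.take i).reverse) l y) (by omega) rfl hcount hKs hn ?_).conseq ?_ ?_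
      · intro i hi
        have hi' : i < Ks.reverse.length := by omega
        have hparty : s₁.idx 6 i 0 = (Ks.reverse[i]).party := by
          rw [hidx 6 (by omega), hs₀]
          simp [Store.presentList, hi]
        refine Triple.letVar (by omega) rfl ?_
        refine Triple.of_eq fun y hy => ?_
        refine Triple.weaken (k' := 30) (fun ι' hι' => ?_) (by omega)
        have h20 : ι' 20 0 0 = i := hι'.2 20 (by omega)
        have h21 : ι' 21 0 0 = (Ks.reverse[i]).party := (hι'.2 21 (by omega)).trans hparty
        refine (triple_applyCmd_cons hD hdD hy.2.1 hy.2.2 h21 ?_).conseq (fun _ h => h) ?_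
        · intro a ha b hb
          rw [hy.1.2, h20, hs₀]
          simp only [Store.presentList, if_pos, entry]
          rw [dif_pos ⟨hi', ha, hb, trivial⟩, dif_pos ⟨ha, hb⟩]
        · rintro y' ⟨h1, -, h3⟩
          refine ⟨⟨?_, ?_⟩, ?_, ?_⟩
          · rw [h3 0 (by omega) (by omega) (by omega), hy.1.1]
          · rw [h3 1 (by omega) (by omega) (by omega), hy.1.2]
          · unfold HasId
            rw [h3 15 (by omega) (by omega) (by omega)]
            exact hy.2.1
          · rw [List.take_add_one, List.getElem?_eq_getElem hi', Option.toList_some,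
              List.reverse_append, List.reverse_singleton, List.singleton_append]
            exact h1
      · rintro y ⟨h1, h2⟩
        refine ⟨⟨?_, ?_⟩, h1, ?_⟩
        · rw [h2 0 (by omega) (by omega), hnum, hs₀]
          funext i j k l
          simp [Store.presentList]
        · rw [h2 1 (by omega) (by omega), hnum]
        · intro l a ha b hb
          have e : y 14 l a b 0 = N.encode.num 14 l a b 0 := by
            rw [h2 14 (by omega) (by omega), hnum, hs₀]
            simp [Store.presentList]
          rw [e]
          simpa using (ready_encode N).ops l a ha b hb
      · rintro y ⟨⟨h1, -⟩, h2, h3⟩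
        refine ⟨h1, h2, fun l => ?_⟩
        have := h3 l
        rwa [← hlen, List.take_length, List.reverse_reverse] at this
    · refine Triple.seq (Q := fun y => y 22 0 0 0 0 = ((applyOps Ks N.contract).normSq : ℂ))
        (Triple.of_eq fun y hy => ?_) (Triple.setC rfl ?_)
      · refine Triple.weaken (k' := 30) (fun ι' hι' => ?_) (by omega)
        exact (triple_contractCmd (hι.of_agree hι'.1) (holds_of_opsAt hy.1 hy.2.1 hy.2.2) hD hdD
          hdim).conseq (fun _ h => h) fun y h => h.2
      · intro y hy
        simpa [Num.set, IExp.val, CExp.val] using hy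
  obtain ⟨s₂, hr₂, -, h⟩ := main s₁ (Agree.refl _ _) rfl
  refine ⟨s₂, (hr₁.seq hr₂).mono ?_, h⟩
  have hm := T.card_vertices
  have h3 : D ^ 3 ≤ D ^ 6 := Nat.pow_le_pow_right hD (by omega)
  have h2 : D ^ 2 ≤ D ^ 6 := Nat.pow_le_pow_right hD (by omega)
  have h4 : D ^ 6 ≤ n * D ^ 6 := Nat.le_mul_of_pos_left _ hn
  have h5 : n ≤ n * D ^ 6 := Nat.le_mul_of_pos_right _ hpow
  have h6 : (37 * D ^ 3 + 2 + 6) * n ≤ 45 * (n * D ^ 6) := by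
    calc (37 * D ^ 3 + 2 + 6) * n ≤ (45 * D ^ 6) * n := Nat.mul_le_mul_right _ (by omega)
      _ = 45 * (n * D ^ 6) := by ring
  rw [mul_assoc 164, mul_assoc 400]
  omega

end MQC

/-! ### Sampling one outcome by inversion of the distribution function. -/

namespace MQC

variable {n d q : ℕ} {T : SubcubicTree n}

/-! ### The sampler -/

/-- The least outcome `s` such that the random number is below the normalized sum of the
probabilities of the outcomes `0, …, s`; the array `12` holds these sums. -/
def selectCmd (q : ℕ) : Cmd :=
  .seq (.setI 7 (.lit 0) (.lit 0) (.lit 0))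
    (.forLoop 20 (.lit q)
      (.ite (.ltRe (.mul (.get 2 (.lit 0) (.lit 0) (.lit 0) (.lit 0))
          (.get 12 (.lit q) (.lit 0) (.lit 0) (.lit 0)))
          (.get 12 (.add (.var 20) (.lit 1)) (.lit 0) (.lit 0) (.lit 0)))
        (.setI 7 (.lit 0) (.lit 0) (.var 7))
        (.setI 7 (.lit 0) (.lit 0) (.add (.var 20) (.lit 1)))))

/-- The loop moves the outcome to `i + 1` whenever the random number is not below the threshold `i +
1`; thus the final outcome is behind the last threshold that fails. Comparing with `u * c q` avoids
a division. In the other branch the outcome is assigned to itself, as an idle command. -/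
theorem runs_selectCmd {s₀ : Store} {c : ℕ → ℝ} {u : ℝ}
    (hc : ∀ j ≤ q, s₀.num 12 j 0 0 0 = c j) (hu : s₀.num 2 0 0 0 0 = u) (h0 : c 0 ≤ u * c q) :
    ∃ s, Runs (selectCmd q) s₀ s (5 * q + 5) ∧ s.num = s₀.num ∧
      (∀ a < 20, a ≠ 7 → s.idx a = s₀.idx a) ∧ s.idx 7 0 0 ≤ q ∧ c (s.idx 7 0 0) ≤ u * c q ∧
      ∀ j, s.idx 7 0 0 ≤ j → j < q → u * c q < c (j + 1) := by
  have key := runs_forLoop (k := 20) (bound := .lit q)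
    (c := .ite (.ltRe (.mul (.get 2 (.lit 0) (.lit 0) (.lit 0) (.lit 0))
          (.get 12 (.lit q) (.lit 0) (.lit 0) (.lit 0)))
          (.get 12 (.add (.var 20) (.lit 1)) (.lit 0) (.lit 0) (.lit 0)))
        (.setI 7 (.lit 0) (.lit 0) (.var 7))
        (.setI 7 (.lit 0) (.lit 0) (.add (.var 20) (.lit 1))))
    (N := q) (B := 2) (s := s₀.setI 7 0 0 0)
    (I := fun i s => s.num = s₀.num ∧ (∀ a < 20, a ≠ 7 → s.idx a = s₀.idx a) ∧
      s.idx 20 0 0 = i ∧ s.idx 7 0 0 ≤ i ∧ c (s.idx 7 0 0) ≤ u * c q ∧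
      ∀ j, s.idx 7 0 0 ≤ j → j < i → u * c q < c (j + 1)) ?_ (fun i s h => h.2.2.1)
      (fun i s h => rfl) ?_
  · obtain ⟨s, hr, hs⟩ := key
    refine ⟨s, ((runs_setI 7 (.lit 0) (.lit 0) (.lit 0) s₀).seq hr).mono (by omega), hs.1, hs.2.1,
      hs.2.2.2.1, hs.2.2.2.2.1, hs.2.2.2.2.2⟩
  · refine ⟨rfl, fun a ha ha' => ?_, by simp [Store.setI_idx_self], ?_, ?_, ?_⟩
    · rw [Store.setI_idx_of_ne (by omega), Store.setI_idx_of_ne ha']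
    · simp [Store.setI_idx_of_ne, Store.setI_idx_self]
    · simpa [Store.setI_idx_of_ne, Store.setI_idx_self] using h0
    · intro j _ hj
      omega
  · rintro i hi s ⟨hnum, hidx, h20, hle, hlow, hup⟩
    have htest : (Test.ltRe (.mul (.get 2 (.lit 0) (.lit 0) (.lit 0) (.lit 0))
          (.get 12 (.lit q) (.lit 0) (.lit 0) (.lit 0)))
          (.get 12 (.add (.var 20) (.lit 1)) (.lit 0) (.lit 0) (.lit 0))).holds s ↔
        u * c q < c (i + 1) := by
      simp only [Test.holds, CExp.eval, IExp.eval, IExp.var, h20, hnum, hu, hc q le_rfl,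
        hc (i + 1) hi]
      rw [← Complex.ofReal_mul, Complex.ofReal_re, Complex.ofReal_re]
    by_cases ht : u * c q < c (i + 1)
    · have e7 : ((s.setI 7 0 0 (s.idx 7 0 0)).setI 20 0 0 (i + 1)).idx 7 0 0 = s.idx 7 0 0 := by
        simp [Store.setI_idx_of_ne, Store.setI_idx_self]
      refine ⟨s.setI 7 0 0 (s.idx 7 0 0), Runs.ite_true (htest.2 ht) (runs_setI 7 _ _ _ s), ?_,
        hnum, fun a ha ha' => ?_, by simp [Store.setI_idx_self], ?_⟩
      · rw [Store.setI_idx_of_ne (by omega), h20]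
      · rw [Store.setI_idx_of_ne (by omega), Store.setI_idx_of_ne ha', hidx a ha ha']
      · rw [e7]
        refine ⟨by omega, hlow, fun j hj hji => ?_⟩
        rcases Nat.lt_succ_iff_lt_or_eq.1 hji with h | rfl
        · exact hup j hj h
        · exact ht
    · have e7 : ((s.setI 7 0 0 (i + 1)).setI 20 0 0 (i + 1)).idx 7 0 0 = i + 1 := by
        simp [Store.setI_idx_of_ne, Store.setI_idx_self]
      refine ⟨s.setI 7 0 0 (i + 1), Runs.ite_false (fun h => ht (htest.1 h)) ?_, ?_,
        hnum, fun a ha ha' => ?_, by simp [Store.setI_idx_self], ?_⟩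
      · have := runs_setI 7 (.lit 0) (.lit 0) (.add (.var 20) (.lit 1)) s
        simpa [IExp.eval, IExp.var, h20] using this
      · rw [Store.setI_idx_of_ne (by omega), h20]
      · rw [Store.setI_idx_of_ne (by omega), Store.setI_idx_of_ne ha', hidx a ha ha']
      · rw [e7]
        refine ⟨le_rfl, not_lt.1 ht, fun j hj hji => ?_⟩
        omega

/-- The sums of the probabilities of the outcomes before `j`, up to normalization. -/
noncomputable def cumulative (M : LocalMeasurement n d q) (φ : State n d) (j : ℕ) : ℝ :=
  ∑ s ∈ Finset.range j, if h : s < q then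
    (LocalOp.apply ⟨M.party, M.kraus ⟨s, h⟩⟩ φ).normSq else 0

theorem cumulative_last (M : LocalMeasurement n d q) (φ : State n d) :
    cumulative M φ q = φ.normSq := by
  rw [← sum_normSq_kraus M φ, cumulative, Finset.sum_range]
  simp

theorem cumulative_succ (M : LocalMeasurement n d q) (φ : State n d) (s : Fin q) :
    cumulative M φ (s + 1) =
      cumulative M φ s + (LocalOp.apply ⟨M.party, M.kraus s⟩ φ).normSq := by
  rw [cumulative, Finset.sum_range_succ, ← cumulative]
  simp

theorem cumulative_mono (M : LocalMeasurement n d q) (φ : State n d) :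
    Monotone (cumulative M φ) := by
  refine monotone_nat_of_le_succ fun j => ?_
  rw [cumulative, cumulative, Finset.sum_range_succ]
  refine le_add_of_nonneg_right ?_
  split_ifs
  · exact State.normSq_nonneg _
  · exact le_rfl

def outcomeSums (d q : ℕ) : Cmd :=
  .seq (.setC 12 (.lit 0) (.lit 0) (.lit 0) (.lit 0) .zero)
    (.forLoop 20 (.lit q) (.letVar 21 (.var 5)
      (.seq (.seq (restoreCmd d) (applyCmd d)) (.seq (contractCmd d)
        (.setC 12 (.add (.var 20) (.lit 1)) (.lit 0) (.lit 0) (.lit 0)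
          (.add (.get 12 (.var 20) (.lit 0) (.lit 0) (.lit 0))
            (.get 22 (.lit 0) (.lit 0) (.lit 0) (.lit 0))))))))

/-- What the sampler keeps while it tries the outcomes of the measurement `M`. -/
structure Trying (N : TTN T d) (Ks : List (LocalOp n d)) (M : LocalMeasurement n d q) (u : ℝ)
    (y : Num) : Prop where
  tensors : y 0 = N.encode.num 0
  random : y 2 0 0 0 0 = u
  kraus : ∀ s : Fin q, ∀ a < d, ∀ b < d, y 1 s a b 0 = entry (M.kraus s) a b
  ident : HasId d y
  saved : ∀ a < d, ∀ b < d, y 16 0 a b 0 =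
    entry (localProduct Ks M.party) a b - if a = b then 1 else 0
  ops : ∀ l, l ≠ M.party → OpsAt Ks l y

section

variable {N : TTN T d} {Ks : List (LocalOp n d)} {M : LocalMeasurement n d q} {u : ℝ}

theorem Trying.congr {y y' : Num} (h : Trying N Ks M u y) (h0 : y' 0 = y 0) (h1 : y' 1 = y 1)
    (h2 : y' 2 = y 2) (h15 : y' 15 = y 15) (h16 : y' 16 = y 16)
    (h14 : ∀ l, l ≠ M.party → OpsAt Ks l y') : Trying N Ks M u y' where
  tensors := h0.trans h.tensors
  random := by rw [h2, h.random]
  kraus := by rw [h1]; exact h.kraus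
  ident := by unfold HasId; rw [h15]; exact h.ident
  saved := by rw [h16]; exact h.saved
  ops := h14

/-- Restoring the saved operator first undoes whatever outcome was tried before, so all outcomes
start from the same state. -/
theorem triple_tryOutcome {ι : Idx} {y₀ : Num} {D : ℕ} (hD : 0 < D) (hdD : d ≤ D)
    (hy : Trying N Ks M u y₀) (hparty : ι 5 0 0 = M.party) (h21 : ι 21 0 0 = M.party)
    (s : Fin q) (hs : ι 20 0 0 = s) :
    Triple ι 30 (· = y₀) (.seq (restoreCmd d) (applyCmd d))
      (fun y => Trying N Ks M u y ∧ (∀ l, OpsAt (⟨M.party, M.kraus s⟩ :: Ks) l y) ∧ y 12 = y₀ 12)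
      (51 * D ^ 3) := by
  refine Triple.mono (B := 13 * D ^ 2 + 37 * D ^ 3 + 1) ((triple_restoreCmd hD hdD).seq
    (Triple.of_eq fun y h => ?_)) ?_
  · obtain ⟨hr1, hr2⟩ := h
    rw [hparty] at hr1 hr2
    have heq : ∀ x, x ≠ 14 → x ≠ 23 → y x = y₀ x := by
      intro x hx hx'
      funext i j k l
      exact hr2 x i j k l hx' (Or.inl hx)
    have hops : ∀ l, OpsAt Ks l y := by
      intro l a ha b hb
      by_cases hl : l = M.party
      · rw [hl, hr1 a ha b hb, hy.saved a ha b hb]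
      · rw [hr2 14 _ _ _ _ (by omega) (Or.inr fun e => hl (Fin.ext e))]
        exact hy.ops l hl a ha b hb
    have hty : Trying N Ks M u y := hy.congr (heq 0 (by omega) (by omega))
      (heq 1 (by omega) (by omega)) (heq 2 (by omega) (by omega)) (heq 15 (by omega) (by omega))
      (heq 16 (by omega) (by omega)) fun l _ => hops l
    refine (triple_applyCmd_cons (K := ⟨M.party, M.kraus s⟩) hD hdD hty.ident hops h21
      ?_).conseq (fun _ h => h) ?_
    · rw [hs]
      exact hty.kraus s
    · rintro y' ⟨h1, h2, h3⟩
      refine ⟨hty.congr (h3 0 (by omega) (by omega) (by omega))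
        (h3 1 (by omega) (by omega) (by omega)) (h3 2 (by omega) (by omega) (by omega))
        (h3 15 (by omega) (by omega) (by omega)) (h3 16 (by omega) (by omega) (by omega)) h2, h1,
        (h3 12 (by omega) (by omega) (by omega)).trans (heq 12 (by omega) (by omega))⟩
  · have h2 : D ^ 2 ≤ D ^ 3 := Nat.pow_le_pow_right hD (by omega)
    have h1 : 1 ≤ D ^ 3 := Nat.one_le_pow _ _ hD
    omega

/-- One contraction per outcome; the operators at the measured party are left in the state of the
last trial, which is why `Trying` says nothing about them. -/
theorem triple_outcomeSums {ι : Idx} {y₀ : Num} {D : ℕ} {l₀ : Fin n} {L : List (Fin T.m)}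
    (hι : Loaded N l₀ ι L) (hD : 0 < D) (hdD : d ≤ D)
    (hdim : ∀ (v : T.Inner) w, T.graph.Adj v w → N.dim s(↑v, w) ≤ D)
    (hy : Trying N Ks M u y₀) (hparty : ι 5 0 0 = M.party) :
    Triple ι 20 (· = y₀) (outcomeSums d q)
      (fun y => Trying N Ks M u y ∧
        ∀ j ≤ q, y 12 j 0 0 0 = cumulative M (applyOps Ks N.contract) j)
      (230 * (q + 1) * (n * D ^ 6)) := by
  have hn : 0 < n := Fin.pos l₀
  have hpow : 1 ≤ D ^ 6 := Nat.one_le_pow _ _ hD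
  have hpow3 : D ^ 3 ≤ D ^ 6 := Nat.pow_le_pow_right hD (by omega)
  have hE : D ^ 6 ≤ n * D ^ 6 := Nat.le_mul_of_pos_left _ hn
  refine Triple.mono (B := 1 + (220 * (n * D ^ 6) + 6) * (q + 1) + 1)
    (Triple.seq (Q := fun y => Trying N Ks M u y ∧ ∀ j ≤ 0, y 12 j 0 0 0 =
      cumulative M (applyOps Ks N.contract) j) (Triple.setC rfl ?_)
      (Triple.forLoop (I := fun i y => Trying N Ks M u y ∧ ∀ j ≤ i, y 12 j 0 0 0 =
        -- The loop rule wants a positive bound of the number of rounds, and `q` might be `0`; hence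
        -- `q + 1`.
        cumulative M (applyOps Ks N.contract) j) (by omega) rfl rfl (Nat.le_succ q)
        (by omega) ?_)) ?_
  · rintro y rfl
    refine ⟨hy.congr ?_ ?_ ?_ ?_ ?_ ?_, ?_⟩
    · funext i j k l; simp [Num.set]
    · funext i j k l; simp [Num.set]
    · funext i j k l; simp [Num.set]
    · funext i j k l; simp [Num.set]
    · funext i j k l; simp [Num.set]
    · intro l hl a ha b hb
      simpa [Num.set] using hy.ops l hl a ha b hb
    · intro j hj
      obtain rfl : j = 0 := by omega
      simp [Num.set, IExp.val, CExp.val, cumulative]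
  · intro i hi
    refine Triple.mono (B := (51 * D ^ 3 + (164 * n * D ^ 6 + 1 + 1) + 1) + 2)
      (Triple.letVar (by omega) rfl (Triple.of_eq fun y hyI => ?_)) ?_
    · refine Triple.weaken (k' := 30) (fun ι' hι' => ?_) (by omega)
      have h20 : ι' 20 0 0 = i := hι'.2 20 (by omega)
      have h5 : ι' 5 0 0 = M.party := (hι'.2 5 (by omega)).trans hparty
      have h21 : ι' 21 0 0 = M.party := (hι'.2 21 (by omega)).trans hparty
      have hL : Loaded N l₀ ι' L :=
        hι.of_agree ((hι'.of_upd (by omega)).of_upd (by omega)).1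
      refine (triple_tryOutcome hD hdD hyI.1 h5 h21 ⟨i, hi⟩ h20).seq (Triple.of_eq fun y₁ h₁ => ?_)
      refine (triple_contractCmd hL (holds_of_opsAt h₁.1.tensors h₁.1.ident h₁.2.1) hD hdD
        hdim).seq (Triple.setC rfl ?_)
      rintro y₂ ⟨h2, h3⟩
      obtain ⟨y₃, hy₃⟩ : ∃ y₃, y₃ = y₂.set 12 (i + 1) 0 0 0 (y₂ 12 i 0 0 0 + y₂ 22 0 0 0 0) :=
        ⟨_, rfl⟩
      have hgoal : Trying N Ks M u y₃ ∧ ∀ j ≤ i + 1, y₃ 12 j 0 0 0 =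
          cumulative M (applyOps Ks N.contract) j := by
        have h4 : ∀ x, x ≠ 12 → y₃ x = y₂ x := by
          intro x hx
          rw [hy₃]
          funext i j k l
          simp [Num.set, hx]
        refine ⟨h₁.1.congr ?_ ?_ ?_ ?_ ?_ ?_, fun j hj => ?_⟩
        · rw [h4 _ (by omega), h2 _ (by omega) (by omega) (by omega)]
        · rw [h4 _ (by omega), h2 _ (by omega) (by omega) (by omega)]
        · rw [h4 _ (by omega), h2 _ (by omega) (by omega) (by omega)]
        · rw [h4 _ (by omega), h2 _ (by omega) (by omega) (by omega)]
        · rw [h4 _ (by omega), h2 _ (by omega) (by omega) (by omega)]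
        · unfold OpsAt
          rw [h4 _ (by omega), h2 _ (by omega) (by omega) (by omega)]
          exact h₁.1.ops
        · have h5 : ∀ j ≤ i, y₂ 12 j 0 0 0 = cumulative M (applyOps Ks N.contract) j := by
            intro j hj
            rw [h2 12 (by omega) (by omega) (by omega), h₁.2.2]
            exact hyI.2 j hj
          rcases Nat.le_succ_iff.1 hj with h6 | rfl
          · rw [hy₃, ← h5 j h6]
            simp [Num.set, show j ≠ i + 1 by omega]
          · have := cumulative_succ M (applyOps Ks N.contract) ⟨i, hi⟩
            simp only at this
            rw [this, Complex.ofReal_add, ← h5 i le_rfl]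
            rw [applyOps] at h3
            rw [← h3, hy₃]
            simp [Num.set]
      rw [hy₃, ← h20] at hgoal
      rw [h20] at hgoal
      have e : (IExp.add (.var 20) (.lit 1)).val ι' = i + 1 := by
        simp [IExp.val, IExp.var, h20]
      have e' : (CExp.add (.get 12 (.var 20) (.lit 0) (.lit 0) (.lit 0))
            (.get 22 (.lit 0) (.lit 0) (.lit 0) (.lit 0))).val ι' y₂ =
          y₂ 12 i 0 0 0 + y₂ 22 0 0 0 0 := by
        simp [CExp.val, IExp.val, IExp.var, h20]
      rw [e, e']
      exact hgoal
    · rw [mul_assoc 164]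
      omega
  · calc 1 + (220 * (n * D ^ 6) + 6) * (q + 1) + 1
        ≤ (220 * (n * D ^ 6) + 6) * (q + 1) + 2 * (n * D ^ 6 * (q + 1)) := by
          have : 1 ≤ n * D ^ 6 * (q + 1) := Nat.mul_pos (by omega) (by omega)
          omega
      _ ≤ (226 * (n * D ^ 6)) * (q + 1) + 2 * (n * D ^ 6 * (q + 1)) :=
          Nat.add_le_add_right (Nat.mul_le_mul_right _ (by omega)) _
      _ = 228 * ((q + 1) * (n * D ^ 6)) := by ring
      _ ≤ 230 * (q + 1) * (n * D ^ 6) := by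
          rw [mul_assoc]
          exact Nat.mul_le_mul_right _ (by omega)

def samplerCmd (d q : ℕ) : Cmd :=
  .seq traverse (.seq (.seq (identityCmd d) (.seq (saveCmd d) (outcomeSums d q)))
    (.seq (selectCmd q)
      (.letVar 20 (.var 7) (.letVar 21 (.var 5) (.seq (restoreCmd d) (applyCmd d))))))

/-- The state is never normalized: the random number is scaled by the squared norm instead. The
selected operator is applied once more at the end, which restores `Ready` for the next measurement.
-/
theorem runs_samplerCmd {D : ℕ} (hn : 0 < n) (hD : 0 < D) (hdD : d ≤ D)
    (hdim : ∀ (v : T.Inner) w, T.graph.Adj v w → N.dim s(↑v, w) ≤ D) {s₀ : Store}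
    (hs₀ : Ready N Ks s₀) (hu : u ∈ Set.Ico (0 : ℝ) 1)
    (hpos : 0 < (applyOps Ks N.contract).normSq) :
    ∃ (s : Store) (o : Fin q),
      Runs (samplerCmd d q) (s₀.present M u) s (500 * (q + 1) * (n * D ^ 6)) ∧
      s.idx 7 0 0 = o ∧
      cumulative M (applyOps Ks N.contract) o ≤ u * (applyOps Ks N.contract).normSq ∧
      u * (applyOps Ks N.contract).normSq < cumulative M (applyOps Ks N.contract) (o + 1) ∧
      Ready N (⟨M.party, M.kraus o⟩ :: Ks) s := by
  obtain ⟨s₁, L, hr₁, hidx, hnum, htrav⟩ := runs_traverse N ⟨0, hn⟩ rfl (s₀ := s₀.present M u) (by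
    intro a ha
    rw [← hs₀.tree a ha]
    funext i j
    simp [Store.present, show a ≠ 5 by omega])
  have htree : ∀ a < 5, s₁.idx a = N.encode.idx a := by
    intro a ha
    rw [hidx a (by omega), ← hs₀.tree a ha]
    funext i j
    simp [Store.present, show a ≠ 5 by omega]
  have hι : Loaded N ⟨0, hn⟩ s₁.idx L := ⟨rfl, htree, htrav⟩
  have hparty : s₁.idx 5 0 0 = M.party := by
    rw [hidx 5 (by omega)]
    simp [Store.present]
  have hnum₁ : ∀ x, x ≠ 1 → x ≠ 2 → s₁.num x = s₀.num x := by
    intro x hx hx'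
    rw [hnum]
    funext i j k l
    simp [Store.present, hx, hx']
  have prepare : Triple s₁.idx 20 (· = s₁.num)
      (.seq (identityCmd d) (.seq (saveCmd d) (outcomeSums d q)))
      (fun y => Trying N Ks M u y ∧
        ∀ j ≤ q, y 12 j 0 0 0 = cumulative M (applyOps Ks N.contract) j)
      (14 * D ^ 2 + (13 * D ^ 2 + 230 * (q + 1) * (n * D ^ 6) + 1) + 1) := by
    refine (Triple.weaken (fun ι' _ => triple_identityCmd hD hdD) (by omega : 20 ≤ 30)).seq
      (Triple.of_eq fun y h => ?_)
    have hsave : Triple s₁.idx 20 (· = y) (saveCmd d)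
        (fun y' => (∀ a < d, ∀ b < d, y' 16 0 a b 0 = y 14 M.party a b 0) ∧
          ∀ x, x ≠ 16 → x ≠ 23 → y' x = y x) (13 * D ^ 2) := by
      refine Triple.weaken (k' := 30) (fun ι' hι' => ?_) (by omega)
      have := triple_saveCmd (ι := ι') (y₀ := y) hD hdD
      rwa [hι'.1 5 (by omega), hparty] at this
    refine hsave.seq (Triple.of_eq fun y' h' => triple_outcomeSums hι hD hdD hdim ?_ hparty)
    have heq : ∀ x, x ≠ 15 → x ≠ 16 → x ≠ 23 → y' x = s₁.num x := fun x h1 h2 h3 =>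
      (h'.2 x h2 h3).trans (h.2 x h1 h3)
    have h14 : ∀ l, OpsAt Ks l s₁.num := by
      unfold OpsAt
      rw [hnum₁ 14 (by omega) (by omega)]
      exact hs₀.ops
    constructor
    case tensors =>
      rw [heq 0 (by omega) (by omega) (by omega), hnum₁ 0 (by omega) (by omega), hs₀.tensors]
    case random =>
      rw [heq 2 (by omega) (by omega) (by omega), hnum]
      simp [Store.present]
    case kraus =>
      intro s a ha b hb
      rw [heq 1 (by omega) (by omega) (by omega), hnum]
      simp [Store.present, entry, ha, hb]
    case ident =>
      unfold HasId
      rw [h'.2 15 (by omega) (by omega)]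
      exact h.1
    case saved =>
      intro a ha b hb
      rw [h'.1 a ha b hb, h.2 14 (by omega) (by omega)]
      exact h14 M.party a ha b hb
    case ops =>
      intro l _
      unfold OpsAt
      rw [heq 14 (by omega) (by omega) (by omega)]
      exact h14 l
  obtain ⟨s₂, hr₂, hag₂, htry, hcum⟩ := prepare s₁ (Agree.refl _ _) rfl
  have hlast := cumulative_last M (applyOps Ks N.contract)
  obtain ⟨s₃, hr₃, hnum₃, hidx₃, hle, hlow, hup⟩ := runs_selectCmd (q := q) hcum htry.random (by
    rw [hlast]
    simpa [cumulative] using mul_nonneg hu.1 hpos.le)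
  rw [hlast] at hlow hup
  -- The value `q` would mean `‖φ‖² ≤ u ‖φ‖²`, impossible for `u < 1` and `‖φ‖ > 0`.
  have hlt : s₃.idx 7 0 0 < q := by
    refine lt_of_le_of_ne hle fun h => ?_
    rw [h, hlast] at hlow
    nlinarith [hu.2]
  have hparty₃ : s₃.idx 5 0 0 = M.party := by
    rw [hidx₃ 5 (by omega) (by omega), hag₂.1 5 (by omega), hparty]
  have finish : Triple s₃.idx 20 (· = s₃.num)
      (.letVar 20 (.var 7) (.letVar 21 (.var 5) (.seq (restoreCmd d) (applyCmd d))))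
      (fun y => Trying N Ks M u y ∧
        ∀ l, OpsAt (⟨M.party, M.kraus ⟨s₃.idx 7 0 0, hlt⟩⟩ :: Ks) l y) (51 * D ^ 3 + 2 + 2) := by
    refine Triple.letVar (by omega) rfl (Triple.letVar (by omega) rfl ?_)
    refine Triple.weaken (k' := 30) (fun ι' hι' => ?_) (by omega)
    have h20 : ι' 20 0 0 = s₃.idx 7 0 0 := hι'.2 20 (by omega)
    have h5 : ι' 5 0 0 = M.party := (hι'.2 5 (by omega)).trans hparty₃
    have h21 : ι' 21 0 0 = M.party := (hι'.2 21 (by omega)).trans hparty₃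
    exact (triple_tryOutcome hD hdD (hnum₃ ▸ htry) h5 h21 ⟨s₃.idx 7 0 0, hlt⟩ h20).conseq
      (fun _ h => h) fun y h => ⟨h.1, h.2.1⟩
  obtain ⟨s₄, hr₄, hag₄, htry₄, hops₄⟩ := finish s₃ (Agree.refl _ _) rfl
  refine ⟨s₄, ⟨s₃.idx 7 0 0, hlt⟩, (hr₁.seq (hr₂.seq (hr₃.seq hr₄))).mono ?_, ?_, hlow,
    hup _ le_rfl hlt, ?_, htry₄.tensors, hops₄⟩
  · have hm := T.card_vertices
    have hpow : 1 ≤ D ^ 6 := Nat.one_le_pow _ _ hD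
    have h3 : D ^ 3 ≤ D ^ 6 := Nat.pow_le_pow_right hD (by omega)
    have h2 : D ^ 2 ≤ D ^ 6 := Nat.pow_le_pow_right hD (by omega)
    have h4 : D ^ 6 ≤ n * D ^ 6 := Nat.le_mul_of_pos_left _ hn
    have h5 : n ≤ n * D ^ 6 := Nat.le_mul_of_pos_right _ hpow
    have h6 : n * D ^ 6 ≤ (q + 1) * (n * D ^ 6) := Nat.le_mul_of_pos_left _ (by omega)
    have h7 : q + 1 ≤ (q + 1) * (n * D ^ 6) := Nat.le_mul_of_pos_right _ (by omega)
    rw [mul_assoc 230, mul_assoc 500]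
    omega
  · rw [hag₄.1 7 (by omega)]
  · intro a ha
    rw [hag₄.1 a (by omega), hidx₃ a (by omega) (by omega), hag₂.1 a (by omega), htree a ha]

end

end MQC

/-! ### Distribution of the simulated outcomes. -/

namespace MQC

open MeasureTheory

variable {n d q : ℕ} {T : SubcubicTree n}

/-! ### Simulation of protocols -/

section Play

variable {S : Simulator} {s₀ : Store} {τ : ℕ} {Λ : Protocol n d q} {r : ℕ} {u : Fin (r + 1) → ℝ}
  {h : List (Fin q)} {s s' : Store}

theorem play_succ_of_none (hp : S.play s₀ τ Λ r (Fin.init u) = some (h, s)) (hΛ : Λ h = none) :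
    S.play s₀ τ Λ (r + 1) u = some (h, s) := by
  rw [Simulator.play, hp, Option.bind_some]
  simp only [hΛ]

theorem play_succ_of_some (hp : S.play s₀ τ Λ r (Fin.init u) = some (h, s))
    {M : LocalMeasurement n d q} (hΛ : Λ h = some M)
    (he : exec S.sampler τ (s.present M (u (Fin.last r))) = some s') {o : Fin q}
    (ho : s'.idx 7 0 0 = o) :
    S.play s₀ τ Λ (r + 1) u = some (o :: h, s') := by
  rw [Simulator.play, hp, Option.bind_some]
  simp only [hΛ, he, Option.bind_some]
  rw [dif_pos (by rw [ho]; exact o.2)]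
  simp [ho]

/-- A round adds at most one outcome. This excludes that a protocol which has stopped shows a
history as long as the number of rounds begun since. -/
theorem length_le_of_play : ∀ {r : ℕ} {u : Fin r → ℝ} {h : List (Fin q)} {s : Store},
    S.play s₀ τ Λ r u = some (h, s) → h.length ≤ r
  | 0, u, h, s, hp => by
    rw [Simulator.play] at hp
    obtain ⟨rfl, -⟩ := Prod.mk.inj (Option.some.inj hp)
    simp
  | r + 1, u, h, s, hp => by
    rw [Simulator.play] at hp
    obtain ⟨⟨h', s'⟩, hp', hq⟩ := Option.bind_eq_some_iff.1 hp
    have ih := length_le_of_play hp'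
    cases hΛ : Λ h' with
    | none =>
      simp only [hΛ] at hq
      obtain ⟨rfl, -⟩ := Prod.mk.inj (Option.some.inj hq)
      omega
    | some M =>
      simp only [hΛ] at hq
      obtain ⟨s'', -, hq⟩ := Option.bind_eq_some_iff.1 hq
      split_ifs at hq
      obtain ⟨rfl, -⟩ := Prod.mk.inj (Option.some.inj hq)
      simpa using ih

end Play

/-- Lebesgue measure on the cube of random numbers is a product, so the last number is independent
of the earlier ones; no measurability is needed for a rectangle. -/
theorem volume_init_last {r : ℕ} (A : Set (Fin r → ℝ)) (J : Set ℝ) :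
    volume {u : Fin (r + 1) → ℝ | Fin.init u ∈ A ∧ u (Fin.last r) ∈ J} =
      volume A * volume J := by
  have h := volume_preserving_piFinSuccAbove (fun _ : Fin (r + 1) => ℝ) (Fin.last r)
  have h1 : {u : Fin (r + 1) → ℝ | Fin.init u ∈ A ∧ u (Fin.last r) ∈ J} =
      (MeasurableEquiv.piFinSuccAbove (fun _ : Fin (r + 1) => ℝ) (Fin.last r)) ⁻¹' (J ×ˢ A) := by
    ext u
    have e : Fin.init u = (Fin.last r).removeNth u := by
      funext i
      simp [Fin.init, Fin.removeNth]
    rw [Set.mem_ofPred_eq, e]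
    exact and_comm
  rw [h1, h.measure_preimage_equiv, Measure.volume_eq_prod, Measure.prod_prod, mul_comm]

/-- The simulator. -/
def simulator (d q : ℕ) : Simulator := ⟨samplerCmd d q, evaluatorCmd d⟩

section

variable {N : TTN T d} {D τ : ℕ} {Λ : Protocol n d q}

theorem play_step (hn : 0 < n) (hD : 0 < D) (hdD : d ≤ D)
    (hdim : ∀ (v : T.Inner) w, T.graph.Adj v w → N.dim s(↑v, w) ≤ D)
    (hτ : 500 * (q + 1) * (n * D ^ 6) ≤ τ) {r : ℕ} {u : Fin (r + 1) → ℝ}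
    (hu : u (Fin.last r) ∈ Set.Ico (0 : ℝ) 1) {h : List (Fin q)} {s : Store}
    (hp : (simulator d q).play N.encode τ Λ r (Fin.init u) = some (h, s))
    {Ks : List (LocalOp n d)} (hs : Ready N Ks s) (hpos : 0 < (applyOps Ks N.contract).normSq)
    {M : LocalMeasurement n d q} (hΛ : Λ h = some M) :
    ∃ (o : Fin q) (s' : Store),
      (simulator d q).play N.encode τ Λ (r + 1) u = some (o :: h, s') ∧
      Ready N (⟨M.party, M.kraus o⟩ :: Ks) s' ∧
      cumulative M (applyOps Ks N.contract) o ≤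
        u (Fin.last r) * (applyOps Ks N.contract).normSq ∧
      u (Fin.last r) * (applyOps Ks N.contract).normSq <
        cumulative M (applyOps Ks N.contract) (o + 1) := by
  obtain ⟨s', o, hr, ho, h1, h2, h3⟩ := runs_samplerCmd (M := M) hn hD hdD hdim hs hu hpos
  exact ⟨o, s', play_succ_of_some hp hΛ (hr.exec hτ) ho, h3, h1, h2⟩

/-- The interval `[c_o, c_{o+1})` that contains the scaled random number is nonempty, and its length
is the squared norm after the outcome `o`. So the norm stays positive and the sampler never meets
the zero state. -/
theorem play_ready (hn : 0 < n) (hD : 0 < D) (hdD : d ≤ D)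
    (hdim : ∀ (v : T.Inner) w, T.graph.Adj v w → N.dim s(↑v, w) ≤ D)
    (hτ : 500 * (q + 1) * (n * D ^ 6) ≤ τ) (hnorm : N.contract.normSq = 1) :
    ∀ (r : ℕ) (u : Fin r → ℝ), (∀ t, u t ∈ Set.Ico (0 : ℝ) 1) → ∃ h s Ks,
      (simulator d q).play N.encode τ Λ r u = some (h, s) ∧ Λ.record h = some Ks ∧
      Ready N Ks s ∧ 0 < (applyOps Ks N.contract).normSq := by
  intro r
  induction r with
  | zero =>
    intro u _
    refine ⟨[], N.encode, [], rfl, rfl, ready_encode N, ?_⟩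
    rw [applyOps, hnorm]
    exact one_pos
  | succ r ih =>
    intro u hu
    obtain ⟨h, s, Ks, hp, hrec, hs, hpos⟩ := ih (Fin.init u) fun t => hu _
    cases hΛ : Λ h with
    | none => exact ⟨h, s, Ks, play_succ_of_none hp hΛ, hrec, hs, hpos⟩
    | some M =>
      obtain ⟨o, s', hp', hs', h1, h2⟩ := play_step hn hD hdD hdim hτ (hu _) hp hs hpos hΛ
      refine ⟨o :: h, s', _, hp', ?_, hs', ?_⟩
      · rw [Protocol.record, hrec, hΛ]
        rfl
      · have := cumulative_succ M (applyOps Ks N.contract) o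
        rw [applyOps]
        linarith

/-- Induction on the history: the set for `o :: h` is the set for `h` times the interval of length
`‖K_o φ‖² / ‖φ‖²`, and the volume for `h` is `‖φ‖²`. -/
theorem simulator_law (hn : 0 < n) (hD : 0 < D) (hdD : d ≤ D)
    (hdim : ∀ (v : T.Inner) w, T.graph.Adj v w → N.dim s(↑v, w) ≤ D)
    (hτ : 500 * (q + 1) * (n * D ^ 6) ≤ τ) (hnorm : N.contract.normSq = 1) (h : List (Fin q)) :
    volume {u : Fin h.length → ℝ | (∀ t, u t ∈ Set.Ico (0 : ℝ) 1) ∧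
      ∃ s, (simulator d q).play N.encode τ Λ h.length u = some (h, s)} =
      ENNReal.ofReal (Λ.born N.contract h) := by
  induction h with
  | nil =>
    have e : {u : Fin ([] : List (Fin q)).length → ℝ | (∀ t, u t ∈ Set.Ico (0 : ℝ) 1) ∧
      ∃ s, (simulator d q).play N.encode τ Λ ([] : List (Fin q)).length u = some ([], s)} =
        Set.univ := by
      refine Set.eq_univ_of_forall fun u => ⟨fun t => t.elim0, N.encode, rfl⟩
    rw [e]
    have hb : Λ.born N.contract [] = 1 := by
      simp [Protocol.born, Protocol.record, applyOps, hnorm]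
    rw [hb]
    simp [volume_pi]
  | cons o h ih =>
    set A := {u : Fin h.length → ℝ | (∀ t, u t ∈ Set.Ico (0 : ℝ) 1) ∧
      ∃ s, (simulator d q).play N.encode τ Λ h.length u = some (h, s)} with hA
    have hready : ∀ u ∈ A, ∃ s Ks, (simulator d q).play N.encode τ Λ h.length u = some (h, s) ∧
        Λ.record h = some Ks ∧ Ready N Ks s ∧ 0 < (applyOps Ks N.contract).normSq := by
      rintro u ⟨hu, s, hs⟩
      obtain ⟨h', s', Ks, hp, hrec⟩ := play_ready hn hD hdD hdim hτ hnorm (Λ := Λ) _ u hu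
      rw [hs] at hp
      obtain ⟨rfl, rfl⟩ := Prod.mk.inj (Option.some.inj hp)
      exact ⟨s, Ks, hs, hrec⟩
    have hcases : ∀ u : Fin (h.length + 1) → ℝ, (∀ t, u t ∈ Set.Ico (0 : ℝ) 1) →
        (∃ s, (simulator d q).play N.encode τ Λ (h.length + 1) u = some (o :: h, s)) →
        Fin.init u ∈ A ∧ ∃ M, Λ h = some M := by
      rintro u hu ⟨s, hs⟩
      obtain ⟨h', s', Ks, hp, hrec, hs', hpos⟩ :=
        play_ready hn hD hdD hdim hτ hnorm (Λ := Λ) _ (Fin.init u) fun t => hu _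
      cases hΛ : Λ h' with
      | none =>
        rw [play_succ_of_none hp hΛ] at hs
        obtain ⟨rfl, rfl⟩ := Prod.mk.inj (Option.some.inj hs)
        -- Had the protocol stopped, the history `o :: h` would have been produced in `h.length`
        -- rounds.
        have := length_le_of_play hp
        simp at this
      | some M =>
        obtain ⟨o', s'', hp', -⟩ := play_step hn hD hdD hdim hτ (hu _) hp hs' hpos hΛ
        rw [hp'] at hs
        obtain ⟨h1, -⟩ := Prod.mk.inj (Option.some.inj hs)
        obtain ⟨rfl, rfl⟩ := List.cons.inj h1
        exact ⟨⟨fun t => hu _, s', hp⟩, M, hΛ⟩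
    -- Covers the three degenerate cases: no record for `h`, a protocol that stops at `h`, and a
    -- history `h` of probability zero.
    have hempty : (∀ u ∈ A, ∀ M, Λ h = some M → False) →
        volume {u : Fin (o :: h).length → ℝ | (∀ t, u t ∈ Set.Ico (0 : ℝ) 1) ∧
        ∃ s, (simulator d q).play N.encode τ Λ (o :: h).length u = some (o :: h, s)} = 0 := by
      intro hfalse
      rw [show {u : Fin (o :: h).length → ℝ | (∀ t, u t ∈ Set.Ico (0 : ℝ) 1) ∧
        ∃ s, (simulator d q).play N.encode τ Λ (o :: h).length u = some (o :: h, s)} = ∅ from ?_,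
        measure_empty]
      refine Set.eq_empty_of_forall_notMem fun u hu => ?_
      obtain ⟨h1, M, h2⟩ := hcases u hu.1 hu.2
      exact hfalse _ h1 M h2
    cases hrec : Λ.record h with
    | none =>
      rw [hempty, Protocol.born, Protocol.record, hrec]
      · simp
      · intro u hu M _
        obtain ⟨s, Ks, -, hK, -⟩ := hready u hu
        rw [hrec] at hK
        cases hK
    | some Ks =>
      cases hΛ : Λ h with
      | none =>
        rw [hempty, Protocol.born, Protocol.record, hrec]
        · simp [hΛ]
        · intro u hu M hM
          rw [hΛ] at hM
          cases hM
      | some M =>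
        set φ := applyOps Ks N.contract with hφ
        have hbornh : Λ.born N.contract h = φ.normSq := by
          simp only [Protocol.born, hrec, hφ]
        have hborn : Λ.born N.contract (o :: h) =
            (LocalOp.apply ⟨M.party, M.kraus o⟩ φ).normSq := by
          have : Λ.record (o :: h) = some (⟨M.party, M.kraus o⟩ :: Ks) := by
            rw [Protocol.record, hrec, hΛ]
            rfl
          simp only [Protocol.born, this, hφ, applyOps]
        have hsucc := cumulative_succ M φ o
        have hlast := cumulative_last M φ
        have hmono := cumulative_mono M φ
        have hc0 : 0 ≤ cumulative M φ o := by
          have := hmono (Nat.zero_le o)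
          simpa [cumulative] using this
        have hc1 : cumulative M φ (o + 1) ≤ φ.normSq := by
          rw [← hlast]
          exact hmono o.2
        rw [hborn]
        rcases (State.normSq_nonneg φ).eq_or_lt with h0 | hpos
        -- The partial sums are monotone and end at `‖φ‖² = 0`, so Born's rule gives zero, and by
        -- `play_ready` this history is never played.
        · have hz : (LocalOp.apply ⟨M.party, M.kraus o⟩ φ).normSq = 0 := by
            have := State.normSq_nonneg (LocalOp.apply ⟨M.party, M.kraus o⟩ φ)
            linarith
          rw [hz, ENNReal.ofReal_zero]
          refine hempty fun u hu M _ => ?_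
          obtain ⟨s, Ks', -, hK, -, hp⟩ := hready u hu
          rw [hrec] at hK
          obtain rfl := Option.some.inj hK
          rw [← hφ] at hp
          linarith
        · have hset : {u : Fin (o :: h).length → ℝ | (∀ t, u t ∈ Set.Ico (0 : ℝ) 1) ∧
              ∃ s, (simulator d q).play N.encode τ Λ (o :: h).length u = some (o :: h, s)} =
              {u : Fin (h.length + 1) → ℝ | Fin.init u ∈ A ∧ u (Fin.last h.length) ∈
                Set.Ico (cumulative M φ o / φ.normSq) (cumulative M φ (o + 1) / φ.normSq)} := by
            ext u
            change Fin (h.length + 1) → ℝ at u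
            have hJ : u (Fin.last h.length) ∈
                Set.Ico (cumulative M φ o / φ.normSq) (cumulative M φ (o + 1) / φ.normSq) ↔
                cumulative M φ o ≤ u (Fin.last h.length) * φ.normSq ∧
                u (Fin.last h.length) * φ.normSq < cumulative M φ (o + 1) := by
              rw [Set.mem_Ico, div_le_iff₀ hpos, lt_div_iff₀ hpos]
            constructor
            · rintro ⟨hu, hs⟩
              obtain ⟨hA', -⟩ := hcases u hu hs
              refine ⟨hA', hJ.2 ?_⟩
              obtain ⟨s, Ks', hp, hK, hs', -⟩ := hready _ hA'
              rw [hrec] at hK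
              obtain rfl := Option.some.inj hK
              obtain ⟨o', s'', hp', -, h1, h2⟩ :=
                play_step hn hD hdD hdim hτ (hu (Fin.last h.length)) hp hs' hpos hΛ
              obtain ⟨s₁, hs₁⟩ := hs
              have hs₁ : (simulator d q).play N.encode τ Λ (h.length + 1) u =
                some (o :: h, s₁) := hs₁
              rw [hp'] at hs₁
              obtain ⟨h3, -⟩ := Prod.mk.inj (Option.some.inj hs₁)
              obtain ⟨rfl, -⟩ := List.cons.inj h3
              exact ⟨h1, h2⟩
            · rintro ⟨hA', hu⟩
              have hu' := hJ.1 hu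
              have hlastu : u (Fin.last h.length) ∈ Set.Ico (0 : ℝ) 1 := by
                refine ⟨le_trans (by positivity) hu.1, lt_of_lt_of_le hu.2 ?_⟩
                rw [div_le_one hpos]
                exact hc1
              have hall : ∀ t, u t ∈ Set.Ico (0 : ℝ) 1 := by
                intro t
                refine Fin.lastCases hlastu (fun t => ?_) t
                exact hA'.1 t
              obtain ⟨s, Ks', hp, hK, hs', -⟩ := hready _ hA'
              rw [hrec] at hK
              obtain rfl := Option.some.inj hK
              obtain ⟨o', s'', hp', -, h1, h2⟩ :=
                play_step hn hD hdD hdim hτ hlastu hp hs' hpos hΛ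
              -- The intervals of different outcomes are disjoint, since the partial sums are
              -- monotone.
              have hoo : o' = o := by
                rcases lt_trichotomy (o' : ℕ) o with h3 | h3 | h3
                · have := hmono (show (o' : ℕ) + 1 ≤ o by omega)
                  linarith [hu'.1]
                · exact Fin.ext h3
                · have := hmono (show (o : ℕ) + 1 ≤ o' by omega)
                  linarith [hu'.2]
              subst hoo
              exact ⟨hall, s'', hp'⟩
          rw [hset, volume_init_last, ih, hbornh, Real.volume_Ico,
            ← ENNReal.ofReal_mul (State.normSq_nonneg φ)]
          congr 1
          field_simp
          linarith

theorem simulator_simulates (hn : 0 < n) (hD : 0 < D) (hdD : d ≤ D)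
    (hdim : ∀ (v : T.Inner) w, T.graph.Adj v w → N.dim s(↑v, w) ≤ D)
    (hnorm : N.contract.normSq = 1) :
    (simulator d q).Simulates q N.encode N.contract (500 * (q + 1) * (n * D ^ 6)) where
  inTime Λ r u hu := by
    obtain ⟨h, s, Ks, hp, -⟩ := play_ready hn hD hdD hdim le_rfl hnorm (Λ := Λ) r u hu
    rw [hp]
    rfl
  law Λ h := simulator_law hn hD hdD hdim le_rfl hnorm h
  prob Ks hKs := by
    obtain ⟨s, hr, hs⟩ := runs_evaluatorCmd hn hD hdD hdim Ks hKs
    refine ⟨s, hr.exec ?_, hs⟩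
    rw [mul_assoc, mul_assoc]
    refine Nat.mul_le_mul (by omega) (Nat.le_mul_of_pos_left _ (by omega))

end

end MQC

/-! ### Interpolation of a state across its cuts. -/

namespace MQC

/-! ### Factorization of a matrix through some of its rows -/

/-- Choose rows that form a basis of the row space. A left inverse of the combination map yields the
coefficients of a row in this basis as linear functions of the row, that is, as combinations of the
columns of `M`; it is this form of the coefficients that lets the factorizations be nested along the
tree. -/
theorem exists_rows_factorization {A C : Type*} [Fintype A] [Fintype C] (M : Matrix A C ℂ) :
    ∃ (p : Fin M.rank → A) (W : C → Fin M.rank → ℂ),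
      ∀ a b, M a b = ∑ j, (∑ c, M a c * W c j) * M (p j) b := by
  classical
  obtain ⟨κ, p, hp, hspan, hli⟩ := exists_linearIndependent' ℂ M.row
  have : Finite κ := Finite.of_injective p hp
  have := Fintype.ofFinite κ
  have hcard : Fintype.card κ = M.rank := by
    rw [Matrix.rank_eq_finrank_span_row, ← hspan, finrank_span_eq_card hli]
  let e : Fin M.rank ≃ κ := (Fintype.equivFinOfCardEq hcard).symm
  have hli' : LinearIndependent ℂ (fun j => M.row (p (e j))) := hli.comp e e.injective
  let f : (Fin M.rank → ℂ) →ₗ[ℂ] (C → ℂ) := Fintype.linearCombination ℂ fun j => M.row (p (e j))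
  have hf : LinearMap.ker f = ⊥ := by
    rw [LinearMap.ker_eq_bot]
    exact hli'.fintypeLinearCombination_injective
  obtain ⟨g, hg⟩ := f.exists_leftInverse_of_injective hf
  refine ⟨fun j => p (e j), fun c j => g (Pi.single c 1) j, fun a b => ?_⟩
  have hmem : M.row a ∈ LinearMap.range f := by
    rw [Fintype.range_linearCombination]
    have : Set.range (fun j => M.row (p (e j))) = Set.range (M.row ∘ p) := by
      rw [← e.surjective.range_comp (M.row ∘ p)]
      rfl
    rw [this, hspan]
    exact Submodule.subset_span ⟨a, rfl⟩
  obtain ⟨c, hc⟩ := hmem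
  have hgc : g (M.row a) = c := by
    rw [← hc]
    exact LinearMap.congr_fun hg c
  have hW : ∀ j, ∑ c', M a c' * g (Pi.single c' 1) j = c j := fun j => by
    rw [← hgc]
    conv_rhs => rw [pi_eq_sum_univ' (M.row a), map_sum]
    simp [Finset.sum_apply, Matrix.row]
  simp only [hW]
  have := congrFun hc b
  rw [Fintype.linearCombination_apply] at this
  simpa [Matrix.row, Finset.sum_apply] using this.symm

/-! ### Cuts of a state -/

section Cuts

variable {n d : ℕ}

open Classical in
/-- The coefficients of `ψ` as a matrix, the parties in `S` being read off from the rows and the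
others from the columns. -/
noncomputable def cutMatrix (ψ : State n d) (S : Set (Fin n)) :
    Matrix (Fin n → Fin d) (Fin n → Fin d) ℂ :=
  fun z y => ψ (S.piecewise z y)

/-- `cutMatrix` repeats rows and columns of the Schmidt matrix: it is this matrix between two
zero-one matrices that restrict configurations to `S` and to its complement. -/
theorem rank_cutMatrix_le (ψ : State n d) (S : Set (Fin n)) :
    (cutMatrix ψ S).rank ≤ schmidtRank ψ S := by
  classical
  set M : Matrix (S → Fin d) ((Sᶜ : Set (Fin n)) → Fin d) ℂ := Matrix.of fun a b =>
    ψ fun l => if h : l ∈ S then a ⟨l, h⟩ else b ⟨l, h⟩ with hM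
  have hs : schmidtRank ψ S = M.rank := by
    rw [schmidtRank, hM]
  have h : cutMatrix ψ S = (Matrix.of fun (z : Fin n → Fin d) (a : S → Fin d) =>
      if (fun l : S => z l) = a then (1 : ℂ) else 0) * M *
      (Matrix.of fun (b : (Sᶜ : Set (Fin n)) → Fin d) (y : Fin n → Fin d) =>
        if (fun l : (Sᶜ : Set (Fin n)) => y l) = b then (1 : ℂ) else 0) := by
    ext z y
    simp only [Matrix.mul_apply, Matrix.of_apply, ite_mul, one_mul, zero_mul, Finset.sum_ite_eq,
      Finset.mem_univ, if_true, mul_ite, mul_one, mul_zero, cutMatrix, hM]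
    congr 1
  rw [hs, h]
  exact (Matrix.rank_mul_le_left _ _).trans (Matrix.rank_mul_le_right _ _)

open Classical in
/-- `F` is a combination of the columns of `cutMatrix ψ S`. -/
def InColumnSpan (ψ : State n d) (S : Set (Fin n)) (F : (Fin n → Fin d) → ℂ) : Prop :=
  ∃ W : (Fin n → Fin d) → ℂ, ∀ z, F z = ∑ y, ψ (S.piecewise z y) * W y

open Classical in
/-- `ψ` is reproduced from its values at the points `X j` of the parties in `S`, with coefficients
`B` that depend on these parties only. -/
structure Interpolates (ψ : State n d) (S : Set (Fin n)) (r : ℕ) (X : ℕ → Fin n → Fin d)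
    (B : (Fin n → Fin d) → ℕ → ℂ) : Prop where
  congr : ∀ z z', (∀ l ∈ S, z l = z' l) → B z = B z'
  eq_sum : ∀ z, ψ z = ∑ j ∈ Finset.range r, B z j * ψ (S.piecewise (X j) z)

theorem InColumnSpan.congr {ψ : State n d} {S : Set (Fin n)} {F : (Fin n → Fin d) → ℂ}
    (hF : InColumnSpan ψ S F) {z z' : Fin n → Fin d} (h : ∀ l ∈ S, z l = z' l) : F z = F z' := by
  classical
  obtain ⟨W, hW⟩ := hF
  rw [hW, hW]
  refine Finset.sum_congr rfl fun y _ => ?_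
  congr 2
  funext l
  by_cases hl : l ∈ S <;> simp [Set.piecewise, hl, h]

open Classical in
-- A column of the cut at `S'` is `ψ` with the parties outside `S'` fixed. The interpolation acts
-- inside `S ⊆ S'` with coefficients that do not see the fixed parties, so it passes to columns and
-- to their combinations.
theorem Interpolates.eq_sum_of_inColumnSpan {ψ : State n d} {S S' : Set (Fin n)} {r : ℕ}
    {X : ℕ → Fin n → Fin d} {B : (Fin n → Fin d) → ℕ → ℂ} (h : Interpolates ψ S r X B)
    (hS : S ⊆ S') {F : (Fin n → Fin d) → ℂ} (hF : InColumnSpan ψ S' F) (z : Fin n → Fin d) :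
    F z = ∑ j ∈ Finset.range r, B z j * F (S.piecewise (X j) z) := by
  obtain ⟨W, hW⟩ := hF
  simp only [hW, Finset.mul_sum]
  rw [Finset.sum_comm]
  refine Finset.sum_congr rfl fun y _ => ?_
  rw [h.eq_sum (S'.piecewise z y), Finset.sum_mul]
  refine Finset.sum_congr rfl fun j _ => ?_
  have e1 : B (S'.piecewise z y) = B z := h.congr _ _ fun l hl => by
    simp [Set.piecewise, hS hl]
  have e2 : S.piecewise (X j) (S'.piecewise z y) = S'.piecewise (S.piecewise (X j) z) y := by
    funext l
    by_cases hl : l ∈ S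
    · simp [Set.piecewise, hl, hS hl]
    · by_cases hl' : l ∈ S' <;> simp [Set.piecewise, hl, hl']
  rw [e1, e2, mul_assoc]

open Classical in
-- Interpolate first in `S₁`, then in `S₂`. As `F` depends on `S₁ ∪ S₂` only, the remaining parties
-- may be set to `x₀`, which makes the first factor independent of `z`: it becomes the tensor entry.
theorem Interpolates.eq_sum_sum {ψ : State n d} {S₁ S₂ S : Set (Fin n)} {r₁ r₂ : ℕ}
    {X₁ X₂ : ℕ → Fin n → Fin d} {B₁ B₂ : (Fin n → Fin d) → ℕ → ℂ}
    (h₁ : Interpolates ψ S₁ r₁ X₁ B₁) (h₂ : Interpolates ψ S₂ r₂ X₂ B₂)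
    (hS : S = S₁ ∪ S₂) (hdisj : Disjoint S₁ S₂) {F : (Fin n → Fin d) → ℂ}
    (hF : InColumnSpan ψ S F) (x₀ z : Fin n → Fin d) :
    F z = ∑ j ∈ Finset.range r₁, ∑ k ∈ Finset.range r₂,
      F (S₁.piecewise (X₁ j) (S₂.piecewise (X₂ k) x₀)) * (B₁ z j * B₂ z k) := by
  rw [h₁.eq_sum_of_inColumnSpan (hS ▸ Set.subset_union_left) hF z]
  refine Finset.sum_congr rfl fun j _ => ?_
  rw [h₂.eq_sum_of_inColumnSpan (hS ▸ Set.subset_union_right) hF, Finset.mul_sum]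
  refine Finset.sum_congr rfl fun k _ => ?_
  have hd : ∀ l ∈ S₂, l ∉ S₁ := fun l h2 h1 => Set.disjoint_left.1 hdisj h1 h2
  have e1 : B₂ (S₁.piecewise (X₁ j) z) = B₂ z := h₂.congr _ _ fun l hl => by
    simp [Set.piecewise, hd l hl]
  have e2 : F (S₂.piecewise (X₂ k) (S₁.piecewise (X₁ j) z)) =
      F (S₁.piecewise (X₁ j) (S₂.piecewise (X₂ k) x₀)) := hF.congr fun l hl => by
    by_cases h2 : l ∈ S₂
    · simp [Set.piecewise, h2, hd l h2]
    · have h1 : l ∈ S₁ := by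
        rw [hS] at hl
        exact hl.resolve_right h2
      simp [Set.piecewise, h1, h2]
  rw [e1, e2]
  ring

/-- The basis rows of the cut matrix are the interpolation points; the factorization is read at row
and column `z`, where the entry of the cut matrix is `ψ z` itself. -/
theorem exists_interpolates (ψ : State n d) (S : Set (Fin n)) (x₀ : Fin n → Fin d) :
    ∃ (X : ℕ → Fin n → Fin d) (B : (Fin n → Fin d) → ℕ → ℂ),
      Interpolates ψ S (cutMatrix ψ S).rank X B ∧ ∀ j, InColumnSpan ψ S fun z => B z j := by
  classical
  obtain ⟨p, W, h⟩ := exists_rows_factorization (cutMatrix ψ S)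
  generalize (cutMatrix ψ S).rank = r at p W h ⊢
  let W' : (Fin n → Fin d) → ℕ → ℂ := fun y j => if hj : j < r then W y ⟨j, hj⟩ else 0
  have hspan : ∀ j, InColumnSpan ψ S fun z => ∑ y, ψ (S.piecewise z y) * W' y j :=
    fun j => ⟨fun y => W' y j, fun z => rfl⟩
  refine ⟨fun j => if hj : j < r then p ⟨j, hj⟩ else x₀,
    fun z j => ∑ y, ψ (S.piecewise z y) * W' y j, ⟨fun z z' hz => ?_, fun z => ?_⟩, hspan⟩
  · funext j
    exact (hspan j).congr hz
  · have := h z z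
    simp only [cutMatrix] at this
    rw [Set.piecewise_same] at this
    rw [this, Finset.sum_range]
    refine Finset.sum_congr rfl fun j _ => ?_
    simp [W']

theorem interpolates_singleton (ψ : State n d) (l : Fin n) {X : ℕ → Fin n → Fin d}
    (hX : ∀ j : Fin d, X j l = j) :
    Interpolates ψ {l} d X fun z j => if (z l : ℕ) = j then 1 else 0 := by
  classical
  refine ⟨fun z z' h => ?_, fun z => ?_⟩
  · funext j
    rw [h l rfl]
  · rw [Finset.sum_eq_single (z l : ℕ)]
    · rw [if_pos rfl, one_mul]
      congr 1
      funext l'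
      by_cases h : l' = l
      · subst h
        simp [Set.piecewise, hX]
      · simp [Set.piecewise, h]
    · intro j _ hj
      rw [if_neg (Ne.symm hj), zero_mul]
    · intro h
      exact (h (Finset.mem_range.2 (z l).2)).elim

end Cuts

/-! ### The parties below a vertex -/

section Below

variable {V : Type*} {G : SimpleGraph V} {r : V}

/-- `Below G r u v`: the path from `u` to the root `r` passes through `v`. -/
def Below (G : SimpleGraph V) (r : V) : V → V → Prop :=
  Relation.ReflTransGen fun a b => a ≠ r ∧ parent G r a = b

/-- The descendants of `v` can be left only through the deleted edge: a step up from a proper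
descendant ends at a descendant, and so does every step down. -/
theorem reachable_deleteEdges_iff_below (hG : G.IsTree) {v : V} (hv : v ≠ r) (u : V) :
    (G.deleteEdges {s(v, parent G r v)}).Reachable v u ↔ Below G r u v := by
  constructor
  · intro h
    rw [SimpleGraph.reachable_iff_reflTransGen] at h
    induction h with
    | refl => exact .refl
    | @tail a b _ hab ih =>
      rw [SimpleGraph.deleteEdges_adj, Set.mem_singleton_iff] at hab
      rcases parent_adj_cases (r := r) hG hab.1 with ⟨h1, h2⟩ | ⟨h1, h2⟩
      · rcases Relation.ReflTransGen.cases_head ih with h | ⟨c, hc, hcv⟩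
        · subst h
          exact (hab.2 (by rw [h2])).elim
        · rwa [h2, hc.2]
      · exact .head ⟨h1, h2.symm⟩ ih
  · intro h
    induction h using Relation.ReflTransGen.head_induction_on with
    | refl => exact .refl _
    | @head a c hac _ ih =>
      by_cases hav : a = v
      · rw [hav]
      · refine ih.trans (SimpleGraph.Adj.reachable ?_)
        rw [SimpleGraph.deleteEdges_adj, Set.mem_singleton_iff, ← hac.2]
        refine ⟨(parent_adj hG hac.1).symm, fun h => hav ?_⟩
        exact edge_parent_inj hG hac.1 hv (by rw [← h, Sym2.eq_swap])

theorem Below.dist_le (hG : G.IsTree) {u v : V} (h : Below G r u v) : G.dist r v ≤ G.dist r u := by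
  induction h with
  | refl => rfl
  | tail _ h ih =>
    rw [← h.2]
    exact (dist_parent_lt hG h.1).le.trans ih

theorem below_iff {u v : V} :
    Below G r u v ↔ u = v ∨ ∃ c, c ≠ r ∧ parent G r c = v ∧ Below G r u c := by
  constructor
  · intro h
    rcases Relation.ReflTransGen.cases_tail h with h | ⟨c, h1, h2, h3⟩
    · exact .inl h.symm
    · exact .inr ⟨c, h2, h3, h1⟩
  · rintro (rfl | ⟨c, h1, h2, h3⟩)
    · exact .refl
    · exact h3.tail ⟨h1, h2⟩

/-- The vertices above `u` form a chain, and of two distinct children of `v` neither is below the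
other, by distance to the root. -/
theorem eq_of_below_of_below (hG : G.IsTree) {u v c c' : V} (hc : c ≠ r)
    (hcv : parent G r c = v) (hc' : c' ≠ r) (hcv' : parent G r c' = v) (h : Below G r u c)
    (h' : Below G r u c') : c = c' := by
  have key : ∀ {a b : V}, a ≠ r → parent G r a = v → b ≠ r → parent G r b = v →
      Below G r a b → a = b := by
    intro a b ha hav hb hbv hab
    rcases Relation.ReflTransGen.cases_head hab with h | ⟨w, hw, hwb⟩
    · exact h
    · have h1 := Below.dist_le hG hwb
      rw [← hw.2, hav, ← hbv] at h1
      exact absurd h1 (dist_parent_lt hG hb).not_ge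
  rcases Relation.ReflTransGen.total_of_right_unique
    (fun a b b' hb hb' => hb.2.symm.trans hb'.2) h h' with h | h
  · exact key hc hcv hc' hcv' h
  · exact (key hc' hcv' hc hcv h).symm

end Below

end MQC

/-! ### Existence of optimal trees and networks. -/

namespace MQC

/-! ### Existence of subcubic trees -/

/-- The graph on `Fin m` in which every vertex `v > 0` is joined to `f v < v`. -/
def predGraph (m : ℕ) (f : ℕ → ℕ) : SimpleGraph (Fin m) where
  Adj u v := (u ≠ v) ∧ ((v : ℕ) = f u ∨ (u : ℕ) = f v)
  symm := ⟨fun _ _ h => ⟨h.1.symm, h.2.symm⟩⟩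
  loopless := ⟨fun _ h => h.1 rfl⟩

/-- Following `f` leads every vertex to `0`, so the graph is connected; every edge joins some `v ≠
0` to `f v`, so there are at most `m - 1` edges. -/
theorem isTree_predGraph {m : ℕ} (hm : 0 < m) {f : ℕ → ℕ} (hf0 : f 0 = 0)
    (hf : ∀ v, 0 < v → f v < v) : (predGraph m f).IsTree := by
  classical
  have hle : ∀ v, f v ≤ v := fun v => by
    rcases Nat.eq_zero_or_pos v with rfl | h
    · rw [hf0]
    · exact (hf v h).le
  have hreach : ∀ v (hv : v < m), (predGraph m f).Reachable ⟨0, hm⟩ ⟨v, hv⟩ := by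
    intro v
    induction v using Nat.strong_induction_on with
    | _ v ih =>
      intro hv
      rcases Nat.eq_zero_or_pos v with rfl | h
      · exact .refl _
      · refine (ih _ (hf v h) ((hf v h).trans hv)).trans (SimpleGraph.Adj.reachable ?_)
        refine ⟨fun e => ?_, .inr rfl⟩
        have := Fin.mk.inj e
        have := hf v h
        omega
  have hconn : (predGraph m f).Connected := by
    have : Nonempty (Fin m) := ⟨⟨0, hm⟩⟩
    exact ⟨fun u v => (hreach u u.2).symm.trans (hreach v v.2)⟩
  rw [SimpleGraph.isTree_iff_connected_and_card]
  refine ⟨hconn, le_antisymm ?_ hconn.card_vert_le_card_edgeSet_add_one⟩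
  have hsub : (predGraph m f).edgeSet ⊆
      (fun v : Fin m => s(v, ⟨f v, (hle v).trans_lt v.2⟩)) '' {⟨0, hm⟩}ᶜ := by
    intro e he
    induction e with
    | _ u v =>
      obtain ⟨hne, h | h⟩ := he
      · refine ⟨u, fun hu => hne ?_, ?_⟩
        · rw [Set.mem_singleton_iff] at hu
          subst hu
          exact Fin.ext (by rw [h, hf0])
        · exact congrArg (s(u, ·)) (Fin.ext h.symm)
      · refine ⟨v, fun hu => hne ?_, ?_⟩
        · rw [Set.mem_singleton_iff] at hu
          subst hu
          exact Fin.ext (by rw [h, hf0])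
        · rw [Sym2.eq_swap (a := u)]
          exact congrArg (s(v, ·)) (Fin.ext h.symm)
  have h1 := (Set.ncard_le_ncard hsub (Set.toFinite _)).trans (Set.ncard_image_le (Set.toFinite _))
  rw [Set.ncard_compl, Set.ncard_singleton] at h1
  rw [Nat.card_coe_set_eq]
  simp only [Nat.card_eq_fintype_card, Fintype.card_fin] at h1 ⊢
  omega

/-- The parent function of a caterpillar: the odd numbers form its spine. -/
def spinePred (v : ℕ) : ℕ := v - 1 - v % 2

/-- The spine is `1, 3, …, 2n - 3`. An even vertex `v > 0` hangs on `v - 1`, and `0` is joined to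
`1`. Hence the leaves are the `n - 1` even vertices and the end `2n - 3` of the spine. -/
theorem ncard_neighborSet_spine {n : ℕ} (hn : 3 ≤ n) (v : Fin (2 * n - 2)) :
    ((predGraph (2 * n - 2) spinePred).neighborSet v).ncard =
      if (v : ℕ) % 2 = 0 ∨ (v : ℕ) = 2 * n - 3 then 1 else 3 := by
  have hv := v.2
  split_ifs with h
  · rw [Set.ncard_eq_one]
    refine ⟨⟨if (v : ℕ) = 0 then 1 else spinePred v, by unfold spinePred; split_ifs <;> omega⟩, ?_⟩
    ext w
    have hw := w.2
    simp only [SimpleGraph.mem_neighborSet, predGraph, Set.mem_singleton_iff, Fin.ext_iff, ne_eq,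
      spinePred]
    split_ifs with h0 <;> omega
  · rw [Set.ncard_eq_three]
    refine ⟨⟨spinePred v, by unfold spinePred; omega⟩, ⟨v + 1, by omega⟩, ⟨v + 2, by omega⟩,
      ?_, ?_, ?_, ?_⟩
    · simp only [ne_eq, Fin.ext_iff, spinePred]
      omega
    · simp only [ne_eq, Fin.ext_iff, spinePred]
      omega
    · simp only [ne_eq, Fin.ext_iff]
      omega
    · ext w
      have hw := w.2
      simp only [SimpleGraph.mem_neighborSet, predGraph, Set.mem_singleton_iff, Fin.ext_iff, ne_eq,
        spinePred, Set.mem_insert_iff]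
      omega

theorem nonempty_subcubicTree {n : ℕ} (hn : 3 ≤ n) : Nonempty (SubcubicTree n) := by
  have hcard := ncard_neighborSet_spine hn
  refine ⟨⟨2 * n - 2, predGraph (2 * n - 2) spinePred,
    isTree_predGraph (by omega) rfl (fun v hv => by unfold spinePred; omega), fun v => ?_,
    Equiv.ofBijective (fun l => ⟨⟨if (l : ℕ) = n - 1 then 2 * n - 3 else 2 * l,
      by split_ifs <;> omega⟩, ?_⟩) ⟨fun l l' h => ?_, fun v => ?_⟩⟩⟩
  · rw [hcard]
    split_ifs <;> simp
  · rw [hcard, if_pos]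
    dsimp only
    split_ifs <;> omega
  · have := congrArg (fun w => ((w : Fin (2 * n - 2)) : ℕ)) (Subtype.mk.inj h)
    dsimp only at this
    ext
    split_ifs at this <;> omega
  · obtain ⟨v, hv⟩ := v
    have hlt := v.2
    have hv' := hv
    rw [hcard] at hv'
    have h : (v : ℕ) % 2 = 0 ∨ (v : ℕ) = 2 * n - 3 := by
      by_contra h
      rw [if_neg h] at hv'
      omega
    by_cases h' : (v : ℕ) = 2 * n - 3
    · refine ⟨⟨n - 1, by omega⟩, Subtype.ext (Fin.ext ?_)⟩
      simp [h']
    · refine ⟨⟨v / 2, by omega⟩, Subtype.ext (Fin.ext ?_)⟩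
      dsimp only
      rw [if_neg (by omega)]
      omega

/-! ### The minimum in the Schmidt-rank width -/

section Width

variable {n d : ℕ}

theorem SubcubicTree.nonempty_dart (T : SubcubicTree n) (hn : 0 < n) : Nonempty T.graph.Dart :=
  ⟨⟨(_, _), T.adj_leaf_nbr ⟨0, hn⟩⟩⟩

theorem SubcubicTree.finite_dart (T : SubcubicTree n) : Finite T.graph.Dart :=
  Finite.of_injective _ SimpleGraph.Dart.toProd_injective

/-- Each width is the logarithm of the Schmidt rank for one of finitely many sets of parties, so the
infimum over all trees runs over a finite set of values and is attained. -/
theorem exists_width_eq_chiWidth (hn : 3 ≤ n) (ψ : State n d) :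
    ∃ T : SubcubicTree n, T.width ψ = chiWidth ψ := by
  have := nonempty_subcubicTree hn
  have hfin : (Set.range fun T : SubcubicTree n => T.width ψ).Finite := by
    refine (Set.finite_range fun A : Set (Fin n) => Real.logb 2 (schmidtRank ψ A)).subset ?_
    rintro _ ⟨T, rfl⟩
    have := T.nonempty_dart (by omega)
    have := T.finite_dart
    obtain ⟨e, he⟩ := exists_eq_ciSup_of_finite
      (f := fun e : T.graph.Dart => Real.logb 2 (schmidtRank ψ (T.side e.fst e.snd)))
    exact ⟨_, he⟩
  exact (Set.range_nonempty _).csInf_mem hfin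

theorem logb_schmidtRank_nonneg (ψ : State n d) (A : Set (Fin n)) :
    0 ≤ Real.logb 2 (schmidtRank ψ A) := by
  rcases Nat.eq_zero_or_pos (schmidtRank ψ A) with h | h
  · simp [h]
  · exact Real.logb_nonneg one_lt_two (by exact_mod_cast h)

theorem chiWidth_nonneg (ψ : State n d) : 0 ≤ chiWidth ψ :=
  Real.iInf_nonneg fun _ => Real.iSup_nonneg fun _ => logb_schmidtRank_nonneg ψ _

theorem SubcubicTree.schmidtRank_le (T : SubcubicTree n) (ψ : State n d) {v w : Fin T.m}
    (h : T.graph.Adj v w) : (schmidtRank ψ (T.side v w) : ℝ) ≤ (2 : ℝ) ^ T.width ψ := by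
  have := T.finite_dart
  rcases Nat.eq_zero_or_pos (schmidtRank ψ (T.side v w)) with h0 | h0
  · rw [h0, Nat.cast_zero]
    positivity
  · rw [← Real.logb_le_iff_le_rpow one_lt_two (by exact_mod_cast h0)]
    exact le_ciSup (f := fun e : T.graph.Dart => Real.logb 2 (schmidtRank ψ (T.side e.fst e.snd)))
      (Set.finite_range _).bddAbove ⟨(v, w), h⟩

end Width

/-! ### Existence of optimal networks -/

namespace SubcubicTree

variable {n d : ℕ} (T : SubcubicTree n)

theorem mem_side_parent {l₀ : Fin n} {v : Fin T.m} (hv : v ≠ T.leaf l₀) (l : Fin n) :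
    l ∈ T.side v (parent T.graph (T.leaf l₀) v) ↔ Below T.graph (T.leaf l₀) (T.leaf l) v :=
  reachable_deleteEdges_iff_below T.isTree hv _

theorem parent_leaf {l₀ l : Fin n} (hl : l ≠ l₀) {w : Fin T.m} (h : T.graph.Adj (T.leaf l) w) :
    w = parent T.graph (T.leaf l₀) (T.leaf l) := by
  have h' := parent_adj (r := (T.leaf l₀ : Fin T.m)) T.isTree
    (fun e => hl (T.leaf_injective e) : (T.leaf l : Fin T.m) ≠ T.leaf l₀)
  rw [T.adj_leaf h, T.adj_leaf h']

theorem below_leaf {l₀ l : Fin n} (hl : l ≠ l₀) {u : Fin T.m}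
    (h : Below T.graph (T.leaf l₀) u (T.leaf l)) : u = T.leaf l := by
  rcases below_iff.1 h with h | ⟨c, hc, hcl, -⟩
  · exact h
  · have h1 := parent_adj T.isTree hc
    rw [hcl] at h1
    exact (parent_ne_of_child T.isTree (fun e => hl (T.leaf_injective e)) hc hcl
      (T.parent_leaf hl h1.symm)).elim

theorem side_leaf {l₀ l : Fin n} (hl : l ≠ l₀) :
    T.side (T.leaf l) (parent T.graph (T.leaf l₀) (T.leaf l)) = {l} := by
  ext l'
  rw [T.mem_side_parent fun e => hl (T.leaf_injective e), Set.mem_singleton_iff]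
  constructor
  · exact fun h => T.leaf_injective (T.below_leaf hl h)
  · rintro rfl
    exact .refl

/-- The root is a leaf, so every ascent to it passes through its only neighbour. -/
theorem below_root_child (l₀ : Fin n) {u : Fin T.m} (hu : u ≠ T.leaf l₀) :
    Below T.graph (T.leaf l₀) u (T.nbr (T.leaf l₀) 0) := by
  induction h : T.graph.dist (T.leaf l₀ : Fin T.m) u using Nat.strong_induction_on generalizing u
    with
  | _ k ih =>
    have hadj := parent_adj T.isTree hu
    by_cases hp : parent T.graph (T.leaf l₀ : Fin T.m) u = T.leaf l₀
    · rw [hp] at hadj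
      rw [T.adj_leaf hadj.symm]
      exact .refl
    · exact .head ⟨hu, rfl⟩ (ih _ (h ▸ dist_parent_lt T.isTree hu) hp rfl)

theorem nbr_leaf_ne (l : Fin n) : T.nbr (T.leaf l) 0 ≠ T.leaf l := (T.adj_leaf_nbr l).ne'

theorem parent_nbr_leaf (l : Fin n) :
    parent T.graph (T.leaf l : Fin T.m) (T.nbr (T.leaf l) 0) = T.leaf l :=
  (parent_eq_of_adj_of_ne T.isTree (T.adj_leaf_nbr l) fun h => (h rfl).elim).2

theorem side_root_child (l₀ : Fin n) :
    T.side (T.nbr (T.leaf l₀) 0) (parent T.graph (T.leaf l₀) (T.nbr (T.leaf l₀) 0)) = {l₀}ᶜ := by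
  ext l
  rw [T.mem_side_parent (T.nbr_leaf_ne l₀), Set.mem_compl_iff, Set.mem_singleton_iff]
  constructor
  · rintro h rfl
    rcases Relation.ReflTransGen.cases_head h with h | ⟨c, h, -⟩
    · exact T.nbr_leaf_ne l h.symm
    · exact h.1 rfl
  · exact fun h => T.below_root_child l₀ fun e => h (T.leaf_injective e)

/-- All parties other than `l₀` lie below the neighbour of the root, while below a leaf there is
just one; a third party gives the contradiction. -/
theorem nbr_leaf_ne_leaf (hn : 3 ≤ n) (l₀ l : Fin n) : T.nbr (T.leaf l₀) 0 ≠ T.leaf l := by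
  intro h
  have hl : l ≠ l₀ := by
    rintro rfl
    exact T.nbr_leaf_ne l h
  obtain ⟨l', h1, h2⟩ : ∃ l' : Fin n, l' ≠ l₀ ∧ l' ≠ l := by
    have : ({l₀, l} : Finset (Fin n)).card < Fintype.card (Fin n) := by
      rw [Fintype.card_fin]
      exact (Finset.card_le_two).trans_lt (by omega)
    obtain ⟨l', hl'⟩ := Finset.exists_mem_notMem_of_card_lt_card
      (s := {l₀, l}) (t := Finset.univ) (by simpa using this)
    simp only [Finset.mem_insert, Finset.mem_singleton, not_or] at hl'
    exact ⟨l', hl'.2⟩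
  have := T.below_root_child l₀ (u := T.leaf l') fun e => h1 (T.leaf_injective e)
  rw [h] at this
  exact h2 (T.leaf_injective (T.below_leaf hl this))

/-- An inner vertex has two children, and the parties below it are those below its children. -/
theorem exists_children (l₀ : Fin n) (v : T.Inner) :
    ∃ c₁ c₂ : Fin T.m, c₁ ≠ c₂ ∧ T.graph.Adj v c₁ ∧ T.graph.Adj v c₂ ∧
      c₁ ≠ parent T.graph (T.leaf l₀) v ∧ c₂ ≠ parent T.graph (T.leaf l₀) v ∧
      T.side v (parent T.graph (T.leaf l₀) v) =
        T.side c₁ (parent T.graph (T.leaf l₀) c₁) ∪ T.side c₂ (parent T.graph (T.leaf l₀) c₂) ∧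
      Disjoint (T.side c₁ (parent T.graph (T.leaf l₀) c₁))
        (T.side c₂ (parent T.graph (T.leaf l₀) c₂)) := by
  have hG := T.isTree
  set r : Fin T.m := (T.leaf l₀ : Fin T.m) with hr
  have hvr : (v : Fin T.m) ≠ r := T.inner_ne_leaf v l₀
  have hpadj := parent_adj hG hvr
  have h2 : ((T.graph.neighborSet v) \ {parent T.graph r v}).ncard = 2 := by
    rw [Set.ncard_sdiff_singleton_of_mem ((T.graph.mem_neighborSet _ _).2 hpadj), v.2]
  obtain ⟨c₁, c₂, hne, hc⟩ := Set.ncard_eq_two.1 h2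
  have hc₁ : T.graph.Adj v c₁ ∧ c₁ ≠ parent T.graph r v := by
    have : c₁ ∈ ((T.graph.neighborSet v) \ {parent T.graph r v}) := by simp [hc]
    exact this
  have hc₂ : T.graph.Adj v c₂ ∧ c₂ ≠ parent T.graph r v := by
    have : c₂ ∈ ((T.graph.neighborSet v) \ {parent T.graph r v}) := by simp [hc]
    exact this
  obtain ⟨hr₁, hp₁⟩ := parent_eq_of_adj_of_ne (r := r) hG hc₁.1 fun _ => hc₁.2
  obtain ⟨hr₂, hp₂⟩ := parent_eq_of_adj_of_ne (r := r) hG hc₂.1 fun _ => hc₂.2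
  refine ⟨c₁, c₂, hne, hc₁.1, hc₂.1, hc₁.2, hc₂.2, ?_, ?_⟩
  · ext l
    rw [Set.mem_union, T.mem_side_parent hvr, T.mem_side_parent hr₁, T.mem_side_parent hr₂,
      below_iff]
    constructor
    · rintro (h | ⟨c, hcr, hcv, h⟩)
      · exact (T.inner_ne_leaf v l h.symm).elim
      · have : c ∈ ((T.graph.neighborSet v) \ {parent T.graph r v}) :=
          ⟨by simpa [hcv] using (parent_adj hG hcr).symm,
            parent_ne_of_child hG hvr hcr hcv⟩
        rw [hc] at this
        rcases this with rfl | rfl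
        · exact .inl h
        · exact .inr h
    · rintro (h | h)
      · exact .inr ⟨c₁, hr₁, hp₁, h⟩
      · exact .inr ⟨c₂, hr₂, hp₂, h⟩
  · rw [Set.disjoint_left]
    intro l h1 h2
    rw [T.mem_side_parent hr₁] at h1
    rw [T.mem_side_parent hr₂] at h2
    exact hne (eq_of_below_of_below hG hr₁ hp₁ hr₂ hp₂ h1 h2)

/-- The data from which the tensors of a network are built. -/
theorem exists_vertex_interpolation (hn : 3 ≤ n) (l₀ : Fin n) (ψ : State n d) (x₀ : Fin n → Fin d)
    (v : Fin T.m) :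
    ∃ (r : ℕ) (X : ℕ → Fin n → Fin d) (B : (Fin n → Fin d) → ℕ → ℂ),
      (∀ l, l ≠ l₀ → v = T.leaf l → r = d ∧ ∀ z j, B z j = if (z l : ℕ) = j then 1 else 0) ∧
      (v = T.nbr (T.leaf l₀) 0 → r = d ∧ ∀ z, B z (z l₀) = ψ z) ∧
      (v ≠ T.leaf l₀ → v ≠ T.nbr (T.leaf l₀) 0 →
        Interpolates ψ (T.side v (parent T.graph (T.leaf l₀) v)) r X B) ∧
      ((∀ l, v ≠ T.leaf l) →
        ∀ j, InColumnSpan ψ (T.side v (parent T.graph (T.leaf l₀) v)) fun z => B z j) ∧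
      ((∀ l, v ≠ T.leaf l) → v ≠ T.nbr (T.leaf l₀) 0 →
        r ≤ schmidtRank ψ (T.side v (parent T.graph (T.leaf l₀) v))) := by
  classical
  -- Every party gets the value `j`; `x₀` only serves for `j ≥ d`.
  let fill : ℕ → Fin n → Fin d := fun j l => if h : j < d then ⟨j, h⟩ else x₀ l
  -- The edge above this vertex is the open edge of `l₀`, so its index has to be the value of `l₀`
  -- itself, and the coefficients are those of `ψ` with this value inserted.
  by_cases hroot : v = T.nbr (T.leaf l₀) 0
  · subst hroot
    have hleaf := T.nbr_leaf_ne_leaf hn l₀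
    refine ⟨d, fill, fun z j => ψ (Set.piecewise {l₀}ᶜ z (fill j)), fun l _ h => (hleaf l h).elim,
      fun _ => ⟨rfl, fun z => ?_⟩, fun _ h => (h rfl).elim, fun _ j => ?_, fun _ h => (h rfl).elim⟩
    · dsimp only
      congr 1
      funext l
      by_cases hl : l = l₀
      · subst hl
        simp [Set.piecewise, fill]
      · simp [Set.piecewise, hl]
    · rw [T.side_root_child]
      refine ⟨fun y => if y = fill j then 1 else 0, fun z => ?_⟩
      simp
  by_cases hleaf : ∃ l, v = T.leaf l
  · obtain ⟨l, rfl⟩ := hleaf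
    refine ⟨d, fill, fun z j => if (z l : ℕ) = j then 1 else 0, fun l' _ h => ?_,
      fun h => (hroot h).elim, fun h _ => ?_, fun h => (h l rfl).elim, fun h => (h l rfl).elim⟩
    · rw [T.leaf_injective h]
      exact ⟨rfl, fun _ _ => rfl⟩
    · rw [T.side_leaf fun e => h (by rw [e])]
      exact interpolates_singleton ψ l fun j => by simp [fill]
  -- At the remaining vertices the dimension is the rank of the cut, which gives the bound on the
  -- summed indices.
  · push Not at hleaf
    obtain ⟨X, B, h, hspan⟩ :=
      exists_interpolates ψ (T.side v (parent T.graph (T.leaf l₀) v)) x₀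
    exact ⟨_, X, B, fun l _ h => (hleaf l h).elim, fun h => (hroot h).elim, fun _ _ => h,
      fun _ => hspan, fun _ _ => rank_cutMatrix_le ψ _⟩

/-- The messages of the network at input `x` are the coefficients `B v x`. `Interpolates.eq_sum_sum`
is the message equation at an inner vertex, and next to the root the message is `ψ x`. -/
theorem exists_ttn (hn : 3 ≤ n) (ψ : State n d) (x₀ : Fin n → Fin d) :
    ∃ N : TTN T d, N.contract = ψ ∧
      ∀ v w : T.Inner, T.graph.Adj v w → ∃ a b : Fin T.m, T.graph.Adj a b ∧
        N.dim s(↑v, ↑w) ≤ schmidtRank ψ (T.side a b) := by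
  classical
  have hG := T.isTree
  let l₀ : Fin n := ⟨0, by omega⟩
  set r : Fin T.m := (T.leaf l₀ : Fin T.m) with hr
  choose dim X B hleaf hroot hint hspan hdim using T.exists_vertex_interpolation hn l₀ ψ x₀
  choose c₁ c₂ hne hadj₁ hadj₂ hpar₁ hpar₂ hunion hdisj using T.exists_children l₀
  have hchild : ∀ (v : T.Inner) {c : Fin T.m}, T.graph.Adj v c → c ≠ parent T.graph r v →
      c ≠ r ∧ parent T.graph r c = v ∧ c ≠ T.nbr r 0 := by
    intro v c hvc hc
    obtain ⟨h1, h2⟩ := parent_eq_of_adj_of_ne (r := r) hG hvc fun _ => hc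
    refine ⟨h1, h2, ?_⟩
    rintro rfl
    rw [T.parent_nbr_leaf l₀] at h2
    exact T.inner_ne_leaf v l₀ h2.symm
  let N : TTN T d :=
    { dim := fun e => dim (lowerEnd T.graph r e)
      dim_open := fun l w h => by
        by_cases hl : l = l₀
        · subst hl
          have hw := T.adj_leaf h
          have := T.nbr_leaf_ne l₀
          rw [lowerEnd_child hG (hw ▸ this) (hw ▸ T.parent_nbr_leaf l₀)]
          exact (hroot w hw).1
        · rw [T.parent_leaf hl h, lowerEnd_parent hG fun e => hl (T.leaf_injective e)]
          exact (hleaf _ l hl rfl).1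
      -- The coefficient with the index of the parent edge, at the configuration glued from the
      -- points chosen by the indices of the two children.
      tensor := fun v g =>
        B v ((T.side (c₁ v) (parent T.graph r (c₁ v))).piecewise (X (c₁ v) (g ⟨c₁ v, hadj₁ v⟩))
          ((T.side (c₂ v) (parent T.graph r (c₂ v))).piecewise (X (c₂ v) (g ⟨c₂ v, hadj₂ v⟩)) x₀))
          (g ⟨parent T.graph r v, parent_adj hG (T.inner_ne_leaf v l₀)⟩) }
  refine ⟨N, ?_, fun v w h => ?_⟩
  · funext x
    -- Writing the coefficient as an overlap with point masses at the leaves brings it into the form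
    -- of `sum_edges_eq_message`.
    have h1 : N.contract x =
        ∑ y, N.contract y * ∏ l, if (y l : ℕ) = x l then (1 : ℂ) else 0 := by
      rw [Finset.sum_eq_single x]
      · simp
      · intro y _ hy
        obtain ⟨l, hl⟩ := Function.ne_iff.1 hy
        rw [Finset.prod_eq_zero (Finset.mem_univ l), mul_zero]
        exact if_neg fun h => hl (Fin.ext h)
      · simp
    rw [h1, N.sum_contract_mul fun y => ∏ l, if y l = x l then (1 : ℂ) else 0,
      T.sum_edges_eq_message l₀ (fun e => Finset.range (N.dim e)) N.tensor
        (fun l i => if i = x l then 1 else 0) (fun v i => B v x i)]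
    · rw [N.dim_leafEdge, Finset.sum_eq_single (x l₀ : ℕ)]
      · rw [if_pos rfl, one_mul]
        exact (hroot _ rfl).2 x
      · intro i _ hi
        rw [if_neg hi, zero_mul]
      · intro h
        exact (h (Finset.mem_range.2 (x l₀).2)).elim
    · intro l hl i _
      rw [(hleaf _ l hl rfl).2]
      simp only [eq_comm]
    · intro v
      refine ⟨c₁ v, c₂ v, hne v, hpar₁ v, hpar₂ v, hadj₁ v, hadj₂ v, fun i _ => ?_⟩
      obtain ⟨a1, a2, a3⟩ := hchild v (hadj₁ v) (hpar₁ v)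
      obtain ⟨b1, b2, b3⟩ := hchild v (hadj₂ v) (hpar₂ v)
      have e1 : N.dim s(↑v, c₁ v) = dim (c₁ v) :=
        congrArg dim (lowerEnd_child hG a1 a2)
      have e2 : N.dim s(↑v, c₂ v) = dim (c₂ v) :=
        congrArg dim (lowerEnd_child hG b1 b2)
      rw [e1, e2, Interpolates.eq_sum_sum (hint _ a1 a3) (hint _ b1 b3) (hunion v) (hdisj v)
        (hspan v (fun l => T.inner_ne_leaf v l) i) x₀ x]
      refine Finset.sum_congr rfl fun j _ => Finset.sum_congr rfl fun k _ => ?_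
      have p₁ : parent T.graph r v ≠ c₁ v := (hpar₁ v).symm
      have p₂ : parent T.graph r v ≠ c₂ v := (hpar₂ v).symm
      simp only [N, if_true, if_neg (hne v).symm, if_neg p₁, if_neg p₂]
      rfl
  -- An edge between inner vertices is not the edge at the root, so its dimension is the rank of a
  -- cut of the tree.
  · have key : ∀ a b : T.Inner, (a : Fin T.m) ≠ r → (b : Fin T.m) = parent T.graph r a →
        N.dim s(↑a, ↑b) ≤ schmidtRank ψ (T.side a b) := by
      intro a b ha hb
      have : N.dim s(↑a, ↑b) = dim a := by
        rw [hb]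
        exact congrArg dim (lowerEnd_parent hG ha)
      rw [this, hb]
      refine hdim a (fun l => T.inner_ne_leaf a l) fun h => ?_
      rw [h, T.parent_nbr_leaf] at hb
      exact T.inner_ne_leaf b l₀ hb
    rcases parent_adj_cases (r := r) hG h with ⟨h1, h2⟩ | ⟨h1, h2⟩
    · exact ⟨v, w, h, key v w h1 h2⟩
    · refine ⟨w, v, h.symm, ?_⟩
      rw [Sym2.eq_swap]
      exact key w v h1 h2

end SubcubicTree

theorem exists_isOptimalFor {n d : ℕ} (hn : 3 ≤ n) (ψ : State n d) (x₀ : Fin n → Fin d) :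
    ∃ (T : SubcubicTree n) (N : TTN T d), N.IsOptimalFor ψ := by
  obtain ⟨T, hT⟩ := exists_width_eq_chiWidth hn ψ
  obtain ⟨N, hN, hdim⟩ := T.exists_ttn hn ψ x₀
  refine ⟨T, N, hT, hN, fun v w h => ?_⟩
  obtain ⟨a, b, hab, hle⟩ := hdim v w h
  rw [← hT]
  exact (Nat.cast_le.2 hle).trans (T.schmidtRank_le ψ hab)

end MQC

/-! ### Time bounds in terms of the width. -/

namespace MQC

/-! ### Running time -/

section RunningTime

variable {n d : ℕ}

theorem State.exists_index {ψ : State n d} (hψ : ψ.normSq = 1) : Nonempty (Fin n → Fin d) := by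
  by_contra h
  rw [not_nonempty_iff] at h
  simp [State.normSq] at hψ

theorem pos_of_normSq_eq_one (hn : 0 < n) {ψ : State n d} (hψ : ψ.normSq = 1) : 0 < d := by
  obtain ⟨x⟩ := State.exists_index hψ
  exact (Nat.zero_le _).trans_lt (x ⟨0, hn⟩).2

/-- The time for one call of the simulator in terms of the Schmidt-rank width. -/
theorem TTN.IsOptimalFor.simulates {T : SubcubicTree n} {N : TTN T d} {ψ : State n d} (q : ℕ)
    (h : N.IsOptimalFor ψ) (hn : 0 < n) (hψ : ψ.normSq = 1) :
    ∃ τ : ℕ, (τ : ℝ) ≤ 500 * (q + 1) * d ^ 6 * n * ((2 : ℝ) ^ chiWidth ψ) ^ 6 ∧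
      (simulator d q).Simulates q N.encode ψ τ := by
  have hd : 0 < d := pos_of_normSq_eq_one hn hψ
  have hR : (1 : ℝ) ≤ (2 : ℝ) ^ chiWidth ψ := Real.one_le_rpow one_le_two (chiWidth_nonneg ψ)
  have hR' : 1 ≤ ⌊(2 : ℝ) ^ chiWidth ψ⌋₊ := Nat.le_floor (by simpa using hR)
  -- `D = d * R` bounds the dimension `d` of the open edges and the dimensions of the summed ones,
  -- since both factors are at least `1`.
  set R := ⌊(2 : ℝ) ^ chiWidth ψ⌋₊ with hRdef
  have hdD : d ≤ d * R := Nat.le_mul_of_pos_right d hR'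
  have hRD : R ≤ d * R := Nat.le_mul_of_pos_left R hd
  have hdim : ∀ (v : T.Inner) w, T.graph.Adj v w → N.dim s(↑v, w) ≤ d * R := by
    intro v w hvw
    rcases T.subcubic w with hw | hw
    · obtain ⟨l, hl⟩ := T.leaf.surjective ⟨w, hw⟩
      have hl' : (T.leaf l : Fin T.m) = w := congrArg Subtype.val hl
      have := N.dim_open l v (hl'.symm ▸ hvw.symm)
      rw [hl', Sym2.eq_swap] at this
      exact this.le.trans hdD
    · exact (Nat.le_floor (h.dim_le v ⟨w, hw⟩ hvw)).trans hRD
  refine ⟨_, ?_, h.represents ▸ simulator_simulates hn (Nat.mul_pos hd hR') hdD hdim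
    (by rw [h.represents, hψ])⟩
  have hfloor : (R : ℝ) ≤ (2 : ℝ) ^ chiWidth ψ := Nat.floor_le (by positivity)
  push_cast
  calc (500 * (q + 1) * (n * (d * R) ^ 6) : ℝ)
      = 500 * (q + 1) * d ^ 6 * n * (R : ℝ) ^ 6 := by ring
    _ ≤ _ := by gcongr

/-- `2 ^ (c log₂ n) = n ^ c`; the natural ceiling gives a natural exponent, for negative `c` as
well. -/
theorem two_rpow_pow_le_natCast_pow {χ c : ℝ} (hn : 2 ≤ n) (h : χ ≤ c * Real.logb 2 n) (k : ℕ) :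
    ((2 : ℝ) ^ χ) ^ k ≤ (n : ℝ) ^ (⌈c⌉₊ * k) := by
  have hn1 : (1 : ℝ) ≤ n := by exact_mod_cast (by omega : 1 ≤ n)
  rw [pow_mul]
  refine pow_le_pow_left₀ (by positivity) ?_ k
  calc (2 : ℝ) ^ χ ≤ 2 ^ (c * Real.logb 2 n) := Real.rpow_le_rpow_of_exponent_le one_le_two h
    _ = (n : ℝ) ^ c := by
      rw [mul_comm, Real.rpow_mul zero_le_two,
        Real.rpow_logb two_pos (by norm_num) (by linarith)]
    _ ≤ (n : ℝ) ^ (⌈c⌉₊ : ℝ) := Real.rpow_le_rpow_of_exponent_le hn1 (Nat.le_ceil c)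
    _ = (n : ℝ) ^ ⌈c⌉₊ := Real.rpow_natCast _ _

end RunningTime

end MQC

theorem theorem4 (d q : ℕ) :
    ∃ (S : MQC.Simulator) (C : ℝ) (k : ℕ),
      (∀ (n : ℕ) (_ : 3 ≤ n) (ψ : MQC.State n d) (_ : ψ.normSq = 1)
          (T : MQC.SubcubicTree n) (N : MQC.TTN T d), N.IsOptimalFor ψ →
        ∃ τ : ℕ, (τ : ℝ) ≤ C * n * ((2 : ℝ) ^ MQC.chiWidth ψ) ^ k ∧
          S.Simulates q N.encode ψ τ) ∧
      (∀ c : ℝ, ∃ C' : ℝ, ∀ (n : ℕ) (_ : 3 ≤ n) (ψ : MQC.State n d) (_ : ψ.normSq = 1),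
        MQC.chiWidth ψ ≤ c →
        ∃ (T : MQC.SubcubicTree n) (N : MQC.TTN T d), N.IsOptimalFor ψ ∧
          ∃ τ : ℕ, (τ : ℝ) ≤ C' * n ∧ S.Simulates q N.encode ψ τ) ∧
      (∀ c : ℝ, ∃ (C' : ℝ) (k' : ℕ), ∀ (n : ℕ) (_ : 3 ≤ n) (ψ : MQC.State n d)
          (_ : ψ.normSq = 1), MQC.chiWidth ψ ≤ c * Real.logb 2 n →
        ∃ (T : MQC.SubcubicTree n) (N : MQC.TTN T d), N.IsOptimalFor ψ ∧
          ∃ τ : ℕ, (τ : ℝ) ≤ C' * (n : ℝ) ^ k' ∧ S.Simulates q N.encode ψ τ) := by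
  refine ⟨MQC.simulator d q, 500 * (q + 1) * d ^ 6, 6, fun n hn ψ hψ T N hN =>
    hN.simulates q (by omega) hψ, fun c => ?_, fun c => ?_⟩
  · refine ⟨500 * (q + 1) * d ^ 6 * ((2 : ℝ) ^ c) ^ 6, fun n hn ψ hψ hc => ?_⟩
    obtain ⟨x₀⟩ := MQC.State.exists_index hψ
    obtain ⟨T, N, hN⟩ := MQC.exists_isOptimalFor hn ψ x₀
    obtain ⟨τ, hτ, hsim⟩ := hN.simulates q (by omega) hψ
    refine ⟨T, N, hN, τ, hτ.trans ?_, hsim⟩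
    rw [mul_right_comm]
    gcongr
    exact one_le_two
  · refine ⟨500 * (q + 1) * d ^ 6, 1 + ⌈c⌉₊ * 6, fun n hn ψ hψ hc => ?_⟩
    obtain ⟨x₀⟩ := MQC.State.exists_index hψ
    obtain ⟨T, N, hN⟩ := MQC.exists_isOptimalFor hn ψ x₀
    obtain ⟨τ, hτ, hsim⟩ := hN.simulates q (by omega) hψ
    refine ⟨T, N, hN, τ, hτ.trans ?_, hsim⟩
    rw [pow_add, pow_one, ← mul_assoc]
    gcongr
    exact MQC.two_rpow_pow_le_natCast_pow (by omega) hc 6
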